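/- Consider the Boiti–Leon–Pempinelli system $$u_{ty}=(u^2-u_x)_{xy}+2v_{xxx},\qquad v_t=v_{xx}+2uv_x$$ for real functions $u,v$ of real variables $(t,x,y)$. A point transformation on an open set $\Omega\subseteq\mathbb R^5$ with coordinates $(t,x,y,u,v)$ is a $C^\infty$ map $\Phi\colon\Omega\to\mathbb R^5$ with nowhere vanishing Jacobian determinant. It is a point symmetry of the system, i.e. an element of the complete point-symmetry pseudogroup $G$ of the system, if, whenever $\Phi$ maps the graph of a smooth pair $(u,v)$ over an open set $D\subseteq\mathbb R^3$ (this graph being contained in $\Omega$) onto the graph of a smooth pair $(\tilde u,\tilde v)$ over an open set $\tilde D\subseteq\mathbb R^3$, the pair $(u,v)$ is a solution of the system on $D$ if and only if $(\tilde u,\tilde v)$ is a solution of the system on $\tilde D$. Say that a map $\Phi$ is of the form $(*)$ on an open set $\Omega$ if there on $$\tilde t=T(t),\quad \tilde x=\varepsilon T_t^{1/2}x+X^0(t),\quad \tilde y=Y(y),\quad \tilde u=\frac{\varepsilon}{T_t^{1/2}}u-\frac{\varepsilon T_{tt}}{4T_t^{3/2}}x-\frac{X^0_t}{2T_t},\quad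 \tilde v=\frac{1}{Y_y}v+V^0(y)\qquad(*)$$ for some $\varepsilon\in\{1,-1\}$ and some smooth functions $T,X^0$ on the projection of $\Omega$ to the $t$-axis and $Y,V^0$ on the projection of $\Omega$ to the $y$-axis, with $T_t>0$ and $Y_y\ne0$. Then the complete point-symmetry pseudogroup $G$ consists exactly of the transformations of the form $(*)$: for every open $\Omega\subseteq\mathbb R^5$, a map $\Phi\colon\Omega\to\mathbb R^5$ is a point symmetry of the system on $\Omega$ if and only if every point of $\Omega$ has an open neighbourhood in $\Omega$ on which $\Phi$ is of the form $(*)$; and if $\Omega$ is moreover convex, $\Phi$ is a point symmetry on $\Omega$ if and only if it is of the form $(*)$ on all of $\Omega$. -/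

import Mathlib

open scoped ContDiff

namespace BLP

/-- The space of the independent variables `(t, x, y)`. -/
abbrev Base : Type := ℝ × ℝ × ℝ

/-- The space of the independent and dependent variables `(t, x, y, u, v)`. -/
abbrev Total : Type := ℝ × ℝ × ℝ × ℝ × ℝ

/-- Partial derivative with respect to `t`. -/
noncomputable def dt (f : Base → ℝ) : Base → ℝ := fun z => fderiv ℝ f z (1, 0, 0)

/-- Partial derivative with respect to `x`. -/
noncomputable def dx (f : Base → ℝ) : Base → ℝ := fun z => fderiv ℝ f z (0, 1, 0)

/-- Partial derivative with respect to `y`. -/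
noncomputable def dy (f : Base → ℝ) : Base → ℝ := fun z => fderiv ℝ f z (0, 0, 1)

/-- The pair `(u, v)` satisfies the Boiti–Leon–Pempinelli system
`u_{ty} = (u² - u_x)_{xy} + 2 v_{xxx}`, `v_t = v_{xx} + 2 u v_x` at every point of `D`.
It is used for open sets `D` and functions that are smooth on `D`. -/
def SolvesOn (D : Set Base) (u v : Base → ℝ) : Prop :=
  ∀ z ∈ D,
    dy (dt u) z = dy (dx (fun w => u w ^ 2 - dx u w)) z + 2 * dx (dx (dx v)) z ∧
    dt v z = dx (dx v) z + 2 * u z * dx v z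

/-- The point over `z` of the graph of the pair `(u, v)`. -/
def graphPoint (u v : Base → ℝ) (z : Base) : Total := (z.1, z.2.1, z.2.2, u z, v z)

/-- A point transformation on the open set `Ω` of the space with coordinates `(t, x, y, u, v)`:
a tuple of five smooth functions on `Ω` with nonvanishing Jacobian. -/
structure IsPointTransformation (Ω : Set Total) (Φ : Total → Total) : Prop where
  isOpen : IsOpen Ω
  smooth : ContDiffOn ℝ ∞ Φ Ω
  jacobian_ne_zero : ∀ p ∈ Ω, (fderiv ℝ Φ p).det ≠ 0

/-- A point symmetry of the Boiti–Leon–Pempinelli system on `Ω`, that is, an element of its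
complete point-symmetry pseudogroup: a point transformation that maps the system to the system of
the same form in the new variables. Whenever `Φ` carries the graph over an open set `D` of a smooth
pair `(u, v)` onto the graph over an open set `D'` of a smooth pair `(u', v')`, one pair is a
solution if and only if the other one is. -/
structure IsPointSymmetry (Ω : Set Total) (Φ : Total → Total) : Prop
    extends IsPointTransformation Ω Φ where
  solves_iff : ∀ (D D' : Set Base) (u v u' v' : Base → ℝ),
    IsOpen D → IsOpen D' →
    ContDiffOn ℝ ∞ u D → ContDiffOn ℝ ∞ v D →
    ContDiffOn ℝ ∞ u' D' → ContDiffOn ℝ ∞ v' D' →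
    (∀ z ∈ D, graphPoint u v z ∈ Ω) →
    (fun z => Φ (graphPoint u v z)) '' D = graphPoint u' v' '' D' →
    (SolvesOn D u v ↔ SolvesOn D' u' v')

/-- On `Ω`, the map `Φ` is given by
`t̃ = T(t)`, `x̃ = ε T_t^{1/2} x + X⁰(t)`, `ỹ = Y(y)`,
`ũ = ε T_t^{-1/2} u - ε T_{tt} T_t^{-3/2} x / 4 - X⁰_t / (2 T_t)`, `ṽ = v / Y_y + V⁰(y)`
with `ε = ±1` and smooth parameter functions `T`, `X⁰` on the projection of `Ω` to the `t`-axis and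
`Y`, `V⁰` on its projection to the `y`-axis, where `T_t > 0` and `Y_y ≠ 0`. -/
def HasForm (Ω : Set Total) (Φ : Total → Total) : Prop :=
  ∃ (ε : ℝ) (T X₀ Y V₀ : ℝ → ℝ),
    (ε = 1 ∨ ε = -1) ∧
    ContDiffOn ℝ ∞ T ((fun p : Total => p.1) '' Ω) ∧
    ContDiffOn ℝ ∞ X₀ ((fun p : Total => p.1) '' Ω) ∧
    ContDiffOn ℝ ∞ Y ((fun p : Total => p.2.2.1) '' Ω) ∧
    ContDiffOn ℝ ∞ V₀ ((fun p : Total => p.2.2.1) '' Ω) ∧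
    ∀ t x y u v : ℝ, (t, x, y, u, v) ∈ Ω →
      0 < deriv T t ∧ deriv Y y ≠ 0 ∧
      Φ (t, x, y, u, v) =
        (T t,
         ε * deriv T t ^ (1 / 2 : ℝ) * x + X₀ t,
         Y y,
         ε / deriv T t ^ (1 / 2 : ℝ) * u
           - ε * deriv (deriv T) t / (4 * deriv T t ^ (3 / 2 : ℝ)) * x
           - deriv X₀ t / (2 * deriv T t),
         v / deriv Y y + V₀ y)

end BLP

/-!
With `B(u) = u_t - 2uu_x + u_xx` the system reads `B(u)_y = 2v_xxx`, `v_t = v_xx + 2uv_x`.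

Solutions in separated variables realise at every point jets in which most first and second
derivatives are free. On the image graph the second equation becomes a polynomial identity in such
a jet; it forces `t̃, x̃, ỹ` to be free of `u` and `v`, `x̃` to be affine in `x` with
`t̃_t = x̃_x²`, and `ũ` to be the corresponding affine function of `u`. The substitution
`u = σũ + q` scales `B` by `σ³` up to a term depending on the base point alone, so solutions with
constant `v`, for which `B(u)` is free of `y`, show that `t̃` and `x̃` do not depend on `y`. What is
left of the first equation, tested on a solution with `v_xxx ≠ 0`, gives `ṽ_v ỹ_y = 1`. Conversely,
the same change of base variables carries the equations into one another.
-/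

namespace BLP

section DirectionalDerivative

variable {E F : Type*} [NormedAddCommGroup E] [NormedSpace ℝ E]
  [NormedAddCommGroup F] [NormedSpace ℝ F]

/-- The derivative of `f` in the direction `w`, as a function of the point; the partial derivatives
`dt`, `dx`, `dy` are the cases where `w` is a coordinate vector. -/
noncomputable def pd (w : E) (f : E → ℝ) : E → ℝ := fun z => fderiv ℝ f z w

variable {D : Set E} {f g : E → ℝ} {w z : E}

theorem contDiffAt_of_mem (hD : IsOpen D) (hz : z ∈ D) {G : E → F} (hG : ContDiffOn ℝ ∞ G D) :
    ContDiffAt ℝ ∞ G z :=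
  hG.contDiffAt (hD.mem_nhds hz)

theorem differentiableAt_of_mem (hD : IsOpen D) (hz : z ∈ D) {G : E → F}
    (hG : ContDiffOn ℝ ∞ G D) : DifferentiableAt ℝ G z :=
  (contDiffAt_of_mem hD hz hG).differentiableAt (by simp)

theorem contDiffOn_fderiv (hD : IsOpen D) {G : E → F} (hG : ContDiffOn ℝ ∞ G D) :
    ContDiffOn ℝ ∞ (fderiv ℝ G) D :=
  hG.fderiv_of_isOpen hD (by simp)

@[fun_prop]
theorem contDiffOn_pd (hD : IsOpen D) (w : E) (hf : ContDiffOn ℝ ∞ f D) :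
    ContDiffOn ℝ ∞ (pd w f) D :=
  (contDiffOn_fderiv hD hf).clm_apply contDiffOn_const

theorem pd_congr (hD : IsOpen D) (w : E) (h : ∀ z ∈ D, f z = g z) :
    ∀ z ∈ D, pd w f z = pd w g z := by
  intro z hz
  have : f =ᶠ[nhds z] g := Filter.eventuallyEq_of_mem (hD.mem_nhds hz) h
  simp only [pd, this.fderiv_eq]

theorem pd_const (w : E) (c : ℝ) (z : E) : pd w (fun _ => c) z = 0 := by
  simp [pd]

theorem pd_eq_zero_of_const (hD : IsOpen D) (w : E) {c : ℝ} (h : ∀ z ∈ D, f z = c) :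
    ∀ z ∈ D, pd w f z = 0 := fun z hz => by
  rw [pd_congr hD w h z hz, pd_const]

theorem pd_add (hD : IsOpen D) (hz : z ∈ D) (hf : ContDiffOn ℝ ∞ f D) (hg : ContDiffOn ℝ ∞ g D) :
    pd w (fun z => f z + g z) z = pd w f z + pd w g z := by
  simp [pd, fderiv_fun_add (differentiableAt_of_mem hD hz hf) (differentiableAt_of_mem hD hz hg)]

theorem pd_sub (hD : IsOpen D) (hz : z ∈ D) (hf : ContDiffOn ℝ ∞ f D) (hg : ContDiffOn ℝ ∞ g D) :
    pd w (fun z => f z - g z) z = pd w f z - pd w g z := by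
  simp [pd, fderiv_fun_sub (differentiableAt_of_mem hD hz hf) (differentiableAt_of_mem hD hz hg)]

theorem pd_mul (hD : IsOpen D) (hz : z ∈ D) (hf : ContDiffOn ℝ ∞ f D) (hg : ContDiffOn ℝ ∞ g D) :
    pd w (fun z => f z * g z) z = f z * pd w g z + g z * pd w f z := by
  simp [pd, fderiv_fun_mul (differentiableAt_of_mem hD hz hf) (differentiableAt_of_mem hD hz hg)]

theorem pd_inv (hD : IsOpen D) (hz : z ∈ D) (hf : ContDiffOn ℝ ∞ f D) (h0 : f z ≠ 0) :
    pd w (fun z => (f z)⁻¹) z = - pd w f z / f z ^ 2 := by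
  have h : HasFDerivAt (fun z => (f z)⁻¹) _ z :=
    (hasDerivAt_inv h0).comp_hasFDerivAt z (differentiableAt_of_mem hD hz hf).hasFDerivAt
  simp only [pd, h.fderiv, smul_eq_mul, smul_apply]
  ring

theorem pd_comm (hD : IsOpen D) (hz : z ∈ D) (hf : ContDiffOn ℝ ∞ f D) (w w' : E) :
    pd w (pd w' f) z = pd w' (pd w f) z := by
  have hd : DifferentiableAt ℝ (fderiv ℝ f) z :=
    differentiableAt_of_mem hD hz (contDiffOn_fderiv hD hf)
  have hsnd (a b : E) : pd a (pd b f) z = fderiv ℝ (fderiv ℝ f) z a b := by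
    have : fderiv ℝ (fun z => fderiv ℝ f z b) z = (fderiv ℝ (fderiv ℝ f) z).flip b := by
      simp [fderiv_clm_apply hd (differentiableAt_const b)]
    exact DFunLike.congr_fun this a
  rw [hsnd, hsnd]
  exact (contDiffAt_of_mem hD hz hf).isSymmSndFDerivAt
    (by rw [minSmoothness_of_isRCLikeNormedField]; exact WithTop.coe_le_coe.2 le_top) w w'

theorem pd_add_dir (w w' : E) (f : E → ℝ) (z : E) : pd (w + w') f z = pd w f z + pd w' f z := by
  simp [pd]

theorem pd_smul_dir (c : ℝ) (w : E) (f : E → ℝ) (z : E) : pd (c • w) f z = c * pd w f z := by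
  simp [pd]

theorem pd_pd_eq_zero (hD : IsOpen D) (hf : ContDiffOn ℝ ∞ f D) {e : E}
    (h : ∀ z ∈ D, pd e f z = 0) (w : E) : ∀ z ∈ D, pd e (pd w f) z = 0 := fun z hz => by
  rw [pd_comm hD hz hf e w, pd_eq_zero_of_const hD w h z hz]

theorem pd_comp {h : F → ℝ} {G : E → F} (hh : DifferentiableAt ℝ h (G z))
    (hG : DifferentiableAt ℝ G z) (w : E) :
    pd w (fun z => h (G z)) z = pd (fderiv ℝ G z w) h (G z) :=
  DFunLike.congr_fun (fderiv_comp z hh hG) w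

theorem pd_pd_comp {D' : Set F} {h : F → ℝ} {G : E → F} (hD : IsOpen D) (hD' : IsOpen D')
    (hz : z ∈ D) (hG : ContDiffOn ℝ ∞ G D) (hh : ContDiffOn ℝ ∞ h D') (hm : ∀ z ∈ D, G z ∈ D') :
    pd w (pd w (fun z => h (G z))) z =
      pd (fderiv ℝ G z w) (pd (fderiv ℝ G z w) h) (G z) +
        fderiv ℝ h (G z) (fderiv ℝ (fun z => fderiv ℝ G z w) z w) := by
  have hd : DifferentiableAt ℝ (fderiv ℝ h) (G z) :=
    differentiableAt_of_mem hD' (hm z hz) (contDiffOn_fderiv hD' hh)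
  have hGw : DifferentiableAt ℝ (fun z => fderiv ℝ G z w) z :=
    differentiableAt_of_mem hD hz ((contDiffOn_fderiv hD hG).clm_apply contDiffOn_const)
  have hfst : ∀ z ∈ D, pd w (fun z => h (G z)) z = fderiv ℝ h (G z) (fderiv ℝ G z w) :=
    fun z hz => pd_comp (differentiableAt_of_mem hD' (hm z hz) hh)
      (differentiableAt_of_mem hD hz hG) w
  have hsnd (b : F) : pd b (pd b h) (G z) = fderiv ℝ (fderiv ℝ h) (G z) b b := by
    change fderiv ℝ (fun y => fderiv ℝ h y b) (G z) b = _
    simp [fderiv_clm_apply hd (differentiableAt_const b)]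
  have hcomp : HasFDerivAt (fun z => fderiv ℝ h (G z)) _ z :=
    hd.hasFDerivAt.comp z (differentiableAt_of_mem hD hz hG).hasFDerivAt
  rw [pd_congr hD w hfst z hz, hsnd]
  change fderiv ℝ _ z w = _
  rw [(hcomp.clm_apply hGw.hasFDerivAt).fderiv]
  simp only [add_apply, ContinuousLinearMap.comp_apply,
    ContinuousLinearMap.flip_apply, add_comm]

end DirectionalDerivative

/-- The direction of the `t`-axis of the base. -/
abbrev et : Base := (1, 0, 0)

/-- The direction of the `x`-axis of the base. -/
abbrev ex : Base := (0, 1, 0)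

/-- The direction of the `y`-axis of the base. -/
abbrev ey : Base := (0, 0, 1)

theorem dt_eq : dt = pd et := rfl

theorem dx_eq : dx = pd ex := rfl

theorem dy_eq : dy = pd ey := rfl

/-- The backward Burgers expression `u_t - 2 u u_x + u_{xx}`: the first equation of the system reads
`burgers(u)_y = 2 v_{xxx}`. -/
noncomputable def burgers (u : Base → ℝ) : Base → ℝ :=
  fun z => pd et u z - 2 * (u z * pd ex u z) + pd ex (pd ex u) z

/-- The Boiti–Leon–Pempinelli system at the point `z`, in terms of `pd` and `burgers`. -/
def SolvesAt (u v : Base → ℝ) (z : Base) : Prop :=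
  pd ey (burgers u) z = 2 * pd ex (pd ex (pd ex v)) z ∧
    pd et v z = pd ex (pd ex v) z + 2 * u z * pd ex v z

section Base

variable {D : Set Base} {u v : Base → ℝ} {z : Base}

@[fun_prop]
theorem contDiffOn_burgers (hD : IsOpen D) (hu : ContDiffOn ℝ ∞ u D) :
    ContDiffOn ℝ ∞ (burgers u) D := by
  unfold burgers
  fun_prop (disch := assumption)

theorem pd_burgers (hD : IsOpen D) (hz : z ∈ D) (hu : ContDiffOn ℝ ∞ u D) (w : Base) :
    pd w (burgers u) z =
      pd w (pd et u) z - 2 * (u z * pd w (pd ex u) z + pd ex u z * pd w u z)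
        + pd w (pd ex (pd ex u)) z := by
  unfold burgers
  simp (disch := fun_prop (disch := assumption)) only
    [pd_add hD hz, pd_sub hD hz, pd_mul hD hz, pd_const, mul_zero, add_zero]

theorem pd_ey_burgers_eq_zero (hD : IsOpen D) (hu : ContDiffOn ℝ ∞ u D)
    (huy : ∀ z ∈ D, pd ey u z = 0) : ∀ z ∈ D, pd ey (burgers u) z = 0 := fun z hz => by
  have hux := pd_pd_eq_zero hD hu huy ex
  rw [pd_burgers hD hz hu, huy z hz, pd_pd_eq_zero hD hu huy et z hz, hux z hz,
    pd_pd_eq_zero hD (contDiffOn_pd hD ex hu) hux ex z hz]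
  ring

theorem solvesOn_iff (hD : IsOpen D) (hu : ContDiffOn ℝ ∞ u D) :
    SolvesOn D u v ↔ ∀ z ∈ D, SolvesAt u v z := by
  have hflux : ∀ z ∈ D, pd ex (fun w => u w ^ 2 - pd ex u w) z =
      2 * (u z * pd ex u z) - pd ex (pd ex u) z := fun z hz => by
    simp (disch := fun_prop (disch := assumption)) only [pow_two, pd_sub hD hz, pd_mul hD hz]
    ring
  have hflux_y : ∀ z ∈ D, pd ey (pd ex (fun w => u w ^ 2 - pd ex u w)) z =
      pd ey (pd et u) z - pd ey (burgers u) z := fun z hz => by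
    rw [pd_congr hD ey hflux z hz, pd_burgers hD hz hu]
    simp (disch := fun_prop (disch := assumption)) only
      [pd_sub hD hz, pd_mul hD hz, pd_const]
    ring
  refine forall₂_congr fun z hz => ?_
  simp only [dt_eq, dx_eq, dy_eq, SolvesAt]
  rw [hflux_y z hz]
  exact and_congr_left' ⟨fun h => by linarith, fun h => by linarith⟩

theorem pd_pd_pd_comm (hD : IsOpen D) (hz : z ∈ D) (hu : ContDiffOn ℝ ∞ u D) (w w' : Base) :
    pd w (pd w (pd w' u)) z = pd w' (pd w (pd w u)) z := by
  rw [pd_congr hD w (fun z hz => pd_comm hD hz hu w w') z hz,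
    pd_comm hD hz (contDiffOn_pd hD w hu)]

theorem burgers_potential {W u₀ : Base → ℝ} (hD : IsOpen D) (hz : z ∈ D)
    (hW : ContDiffOn ℝ ∞ W D) (hu₀ : ContDiffOn ℝ ∞ u₀ D)
    (heq : ∀ z ∈ D, pd et W z =
      pd ex (pd ex W) z + pd ex W z * pd ex W z + 2 * (u₀ z * pd ex W z)) :
    burgers (fun z => pd ex W z + u₀ z) z = 2 * pd ex (pd ex (pd ex W)) z + burgers u₀ z := by
  have hux : ∀ z ∈ D, pd ex (fun z => pd ex W z + u₀ z) z = pd ex (pd ex W) z + pd ex u₀ z :=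
    fun z hz => pd_add hD hz (contDiffOn_pd hD ex hW) hu₀
  have hWxt : pd et (pd ex W) z = _ :=
    (pd_comm hD hz hW et ex).trans (pd_congr hD ex heq z hz)
  simp only [burgers]
  rw [hux z hz, pd_congr hD ex hux z hz]
  simp (disch := fun_prop (disch := assumption)) only
    [hWxt, pd_add hD hz, pd_mul hD hz, pd_const]
  ring

/- With `u = W_x + u₀` and `v = W_y + V₀`, the second equation is the `y`-derivative of the equation
for `W`, and the first one the `y`-derivative of its `x`-derivative. -/
theorem solvesAt_of_potential {W u₀ V₀ : Base → ℝ} (hD : IsOpen D) (hW : ContDiffOn ℝ ∞ W D)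
    (hu₀ : ContDiffOn ℝ ∞ u₀ D) (hV₀ : ContDiffOn ℝ ∞ V₀ D)
    (heq : ∀ z ∈ D, pd et W z =
      pd ex (pd ex W) z + pd ex W z * pd ex W z + 2 * (u₀ z * pd ex W z))
    (hu₀y : ∀ z ∈ D, pd ey u₀ z = 0) (hV₀t : ∀ z ∈ D, pd et V₀ z = 0)
    (hV₀x : ∀ z ∈ D, pd ex V₀ z = 0) :
    ∀ z ∈ D, SolvesAt (fun z => pd ex W z + u₀ z) (fun z => pd ey W z + V₀ z) z := by
  have := contDiffOn_pd hD ex hW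
  have hvx : ∀ z ∈ D, pd ex (fun z => pd ey W z + V₀ z) z = pd ex (pd ey W) z := fun z hz => by
    rw [pd_add hD hz (contDiffOn_pd hD ey hW) hV₀, hV₀x z hz, add_zero]
  have hvxx : ∀ z ∈ D, pd ex (pd ex (fun z => pd ey W z + V₀ z)) z = pd ey (pd ex (pd ex W)) z :=
    fun z hz => (pd_congr hD ex hvx z hz).trans (pd_pd_pd_comm hD hz hW ex ey)
  intro z hz
  constructor
  · rw [pd_congr hD ey (fun z hz => burgers_potential hD hz hW hu₀ heq) z hz,
      pd_congr hD ex hvxx z hz, pd_comm hD hz (by fun_prop (disch := assumption)) ex ey]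
    simp (disch := fun_prop (disch := assumption)) only [pd_add hD hz, pd_mul hD hz, pd_const]
    rw [pd_ey_burgers_eq_zero hD hu₀ hu₀y z hz]
    ring
  · rw [hvxx z hz, hvx z hz, pd_comm hD hz hW ex ey, pd_add hD hz (contDiffOn_pd hD ey hW) hV₀,
      hV₀t z hz, pd_comm hD hz hW et ey, pd_congr hD ey heq z hz]
    simp (disch := fun_prop (disch := assumption)) only
      [pd_add hD hz, pd_mul hD hz, pd_const]
    rw [hu₀y z hz]
    ring

theorem pd_comp_base {D' : Set Base} {τ χ ψ g : Base → ℝ} (hD : IsOpen D) (hD' : IsOpen D')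
    (hz : z ∈ D) (hτ : ContDiffOn ℝ ∞ τ D) (hχ : ContDiffOn ℝ ∞ χ D) (hψ : ContDiffOn ℝ ∞ ψ D)
    (hg : ContDiffOn ℝ ∞ g D') (hm : ∀ z ∈ D, (τ z, χ z, ψ z) ∈ D') (w : Base) :
    pd w (fun z => g (τ z, χ z, ψ z)) z =
      pd w τ z * pd et g (τ z, χ z, ψ z) + pd w χ z * pd ex g (τ z, χ z, ψ z)
        + pd w ψ z * pd ey g (τ z, χ z, ψ z) := by
  have hφ := (differentiableAt_of_mem hD hz hτ).hasFDerivAt.prodMk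
    ((differentiableAt_of_mem hD hz hχ).hasFDerivAt.prodMk
      (differentiableAt_of_mem hD hz hψ).hasFDerivAt)
  have hsplit : ((fderiv ℝ τ z w, fderiv ℝ χ z w, fderiv ℝ ψ z w) : Base) =
      fderiv ℝ τ z w • et + fderiv ℝ χ z w • ex + fderiv ℝ ψ z w • ey := by
    simp [et, ex, ey]
  rw [pd_comp (G := fun z => (τ z, χ z, ψ z)) (differentiableAt_of_mem hD' (hm z hz) hg)
    hφ.differentiableAt, hφ.fderiv]
  simp only [pd, ContinuousLinearMap.prod_apply, hsplit, map_add, map_smul, smul_eq_mul]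

end Base

/-- Smooth functions `τ`, `χ`, `ψ`, `σ`, `q` on `D` with `τ = τ(t, y)`, `ψ = ψ(y)`, `χ_x = σ ≠ 0`,
`σ_x = 0`, `τ_t = σ²` and `χ_t = 2 σ q`. Then `(τ, χ, ψ)` is a change of the independent variables
under which the second equation of the system is preserved when `u` is replaced by `σ u + q`. -/
structure IsBaseChange (D : Set Base) (τ χ ψ σ q : Base → ℝ) : Prop where
  isOpen : IsOpen D
  smooth_τ : ContDiffOn ℝ ∞ τ D
  smooth_χ : ContDiffOn ℝ ∞ χ D
  smooth_ψ : ContDiffOn ℝ ∞ ψ D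
  smooth_σ : ContDiffOn ℝ ∞ σ D
  smooth_q : ContDiffOn ℝ ∞ q D
  σ_ne_zero : ∀ z ∈ D, σ z ≠ 0
  pd_ex_τ : ∀ z ∈ D, pd ex τ z = 0
  pd_ex_ψ : ∀ z ∈ D, pd ex ψ z = 0
  pd_et_ψ : ∀ z ∈ D, pd et ψ z = 0
  pd_ex_χ : ∀ z ∈ D, pd ex χ z = σ z
  pd_ex_σ : ∀ z ∈ D, pd ex σ z = 0
  pd_et_τ : ∀ z ∈ D, pd et τ z = σ z ^ 2
  pd_et_χ : ∀ z ∈ D, pd et χ z = 2 * (σ z * q z)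

namespace IsBaseChange

variable {D D' : Set Base} {τ χ ψ σ q c g u u' v v' a b : Base → ℝ} {z : Base}

theorem pd_ex_q (h : IsBaseChange D τ χ ψ σ q) : ∀ z ∈ D, 2 * (σ z * pd ex q z) = pd et σ z := by
  intro z hz
  have hD := h.isOpen
  have hσ := h.smooth_σ
  have hq := h.smooth_q
  rw [← pd_congr hD et h.pd_ex_χ z hz, pd_comm hD hz h.smooth_χ, pd_congr hD ex h.pd_et_χ z hz]
  simp (disch := fun_prop) only [pd_mul hD hz, pd_const, h.pd_ex_σ z hz]
  ring

theorem pd_ex_pd_ex_q (h : IsBaseChange D τ χ ψ σ q) : ∀ z ∈ D, pd ex (pd ex q) z = 0 := by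
  intro z hz
  have hD := h.isOpen
  have hσ := h.smooth_σ
  have hq := h.smooth_q
  have hσqxx : 2 * (σ z * pd ex (pd ex q) z) = 0 := by
    rw [← pd_pd_eq_zero hD hσ h.pd_ex_σ et z hz, ← pd_congr hD ex h.pd_ex_q z hz]
    simp (disch := fun_prop (disch := assumption)) only
      [pd_mul hD hz, pd_const, h.pd_ex_σ z hz]
    ring
  simpa [h.σ_ne_zero z hz] using hσqxx

theorem pd_ey_q (h : IsBaseChange D τ χ ψ σ q) (hχy : ∀ z ∈ D, pd ey χ z = 0)
    (hσy : ∀ z ∈ D, pd ey σ z = 0) : ∀ z ∈ D, pd ey q z = 0 := by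
  intro z hz
  have hD := h.isOpen
  have hσ := h.smooth_σ
  have hq := h.smooth_q
  have hσqy : 2 * (σ z * pd ey q z) = 0 := by
    rw [← pd_pd_eq_zero hD h.smooth_χ hχy et z hz, pd_congr hD ey h.pd_et_χ z hz]
    simp (disch := fun_prop) only [pd_mul hD hz, pd_const, hσy z hz]
    ring
  simpa [h.σ_ne_zero z hz] using hσqy

theorem contDiffOn_comp (h : IsBaseChange D τ χ ψ σ q) (hm : ∀ z ∈ D, (τ z, χ z, ψ z) ∈ D')
    (hg : ContDiffOn ℝ ∞ g D') : ContDiffOn ℝ ∞ (fun z => g (τ z, χ z, ψ z)) D :=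
  hg.comp (h.smooth_τ.prodMk (h.smooth_χ.prodMk h.smooth_ψ)) hm

theorem pd_et_comp (h : IsBaseChange D τ χ ψ σ q) (hD' : IsOpen D')
    (hm : ∀ z ∈ D, (τ z, χ z, ψ z) ∈ D') (hz : z ∈ D) (hg : ContDiffOn ℝ ∞ g D') :
    pd et (fun z => g (τ z, χ z, ψ z)) z =
      σ z ^ 2 * pd et g (τ z, χ z, ψ z) + 2 * (σ z * q z) * pd ex g (τ z, χ z, ψ z) := by
  rw [pd_comp_base h.isOpen hD' hz h.smooth_τ h.smooth_χ h.smooth_ψ hg hm et, h.pd_et_τ z hz,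
    h.pd_et_ψ z hz, h.pd_et_χ z hz]
  ring

theorem pd_ex_comp (h : IsBaseChange D τ χ ψ σ q) (hD' : IsOpen D')
    (hm : ∀ z ∈ D, (τ z, χ z, ψ z) ∈ D') (hz : z ∈ D) (hg : ContDiffOn ℝ ∞ g D') :
    pd ex (fun z => g (τ z, χ z, ψ z)) z = σ z * pd ex g (τ z, χ z, ψ z) := by
  rw [pd_comp_base h.isOpen hD' hz h.smooth_τ h.smooth_χ h.smooth_ψ hg hm ex, h.pd_ex_τ z hz,
    h.pd_ex_ψ z hz, h.pd_ex_χ z hz]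
  ring

theorem pd_ex_mul_comp (h : IsBaseChange D τ χ ψ σ q) (hD' : IsOpen D')
    (hm : ∀ z ∈ D, (τ z, χ z, ψ z) ∈ D') (hc : ContDiffOn ℝ ∞ c D)
    (hcx : ∀ z ∈ D, pd ex c z = 0) (hg : ContDiffOn ℝ ∞ g D') :
    ∀ z ∈ D, pd ex (fun z => c z * g (τ z, χ z, ψ z)) z =
      c z * σ z * pd ex g (τ z, χ z, ψ z) := fun z hz => by
  rw [pd_mul h.isOpen hz hc (h.contDiffOn_comp hm hg), h.pd_ex_comp hD' hm hz hg, hcx z hz]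
  ring

theorem pd_ex_mul_σ (h : IsBaseChange D τ χ ψ σ q) (hc : ContDiffOn ℝ ∞ c D)
    (hcx : ∀ z ∈ D, pd ex c z = 0) : ∀ z ∈ D, pd ex (fun z => c z * σ z) z = 0 := fun z hz => by
  rw [pd_mul h.isOpen hz hc h.smooth_σ, hcx z hz, h.pd_ex_σ z hz]
  ring

theorem burgers_eq (h : IsBaseChange D τ χ ψ σ q) (hD' : IsOpen D')
    (hm : ∀ z ∈ D, (τ z, χ z, ψ z) ∈ D') (hu' : ContDiffOn ℝ ∞ u' D')
    (hu : ∀ z ∈ D, u z = σ z * u' (τ z, χ z, ψ z) + q z) :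
    ∀ z ∈ D, burgers u z = σ z * σ z * σ z * burgers u' (τ z, χ z, ψ z) + burgers q z := by
  have hD := h.isOpen
  have hσ := h.smooth_σ
  have hq := h.smooth_q
  have hu'φ := h.contDiffOn_comp hm hu'
  have hu'xφ := h.contDiffOn_comp hm (contDiffOn_pd hD' ex hu')
  have hux : ∀ z ∈ D, pd ex u z = σ z * σ z * pd ex u' (τ z, χ z, ψ z) + pd ex q z := fun z hz => by
    rw [pd_congr hD ex hu z hz, pd_add hD hz (hσ.mul hu'φ) hq,
      h.pd_ex_mul_comp hD' hm hσ h.pd_ex_σ hu' z hz]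
  have huxx : ∀ z ∈ D, pd ex (pd ex u) z =
      σ z * σ z * σ z * pd ex (pd ex u') (τ z, χ z, ψ z) := fun z hz => by
    rw [pd_congr hD ex hux z hz, pd_add hD hz ((hσ.mul hσ).mul hu'xφ) (contDiffOn_pd hD ex hq),
      h.pd_ex_mul_comp hD' hm (hσ.mul hσ) (h.pd_ex_mul_σ hσ h.pd_ex_σ)
        (contDiffOn_pd hD' ex hu') z hz,
      h.pd_ex_pd_ex_q z hz, add_zero]
  intro z hz
  simp only [burgers]
  rw [huxx z hz, hux z hz, hu z hz, pd_congr hD et hu z hz, pd_add hD hz (hσ.mul hu'φ) hq,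
    pd_mul hD hz hσ hu'φ, h.pd_et_comp hD' hm hz hu', h.pd_ex_pd_ex_q z hz, ← h.pd_ex_q z hz]
  ring

theorem pd_ey_burgers_eq (h : IsBaseChange D τ χ ψ σ q) (hD' : IsOpen D')
    (hm : ∀ z ∈ D, (τ z, χ z, ψ z) ∈ D') (hτy : ∀ z ∈ D, pd ey τ z = 0)
    (hχy : ∀ z ∈ D, pd ey χ z = 0) (hu' : ContDiffOn ℝ ∞ u' D')
    (hu : ∀ z ∈ D, u z = σ z * u' (τ z, χ z, ψ z) + q z) :
    ∀ z ∈ D, pd ey (burgers u) z =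
      σ z ^ 3 * pd ey ψ z * pd ey (burgers u') (τ z, χ z, ψ z) := by
  have hD := h.isOpen
  have hσ := h.smooth_σ
  have hBq := contDiffOn_burgers hD h.smooth_q
  have hBu' := contDiffOn_burgers hD' hu'
  have hBu'φ := h.contDiffOn_comp hm hBu'
  have hσy : ∀ z ∈ D, pd ey σ z = 0 := fun z hz => by
    rw [← pd_congr hD ey h.pd_ex_χ z hz, pd_pd_eq_zero hD h.smooth_χ hχy ex z hz]
  intro z hz
  rw [pd_congr hD ey (h.burgers_eq hD' hm hu' hu) z hz]
  simp (disch := fun_prop (disch := assumption)) only [pd_add hD hz, pd_mul hD hz, hσy z hz,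
    pd_ey_burgers_eq_zero hD h.smooth_q (h.pd_ey_q hχy hσy) z hz]
  rw [pd_comp_base hD hD' hz h.smooth_τ h.smooth_χ h.smooth_ψ hBu' hm ey, hτy z hz, hχy z hz]
  ring

theorem pd_ex_affine (h : IsBaseChange D τ χ ψ σ q) (hD' : IsOpen D')
    (hm : ∀ z ∈ D, (τ z, χ z, ψ z) ∈ D') (hv' : ContDiffOn ℝ ∞ v' D')
    (ha : ContDiffOn ℝ ∞ a D) (hax : ∀ z ∈ D, pd ex a z = 0)
    (hb : ContDiffOn ℝ ∞ b D) (hbx : ∀ z ∈ D, pd ex b z = 0)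
    (hv : ∀ z ∈ D, v z = a z * v' (τ z, χ z, ψ z) + b z) :
    (∀ z ∈ D, pd ex v z = a z * σ z * pd ex v' (τ z, χ z, ψ z)) ∧
    (∀ z ∈ D, pd ex (pd ex v) z = a z * σ z * σ z * pd ex (pd ex v') (τ z, χ z, ψ z)) ∧
    ∀ z ∈ D, pd ex (pd ex (pd ex v)) z =
      a z * σ z * σ z * σ z * pd ex (pd ex (pd ex v')) (τ z, χ z, ψ z) := by
  have hD := h.isOpen
  have hv'x := contDiffOn_pd hD' ex hv'
  have haσ : ContDiffOn ℝ ∞ (fun z => a z * σ z) D := ha.mul h.smooth_σ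
  have haσx := h.pd_ex_mul_σ ha hax
  have hvx : ∀ z ∈ D, pd ex v z = a z * σ z * pd ex v' (τ z, χ z, ψ z) := fun z hz => by
    rw [pd_congr hD ex hv z hz, pd_add hD hz (ha.mul (h.contDiffOn_comp hm hv')) hb, hbx z hz,
      h.pd_ex_mul_comp hD' hm ha hax hv' z hz, add_zero]
  have hvxx : ∀ z ∈ D, pd ex (pd ex v) z = a z * σ z * σ z * pd ex (pd ex v') (τ z, χ z, ψ z) :=
    fun z hz => by rw [pd_congr hD ex hvx z hz, h.pd_ex_mul_comp hD' hm haσ haσx hv'x z hz]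
  refine ⟨hvx, hvxx, fun z hz => ?_⟩
  rw [pd_congr hD ex hvxx z hz, h.pd_ex_mul_comp hD' hm (haσ.mul h.smooth_σ)
    (h.pd_ex_mul_σ haσ haσx) (contDiffOn_pd hD' ex hv'x) z hz]

theorem second_equation_eq (h : IsBaseChange D τ χ ψ σ q) (hD' : IsOpen D')
    (hm : ∀ z ∈ D, (τ z, χ z, ψ z) ∈ D') (hv' : ContDiffOn ℝ ∞ v' D')
    (hu : ∀ z ∈ D, u z = σ z * u' (τ z, χ z, ψ z) + q z)
    (ha : ContDiffOn ℝ ∞ a D) (hat : ∀ z ∈ D, pd et a z = 0) (hax : ∀ z ∈ D, pd ex a z = 0)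
    (hb : ContDiffOn ℝ ∞ b D) (hbt : ∀ z ∈ D, pd et b z = 0) (hbx : ∀ z ∈ D, pd ex b z = 0)
    (hv : ∀ z ∈ D, v z = a z * v' (τ z, χ z, ψ z) + b z) :
    ∀ z ∈ D, pd et v z - (pd ex (pd ex v) z + 2 * u z * pd ex v z) =
      a z * σ z ^ 2 * (pd et v' (τ z, χ z, ψ z) - (pd ex (pd ex v') (τ z, χ z, ψ z)
        + 2 * u' (τ z, χ z, ψ z) * pd ex v' (τ z, χ z, ψ z))) := by
  have hD := h.isOpen
  obtain ⟨hvx, hvxx, -⟩ := h.pd_ex_affine hD' hm hv' ha hax hb hbx hv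
  have hv'φ := h.contDiffOn_comp hm hv'
  intro z hz
  rw [hvxx z hz, hvx z hz, hu z hz, pd_congr hD et hv z hz, pd_add hD hz (ha.mul hv'φ) hb, hbt z hz,
    pd_mul hD hz ha hv'φ, hat z hz, h.pd_et_comp hD' hm hz hv']
  ring

end IsBaseChange

theorem IsBaseChange.solvesAt_iff {D D' : Set Base} {τ χ ψ σ q u u' v v' b : Base → ℝ}
    (h : IsBaseChange D τ χ ψ σ q) (hD' : IsOpen D') (hm : ∀ z ∈ D, (τ z, χ z, ψ z) ∈ D')
    (hτy : ∀ z ∈ D, pd ey τ z = 0) (hχy : ∀ z ∈ D, pd ey χ z = 0)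
    (hψy : ∀ z ∈ D, pd ey ψ z ≠ 0) (hu' : ContDiffOn ℝ ∞ u' D') (hv' : ContDiffOn ℝ ∞ v' D')
    (hb : ContDiffOn ℝ ∞ b D) (hbt : ∀ z ∈ D, pd et b z = 0) (hbx : ∀ z ∈ D, pd ex b z = 0)
    (hu : ∀ z ∈ D, u z = σ z * u' (τ z, χ z, ψ z) + q z)
    (hv : ∀ z ∈ D, v z = pd ey ψ z * v' (τ z, χ z, ψ z) + b z) :
    ∀ z ∈ D, SolvesAt u v z ↔ SolvesAt u' v' (τ z, χ z, ψ z) := by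
  have hψ_y := contDiffOn_pd h.isOpen ey h.smooth_ψ
  have hψ_yt := pd_pd_eq_zero h.isOpen h.smooth_ψ h.pd_et_ψ ey
  have hψ_yx := pd_pd_eq_zero h.isOpen h.smooth_ψ h.pd_ex_ψ ey
  intro z hz
  have hσ := h.σ_ne_zero z hz
  have hψyz := hψy z hz
  have hsecond := h.second_equation_eq hD' hm hv' hu hψ_y hψ_yt hψ_yx hb hbt hbx hv z hz
  obtain ⟨-, -, hvxxx⟩ := h.pd_ex_affine hD' hm hv' hψ_y hψ_yx hb hbx hv
  refine and_congr ?_ ?_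
  · have hfactor : σ z ^ 3 * pd ey ψ z ≠ 0 := by positivity
    rw [h.pd_ey_burgers_eq hD' hm hτy hχy hu' hu z hz, hvxxx z hz]
    constructor <;> intro heq
    · apply mul_left_cancel₀ hfactor
      linear_combination heq
    · linear_combination σ z ^ 3 * pd ey ψ z * heq
  · have hfactor : pd ey ψ z * σ z ^ 2 ≠ 0 := by positivity
    rw [← sub_eq_zero, hsecond, mul_eq_zero, or_iff_right hfactor, sub_eq_zero]

section LinearForm

variable {E : Type*} [NormedAddCommGroup E] [NormedSpace ℝ E]

theorem pd_clm (L : E →L[ℝ] ℝ) (w z : E) : pd w (fun z => L z) z = L w := by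
  simp [pd]

theorem pd_comp_clm {I : Set ℝ} (hI : IsOpen I) {g : ℝ → ℝ} (hg : ContDiffOn ℝ ∞ g I)
    (L : E →L[ℝ] ℝ) {z : E} (hz : L z ∈ I) (w : E) :
    pd w (fun z => g (L z)) z = L w * deriv g (L z) := by
  have h : HasFDerivAt (fun z => g (L z)) _ z :=
    (differentiableAt_of_mem hI hz hg).hasDerivAt.comp_hasFDerivAt z L.hasFDerivAt
  simp only [pd, h.fderiv, smul_apply, smul_eq_mul, mul_comm]

theorem contDiffOn_comp_clm {I : Set ℝ} {D : Set E} {g : ℝ → ℝ} (hg : ContDiffOn ℝ ∞ g I)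
    (L : E →L[ℝ] ℝ) (h : ∀ z ∈ D, L z ∈ I) : ContDiffOn ℝ ∞ (fun z => g (L z)) D :=
  hg.comp L.contDiff.contDiffOn h

end LinearForm

/-- The coordinate `t` on the base. -/
abbrev tBase : Base →L[ℝ] ℝ := .fst ℝ ℝ (ℝ × ℝ)

/-- The coordinate `x` on the base. -/
abbrev xBase : Base →L[ℝ] ℝ := .comp (.fst ℝ ℝ ℝ) (.snd ℝ ℝ (ℝ × ℝ))

/-- The coordinate `y` on the base. -/
abbrev yBase : Base →L[ℝ] ℝ := .comp (.snd ℝ ℝ ℝ) (.snd ℝ ℝ (ℝ × ℝ))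

/-- The coordinate `t` on the total space. -/
abbrev tTotal : Total →L[ℝ] ℝ := .fst ℝ ℝ (ℝ × ℝ × ℝ × ℝ)

/-- The coordinate `x` on the total space. -/
abbrev xTotal : Total →L[ℝ] ℝ := .comp (.fst ℝ ℝ (ℝ × ℝ × ℝ)) (.snd ℝ ℝ (ℝ × ℝ × ℝ × ℝ))

/-- The coordinate `y` on the total space. -/
abbrev yTotal : Total →L[ℝ] ℝ :=
  .comp (.fst ℝ ℝ (ℝ × ℝ)) (.comp (.snd ℝ ℝ (ℝ × ℝ × ℝ)) (.snd ℝ ℝ (ℝ × ℝ × ℝ × ℝ)))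

/-- The coordinate `u` on the total space. -/
abbrev uTotal : Total →L[ℝ] ℝ :=
  .comp (.fst ℝ ℝ ℝ) (.comp (.snd ℝ ℝ (ℝ × ℝ))
    (.comp (.snd ℝ ℝ (ℝ × ℝ × ℝ)) (.snd ℝ ℝ (ℝ × ℝ × ℝ × ℝ))))

/-- The coordinate `v` on the total space. -/
abbrev vTotal : Total →L[ℝ] ℝ :=
  .comp (.snd ℝ ℝ ℝ) (.comp (.snd ℝ ℝ (ℝ × ℝ))
    (.comp (.snd ℝ ℝ (ℝ × ℝ × ℝ)) (.snd ℝ ℝ (ℝ × ℝ × ℝ × ℝ))))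

/-- The projection of the total space to the space of the independent variables. -/
abbrev proj : Total →L[ℝ] Base := tTotal.prod (xTotal.prod yTotal)

theorem isOpen_image_tTotal {Ω : Set Total} (hΩ : IsOpen Ω) : IsOpen (tTotal '' Ω) :=
  isOpenMap_fst Ω hΩ

theorem isOpen_image_yTotal {Ω : Set Total} (hΩ : IsOpen Ω) : IsOpen (yTotal '' Ω) :=
  (isOpenMap_fst.comp (isOpenMap_snd.comp isOpenMap_snd)) Ω hΩ

theorem contDiffOn_graphPoint {D : Set Base} {u v : Base → ℝ} (hu : ContDiffOn ℝ ∞ u D)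
    (hv : ContDiffOn ℝ ∞ v D) : ContDiffOn ℝ ∞ (graphPoint u v) D := by
  unfold graphPoint
  fun_prop

theorem isOpen_graph_preimage {D : Set Base} {u v : Base → ℝ} {Ω : Set Total} (hD : IsOpen D)
    (hΩ : IsOpen Ω) (hu : ContDiffOn ℝ ∞ u D) (hv : ContDiffOn ℝ ∞ v D) :
    IsOpen (D ∩ graphPoint u v ⁻¹' Ω) :=
  (contDiffOn_graphPoint hu hv).continuousOn.isOpen_inter_preimage hD hΩ

/-- The map `Φ` has the form `(*)` on the open set `Ω`, with `S = ε T_t^{1/2}` as a parameter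
function of its own: `T_t = S²`, and the coefficients of `(*)` become rational in `S`, `S_t`,
`X⁰_t`. -/
structure HasFormWith (Ω : Set Total) (Φ : Total → Total) (T S X₀ Y V₀ : ℝ → ℝ) : Prop where
  isOpen : IsOpen Ω
  smooth_T : ContDiffOn ℝ ∞ T (tTotal '' Ω)
  smooth_S : ContDiffOn ℝ ∞ S (tTotal '' Ω)
  smooth_X₀ : ContDiffOn ℝ ∞ X₀ (tTotal '' Ω)
  smooth_Y : ContDiffOn ℝ ∞ Y (yTotal '' Ω)
  smooth_V₀ : ContDiffOn ℝ ∞ V₀ (yTotal '' Ω)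
  deriv_T : ∀ t ∈ tTotal '' Ω, deriv T t = S t ^ 2
  S_ne_zero : ∀ t ∈ tTotal '' Ω, S t ≠ 0
  deriv_Y_ne_zero : ∀ y ∈ yTotal '' Ω, deriv Y y ≠ 0
  apply_eq : ∀ p ∈ Ω, Φ p = (T (tTotal p), S (tTotal p) * xTotal p + X₀ (tTotal p), Y (yTotal p),
    uTotal p / S (tTotal p)
      - (deriv S (tTotal p) * xTotal p + deriv X₀ (tTotal p)) / (2 * S (tTotal p) ^ 2),
    vTotal p / deriv Y (yTotal p) + V₀ (yTotal p))

section Root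

variable {s : ℝ}

theorem sq_rpow_half (hs : 0 < s) : (s ^ (1 / 2 : ℝ)) ^ 2 = s := by
  rw [← Real.sqrt_eq_rpow, Real.sq_sqrt hs.le]

theorem rpow_three_halves (hs : 0 < s) : s ^ (3 / 2 : ℝ) = (s ^ (1 / 2 : ℝ)) ^ 3 := by
  rw [← Real.rpow_natCast, ← Real.rpow_mul hs.le]; norm_num

theorem deriv_rpow_half {g : ℝ → ℝ} {t : ℝ} (hg : DifferentiableAt ℝ g t) (h0 : 0 < g t) :
    deriv (fun s => g s ^ (1 / 2 : ℝ)) t = deriv g t / (2 * g t ^ (1 / 2 : ℝ)) := by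
  simp only [← Real.sqrt_eq_rpow]
  exact (hg.hasDerivAt.sqrt h0.ne').deriv

end Root

theorem HasForm.exists_hasFormWith {Ω : Set Total} {Φ : Total → Total} (hΩ : IsOpen Ω)
    (h : HasForm Ω Φ) : ∃ T S X₀ Y V₀, HasFormWith Ω Φ T S X₀ Y V₀ := by
  obtain ⟨ε, T, X₀, Y, V₀, hε, hT, hX₀, hY, hV₀, hform⟩ := h
  have hε2 : ε ^ 2 = 1 := sq_eq_one_iff.2 hε
  have hI := isOpen_image_tTotal hΩ
  have hTt : ContDiffOn ℝ ∞ (deriv T) (tTotal '' Ω) := hT.deriv_of_isOpen hI (by simp)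
  have hTtpos : ∀ t ∈ tTotal '' Ω, 0 < deriv T t := by
    rintro _ ⟨p, hp, rfl⟩
    exact (hform _ _ _ _ _ hp).1
  have hroot : ∀ t ∈ tTotal '' Ω, 0 < deriv T t ^ (1 / 2 : ℝ) := fun t ht =>
    Real.rpow_pos_of_pos (hTtpos t ht) _
  have hSt : ∀ t ∈ tTotal '' Ω, deriv (fun t => ε * deriv T t ^ (1 / 2 : ℝ)) t =
      ε * (deriv (deriv T) t / (2 * deriv T t ^ (1 / 2 : ℝ))) := fun t ht => by
    rw [deriv_const_mul_field, deriv_rpow_half (differentiableAt_of_mem hI ht hTt) (hTtpos t ht)]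
  refine ⟨T, fun t => ε * deriv T t ^ (1 / 2 : ℝ), X₀, Y, V₀,
    { isOpen := hΩ
      smooth_T := hT
      smooth_S := contDiffOn_const.mul (hTt.rpow_const_of_ne fun t ht => (hTtpos t ht).ne')
      smooth_X₀ := hX₀
      smooth_Y := hY
      smooth_V₀ := hV₀
      deriv_T := fun t ht => by rw [mul_pow, hε2, sq_rpow_half (hTtpos t ht), one_mul]
      S_ne_zero := fun t ht => mul_ne_zero (by rintro rfl; simp at hε2) (hroot t ht).ne'
      deriv_Y_ne_zero := by
        rintro _ ⟨p, hp, rfl⟩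
        exact (hform _ _ _ _ _ hp).2.1
      apply_eq := ?_ }⟩
  rintro ⟨t, x, y, u, v⟩ hp
  have ht : t ∈ tTotal '' Ω := ⟨_, hp, rfl⟩
  have hr := hroot t ht
  obtain ⟨-, -, hΦ⟩ := hform t x y u v hp
  simp only [hΦ, tTotal, xTotal, yTotal, uTotal, vTotal, ContinuousLinearMap.coe_fst',
    ContinuousLinearMap.comp_apply, ContinuousLinearMap.coe_snd', hSt t ht,
    rpow_three_halves (hTtpos t ht)]
  congr 4
  have hTt_eq := (sq_rpow_half (hTtpos t ht)).symm
  set r := deriv T t ^ (1 / 2 : ℝ)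
  rw [mul_pow, hε2, hTt_eq]
  rcases hε with rfl | rfl <;> field_simp <;> ring

theorem abs_eq_rpow_half {a b : ℝ} (h : a = b ^ 2) : a ^ (1 / 2 : ℝ) = |b| := by
  rw [← Real.sqrt_eq_rpow, h, Real.sqrt_sq_eq_abs]

namespace HasFormWith

variable {Ω : Set Total} {Φ : Total → Total} {T S X₀ Y V₀ : ℝ → ℝ}

theorem hasForm (h : HasFormWith Ω Φ T S X₀ Y V₀) (hc : IsPreconnected Ω) : HasForm Ω Φ := by
  obtain ⟨ε, hε, hS⟩ : ∃ ε : ℝ, (ε = 1 ∨ ε = -1) ∧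
      ∀ t ∈ tTotal '' Ω, S t = ε * |S t| := by
    have hI : IsPreconnected (tTotal '' Ω) := hc.image _ tTotal.continuous.continuousOn
    rcases hI.eq_or_eq_neg_of_sq_eq h.smooth_S.continuousOn h.smooth_S.continuousOn.abs
      (fun t _ => by simp) (fun {t} ht => abs_ne_zero.2 (h.S_ne_zero t ht)) with hS | hS
    · exact ⟨1, Or.inl rfl, fun t ht => by rw [one_mul]; exact hS ht⟩
    · exact ⟨-1, Or.inr rfl, fun t ht => by rw [neg_one_mul]; exact hS ht⟩
  have hε2 : ε ^ 2 = 1 := sq_eq_one_iff.2 hε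
  refine ⟨ε, T, X₀, Y, V₀, hε, h.smooth_T, h.smooth_X₀, h.smooth_Y, h.smooth_V₀,
    fun t x y u v hp => ?_⟩
  have ht : t ∈ tTotal '' Ω := ⟨_, hp, rfl⟩
  have hS0 := h.S_ne_zero t ht
  have hTtpos : 0 < deriv T t := by rw [h.deriv_T t ht]; positivity
  have hTtt : deriv (deriv T) t = 2 * S t * deriv S t := by
    have hI := isOpen_image_tTotal h.isOpen
    have hT : deriv T =ᶠ[nhds t] fun t => S t ^ 2 :=
      Filter.eventuallyEq_of_mem (hI.mem_nhds ht) h.deriv_T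
    rw [hT.deriv_eq, deriv_fun_pow (differentiableAt_of_mem hI ht h.smooth_S)]
    simp
  refine ⟨hTtpos, h.deriv_Y_ne_zero y ⟨_, hp, rfl⟩, (h.apply_eq _ hp).trans ?_⟩
  simp only [tTotal, xTotal, yTotal, uTotal, vTotal, ContinuousLinearMap.coe_fst',
    ContinuousLinearMap.comp_apply, ContinuousLinearMap.coe_snd']
  rw [rpow_three_halves hTtpos, abs_eq_rpow_half (h.deriv_T t ht), hTtt, h.deriv_T t ht]
  have hSt := hS t ht
  have habs : |S t| = ε * S t := by linear_combination ε * -hSt - |S t| * hε2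
  rw [← hSt, habs]
  congr 4
  rcases hε with rfl | rfl <;> field_simp <;> ring

theorem isBaseChange (h : HasFormWith Ω Φ T S X₀ Y V₀) {D : Set Base} (hD : IsOpen D)
    (ht : ∀ z ∈ D, tBase z ∈ tTotal '' Ω) (hy : ∀ z ∈ D, yBase z ∈ yTotal '' Ω) :
    IsBaseChange D (fun z => T (tBase z)) (fun z => S (tBase z) * xBase z + X₀ (tBase z))
      (fun z => Y (yBase z)) (fun z => S (tBase z))
      (fun z => (deriv S (tBase z) * xBase z + deriv X₀ (tBase z)) / (2 * S (tBase z))) := by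
  have hI := isOpen_image_tTotal h.isOpen
  have hJ := isOpen_image_yTotal h.isOpen
  have hSt := contDiffOn_comp_clm h.smooth_S tBase ht
  have hX₀t := contDiffOn_comp_clm h.smooth_X₀ tBase ht
  have hS't := contDiffOn_comp_clm (h.smooth_S.deriv_of_isOpen hI (by simp)) tBase ht
  have hX₀'t := contDiffOn_comp_clm (h.smooth_X₀.deriv_of_isOpen hI (by simp)) tBase ht
  have hx : ContDiffOn ℝ ∞ (fun z => xBase z) D := xBase.contDiff.contDiffOn
  have pdT := fun w z hz => pd_comp_clm hI h.smooth_T tBase (ht z hz) w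
  have pdS := fun w z hz => pd_comp_clm hI h.smooth_S tBase (ht z hz) w
  have pdX₀ := fun w z hz => pd_comp_clm hI h.smooth_X₀ tBase (ht z hz) w
  have pdY := fun w z hz => pd_comp_clm hJ h.smooth_Y yBase (hy z hz) w
  have pdχ : ∀ w, ∀ z ∈ D, pd w (fun z => S (tBase z) * xBase z + X₀ (tBase z)) z =
      S (tBase z) * xBase w + tBase w * (deriv S (tBase z) * xBase z + deriv X₀ (tBase z)) :=
    fun w z hz => by
      rw [pd_add hD hz (hSt.mul hx) hX₀t, pd_mul hD hz hSt hx, pdS w z hz, pdX₀ w z hz, pd_clm]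
      ring
  exact
    { isOpen := hD
      smooth_τ := contDiffOn_comp_clm h.smooth_T tBase ht
      smooth_χ := (hSt.mul hx).add hX₀t
      smooth_ψ := contDiffOn_comp_clm h.smooth_Y yBase hy
      smooth_σ := hSt
      smooth_q := ((hS't.mul hx).add hX₀'t).div (contDiffOn_const.mul hSt) fun z hz =>
        mul_ne_zero two_ne_zero (h.S_ne_zero _ (ht z hz))
      σ_ne_zero := fun z hz => h.S_ne_zero _ (ht z hz)
      pd_ex_τ := fun z hz => (pdT ex z hz).trans (by simp)
      pd_ex_ψ := fun z hz => (pdY ex z hz).trans (by simp)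
      pd_et_ψ := fun z hz => (pdY et z hz).trans (by simp)
      pd_ex_χ := fun z hz => (pdχ ex z hz).trans (by simp)
      pd_ex_σ := fun z hz => (pdS ex z hz).trans (by simp)
      pd_et_τ := fun z hz => (pdT et z hz).trans ((one_mul _).trans (h.deriv_T _ (ht z hz)))
      pd_et_χ := fun z hz => by
        have hS := h.S_ne_zero _ (ht z hz)
        rw [pdχ et z hz]
        field_simp
        change S (tBase z) * 0 + 1 * _ = _
        ring }

theorem pd_ey_eq_zero (h : HasFormWith Ω Φ T S X₀ Y V₀) {D : Set Base} (hD : IsOpen D)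
    (ht : ∀ z ∈ D, tBase z ∈ tTotal '' Ω) :
    (∀ z ∈ D, pd ey (fun z => T (tBase z)) z = 0) ∧
      ∀ z ∈ D, pd ey (fun z => S (tBase z) * xBase z + X₀ (tBase z)) z = 0 := by
  have pd_ey_tBase {g : ℝ → ℝ} (hg : ContDiffOn ℝ ∞ g (tTotal '' Ω)) :
      ∀ z ∈ D, pd ey (fun z => g (tBase z)) z = 0 := fun z hz =>
    (pd_comp_clm (isOpen_image_tTotal h.isOpen) hg tBase (ht z hz) ey).trans (zero_mul _)
  refine ⟨pd_ey_tBase h.smooth_T, fun z hz => ?_⟩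
  have hS := contDiffOn_comp_clm h.smooth_S tBase ht
  have hx : ContDiffOn ℝ ∞ (fun z => xBase z) D := xBase.contDiff.contDiffOn
  rw [pd_add hD hz (hS.mul hx) (contDiffOn_comp_clm h.smooth_X₀ tBase ht), pd_mul hD hz hS hx,
    pd_ey_tBase h.smooth_S z hz, pd_ey_tBase h.smooth_X₀ z hz, pd_clm]
  simp

theorem coordinates_eq (h : HasFormWith Ω Φ T S X₀ Y V₀) {p : Total} (hp : p ∈ Ω) :
    xTotal p = (S (tTotal p))⁻¹ * xTotal (Φ p) + -((S (tTotal p))⁻¹ * X₀ (tTotal p)) ∧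
    uTotal p = S (tTotal p) * uTotal (Φ p)
      + (deriv S (tTotal p) * xTotal p + deriv X₀ (tTotal p)) / (2 * S (tTotal p)) ∧
    vTotal p = deriv Y (yTotal p) * vTotal (Φ p) + -(deriv Y (yTotal p) * V₀ (yTotal p)) := by
  have hS := h.S_ne_zero (tTotal p) ⟨_, hp, rfl⟩
  have hY' := h.deriv_Y_ne_zero (yTotal p) ⟨_, hp, rfl⟩
  have hxΦ : xTotal (Φ p) = S (tTotal p) * xTotal p + X₀ (tTotal p) :=
    congrArg xTotal (h.apply_eq p hp)
  have huΦ : uTotal (Φ p) = uTotal p / S (tTotal p)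
      - (deriv S (tTotal p) * xTotal p + deriv X₀ (tTotal p)) / (2 * S (tTotal p) ^ 2) :=
    congrArg uTotal (h.apply_eq p hp)
  have hvΦ : vTotal (Φ p) = vTotal p / deriv Y (yTotal p) + V₀ (yTotal p) :=
    congrArg vTotal (h.apply_eq p hp)
  rw [hxΦ, huΦ, hvΦ]
  refine ⟨?_, ?_, ?_⟩ <;> field_simp <;> ring

theorem of_graphPoint_eq (h : HasFormWith Ω Φ T S X₀ Y V₀) {u v u' v' : Base → ℝ} {z z' : Base}
    (hz : graphPoint u v z ∈ Ω) (hz' : graphPoint u' v' z' = Φ (graphPoint u v z)) :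
    z' = (T (tBase z), S (tBase z) * xBase z + X₀ (tBase z), Y (yBase z)) ∧
      u z = S (tBase z) * u' z'
        + (deriv S (tBase z) * xBase z + deriv X₀ (tBase z)) / (2 * S (tBase z)) ∧
      v z = deriv Y (yBase z) * v' z' + -(deriv Y (yBase z) * V₀ (yBase z)) := by
  obtain ⟨-, hu, hv⟩ := h.coordinates_eq hz
  rw [← hz'] at hu hv
  exact ⟨congrArg proj (hz'.trans (h.apply_eq _ hz)), hu, hv⟩

theorem solvesAt_iff (h : HasFormWith Ω Φ T S X₀ Y V₀) {D D' : Set Base} {u v u' v' : Base → ℝ}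
    (hD : IsOpen D) (hD' : IsOpen D') (hu' : ContDiffOn ℝ ∞ u' D') (hv' : ContDiffOn ℝ ∞ v' D')
    (hΩ : ∀ z ∈ D, graphPoint u v z ∈ Ω)
    (hm : ∀ z ∈ D, ∃ z' ∈ D', graphPoint u' v' z' = Φ (graphPoint u v z)) :
    ∀ z ∈ D, SolvesAt u v z ↔ SolvesAt u' v' (proj (Φ (graphPoint u v z))) := by
  have ht : ∀ z ∈ D, tBase z ∈ tTotal '' Ω := fun z hz => ⟨_, hΩ z hz, rfl⟩
  have hy : ∀ z ∈ D, yBase z ∈ yTotal '' Ω := fun z hz => ⟨_, hΩ z hz, rfl⟩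
  have hJ := isOpen_image_yTotal h.isOpen
  have hφ := h.isBaseChange hD ht hy
  obtain ⟨hτy, hχy⟩ := h.pd_ey_eq_zero hD ht
  set φ : Base → Base := fun z => (T (tBase z), S (tBase z) * xBase z + X₀ (tBase z), Y (yBase z))
  have hproj : ∀ z ∈ D, proj (Φ (graphPoint u v z)) = φ z := fun z hz => by
    rw [h.apply_eq _ (hΩ z hz)]; rfl
  have hgraph : ∀ z ∈ D, φ z ∈ D' ∧ graphPoint u' v' (φ z) = Φ (graphPoint u v z) := fun z hz => by
    obtain ⟨z', hz', hΦ⟩ := hm z hz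
    have hz'φ : z' = φ z := (h.of_graphPoint_eq (hΩ z hz) hΦ).1
    exact hz'φ ▸ ⟨hz', hΦ⟩
  have hYy : ∀ z ∈ D, pd ey (fun z => Y (yBase z)) z = deriv Y (yBase z) := fun z hz =>
    (pd_comp_clm hJ h.smooth_Y yBase (hy z hz) ey).trans (one_mul _)
  have hYV₀ : ContDiffOn ℝ ∞ (fun y => -(deriv Y y * V₀ y)) (yTotal '' Ω) :=
    ((h.smooth_Y.deriv_of_isOpen hJ (by simp)).mul h.smooth_V₀).neg
  have hYV₀_zero {w : Base} (hw : yBase w = 0) :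
      ∀ z ∈ D, pd w (fun z => -(deriv Y (yBase z) * V₀ (yBase z))) z = 0 := fun z hz => by
    rw [pd_comp_clm hJ hYV₀ yBase (hy z hz), hw, zero_mul]
  intro z hz
  rw [hproj z hz]
  exact hφ.solvesAt_iff hD' (fun z hz => (hgraph z hz).1) hτy hχy
    (fun z hz => (hYy z hz).trans_ne (h.deriv_Y_ne_zero _ (hy z hz))) hu' hv'
    (contDiffOn_comp_clm hYV₀ yBase hy) (hYV₀_zero rfl) (hYV₀_zero rfl)
    (fun z hz => (h.of_graphPoint_eq (hΩ z hz) (hgraph z hz).2).2.1)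
    (fun z hz => by rw [hYy z hz]; exact (h.of_graphPoint_eq (hΩ z hz) (hgraph z hz).2).2.2) z hz

end HasFormWith

theorem det_ne_zero_of_injective {E : Type*} [NormedAddCommGroup E] [NormedSpace ℝ E]
    [FiniteDimensional ℝ E] {A : E →L[ℝ] E} (hA : ∀ w, A w = 0 → w = 0) : A.det ≠ 0 := by
  intro h0
  obtain ⟨w, hw, hw0⟩ := (Submodule.ne_bot_iff _).1 (LinearMap.bot_lt_ker_of_det_eq_zero h0).ne'
  exact hw0 (hA w hw)

section Stationary

variable {E : Type*} [NormedAddCommGroup E] [NormedSpace ℝ E] {D : Set E} {w z : E}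

theorem contDiffOn_and_pd_comp_clm {I : Set ℝ} (hI : IsOpen I) {g : ℝ → ℝ}
    (hg : ContDiffOn ℝ ∞ g I) {L : E →L[ℝ] ℝ} (hL : ∀ z ∈ D, L z ∈ I) (hz : z ∈ D)
    (hw : L w = 0) : ContDiffOn ℝ ∞ (fun z => g (L z)) D ∧ pd w (fun z => g (L z)) z = 0 :=
  ⟨contDiffOn_comp_clm hg L hL, by rw [pd_comp_clm hI hg L (hL z hz), hw, zero_mul]⟩

theorem contDiffOn_and_pd_mul_add {c f b g : E → ℝ} (hD : IsOpen D) (hz : z ∈ D)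
    (hc : ContDiffOn ℝ ∞ c D ∧ pd w c z = 0) (hf : ContDiffOn ℝ ∞ f D ∧ pd w f z = 0)
    (hb : ContDiffOn ℝ ∞ b D ∧ pd w b z = 0) (hg : ∀ z ∈ D, g z = c z * f z + b z) :
    ContDiffOn ℝ ∞ g D ∧ pd w g z = 0 := by
  refine ⟨((hc.1.mul hf.1).add hb.1).congr hg, ?_⟩
  rw [pd_congr hD w hg z hz, pd_add hD hz (hc.1.mul hf.1) hb.1, pd_mul hD hz hc.1 hf.1, hc.2, hf.2,
    hb.2]
  ring

theorem contDiffOn_and_pd_clm_comp {F : Type*} [NormedAddCommGroup F] [NormedSpace ℝ F]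
    {G : E → F} (hD : IsOpen D) (hz : z ∈ D) (hG : ContDiffOn ℝ ∞ G D) (hw : fderiv ℝ G z w = 0)
    (L : F →L[ℝ] ℝ) : ContDiffOn ℝ ∞ (fun z => L (G z)) D ∧ pd w (fun z => L (G z)) z = 0 := by
  refine ⟨L.contDiff.comp_contDiffOn hG, ?_⟩
  rw [pd_comp L.differentiableAt (differentiableAt_of_mem hD hz hG), hw]
  simp [pd]

end Stationary

namespace HasFormWith

variable {Ω : Set Total} {Φ : Total → Total} {T S X₀ Y V₀ : ℝ → ℝ} {p w : Total}

theorem contDiffOn (h : HasFormWith Ω Φ T S X₀ Y V₀) : ContDiffOn ℝ ∞ Φ Ω := by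
  have hI := isOpen_image_tTotal h.isOpen
  have hJ := isOpen_image_yTotal h.isOpen
  have ht : ∀ p ∈ Ω, tTotal p ∈ tTotal '' Ω := fun p hp => ⟨p, hp, rfl⟩
  have hy : ∀ p ∈ Ω, yTotal p ∈ yTotal '' Ω := fun p hp => ⟨p, hp, rfl⟩
  have hL (L : Total →L[ℝ] ℝ) : ContDiffOn ℝ ∞ (fun p => L p) Ω := L.contDiff.contDiffOn
  have hS := contDiffOn_comp_clm h.smooth_S tTotal ht
  have hX₀ := contDiffOn_comp_clm h.smooth_X₀ tTotal ht
  have hS' := contDiffOn_comp_clm (h.smooth_S.deriv_of_isOpen hI (by simp)) tTotal ht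
  have hX₀' := contDiffOn_comp_clm (h.smooth_X₀.deriv_of_isOpen hI (by simp)) tTotal ht
  have hY' := contDiffOn_comp_clm (h.smooth_Y.deriv_of_isOpen hJ (by simp)) yTotal hy
  have hS0 : ∀ p ∈ Ω, S (tTotal p) ≠ 0 := fun p hp => h.S_ne_zero _ (ht p hp)
  refine ContDiffOn.congr ?_ h.apply_eq
  exact (contDiffOn_comp_clm h.smooth_T tTotal ht).prodMk <|
    ((hS.mul (hL xTotal)).add hX₀).prodMk <|
    (contDiffOn_comp_clm h.smooth_Y yTotal hy).prodMk <|
    (((hL uTotal).div hS hS0).sub (((hS'.mul (hL xTotal)).add hX₀').div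
      (contDiffOn_const.mul (hS.pow 2)) fun p hp =>
        mul_ne_zero two_ne_zero (pow_ne_zero 2 (hS0 p hp)))).prodMk <|
    ((hL vTotal).div hY' fun p hp => h.deriv_Y_ne_zero _ (hy p hp)).add
      (contDiffOn_comp_clm h.smooth_V₀ yTotal hy)

theorem tTotal_yTotal_eq_zero (h : HasFormWith Ω Φ T S X₀ Y V₀) (hp : p ∈ Ω)
    (hw : fderiv ℝ Φ p w = 0) : tTotal w = 0 ∧ yTotal w = 0 := by
  have hΩ := h.isOpen
  have ht : tTotal p ∈ tTotal '' Ω := ⟨p, hp, rfl⟩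
  have hy : yTotal p ∈ yTotal '' Ω := ⟨p, hp, rfl⟩
  have of_Φ := contDiffOn_and_pd_clm_comp hΩ hp h.contDiffOn hw
  have hTΦ : ∀ p ∈ Ω, T (tTotal p) = tTotal (Φ p) := fun p hp =>
    (congrArg tTotal (h.apply_eq p hp)).symm
  have hYΦ : ∀ p ∈ Ω, Y (yTotal p) = yTotal (Φ p) := fun p hp =>
    (congrArg yTotal (h.apply_eq p hp)).symm
  have hT : tTotal w * deriv T (tTotal p) = 0 := by
    rw [← pd_comp_clm (isOpen_image_tTotal hΩ) h.smooth_T tTotal ht w, pd_congr hΩ w hTΦ p hp,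
      (of_Φ tTotal).2]
  have hY : yTotal w * deriv Y (yTotal p) = 0 := by
    rw [← pd_comp_clm (isOpen_image_yTotal hΩ) h.smooth_Y yTotal hy w, pd_congr hΩ w hYΦ p hp,
      (of_Φ yTotal).2]
  rw [h.deriv_T _ ht] at hT
  exact ⟨(mul_eq_zero.1 hT).resolve_right (pow_ne_zero 2 (h.S_ne_zero _ ht)),
    (mul_eq_zero.1 hY).resolve_right (h.deriv_Y_ne_zero _ hy)⟩

theorem eq_zero_of_fderiv_eq_zero (h : HasFormWith Ω Φ T S X₀ Y V₀) (hp : p ∈ Ω)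
    (hw : fderiv ℝ Φ p w = 0) : w = 0 := by
  have hΩ := h.isOpen
  have hI := isOpen_image_tTotal hΩ
  have hJ := isOpen_image_yTotal hΩ
  have hS' := h.smooth_S.deriv_of_isOpen (m := ∞) hI (by simp)
  have hX₀' := h.smooth_X₀.deriv_of_isOpen (m := ∞) hI (by simp)
  have hY' := h.smooth_Y.deriv_of_isOpen (m := ∞) hJ (by simp)
  have hSinv : ContDiffOn ℝ ∞ (fun t => (S t)⁻¹) (tTotal '' Ω) := h.smooth_S.inv h.S_ne_zero
  obtain ⟨htw, hyw⟩ := h.tTotal_yTotal_eq_zero hp hw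
  have of_t {g : ℝ → ℝ} (hg : ContDiffOn ℝ ∞ g (tTotal '' Ω)) :=
    contDiffOn_and_pd_comp_clm hI hg (fun p hp => ⟨p, hp, rfl⟩) hp htw
  have of_y {g : ℝ → ℝ} (hg : ContDiffOn ℝ ∞ g (yTotal '' Ω)) :=
    contDiffOn_and_pd_comp_clm hJ hg (fun p hp => ⟨p, hp, rfl⟩) hp hyw
  have of_Φ := contDiffOn_and_pd_clm_comp hΩ hp h.contDiffOn hw
  have hxw := contDiffOn_and_pd_mul_add hΩ hp (of_t hSinv) (of_Φ xTotal)
    (of_t (hSinv.mul h.smooth_X₀).neg) fun p hp => (h.coordinates_eq hp).1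
  have hqw := contDiffOn_and_pd_mul_add hΩ hp (of_t ((hS'.mul hSinv).div_const 2)) hxw
    (of_t ((hX₀'.mul hSinv).div_const 2)) (g := fun p =>
      (deriv S (tTotal p) * xTotal p + deriv X₀ (tTotal p)) / (2 * S (tTotal p)))
    fun _ _ => by ring
  have huw := contDiffOn_and_pd_mul_add hΩ hp (of_t h.smooth_S) (of_Φ uTotal) hqw
    fun p hp => (h.coordinates_eq hp).2.1
  have hvw := contDiffOn_and_pd_mul_add hΩ hp (of_y hY') (of_Φ vTotal)
    (of_y (hY'.mul h.smooth_V₀).neg) fun p hp => (h.coordinates_eq hp).2.2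
  exact Prod.ext htw (Prod.ext ((pd_clm xTotal w p).symm.trans hxw.2) (Prod.ext hyw
    (Prod.ext ((pd_clm uTotal w p).symm.trans huw.2) ((pd_clm vTotal w p).symm.trans hvw.2))))

theorem isPointTransformation (h : HasFormWith Ω Φ T S X₀ Y V₀) : IsPointTransformation Ω Φ :=
  ⟨h.isOpen, h.contDiffOn, fun _ hp =>
    det_ne_zero_of_injective fun _ => h.eq_zero_of_fderiv_eq_zero hp⟩

end HasFormWith

theorem isPointSymmetry_of_locally_hasForm {Ω : Set Total} {Φ : Total → Total} (hΩ : IsOpen Ω)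
    (h : ∀ p ∈ Ω, ∃ Ω' : Set Total, IsOpen Ω' ∧ p ∈ Ω' ∧ Ω' ⊆ Ω ∧ HasForm Ω' Φ) :
    IsPointSymmetry Ω Φ := by
  have hlocal : ∀ p ∈ Ω, ∃ (Ω' : Set Total) (T S X₀ Y V₀ : ℝ → ℝ), p ∈ Ω' ∧
      HasFormWith Ω' Φ T S X₀ Y V₀ := fun p hp => by
    obtain ⟨Ω', hΩ', hpΩ', -, hform⟩ := h p hp
    obtain ⟨T, S, X₀, Y, V₀, hform⟩ := hform.exists_hasFormWith hΩ'
    exact ⟨Ω', T, S, X₀, Y, V₀, hpΩ', hform⟩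
  refine ⟨⟨hΩ, fun p hp => ?_, fun p hp => ?_⟩, ?_⟩
  · obtain ⟨Ω', _, _, _, _, _, hpΩ', hform⟩ := hlocal p hp
    exact (contDiffAt_of_mem hform.isOpen hpΩ' hform.contDiffOn).contDiffWithinAt
  · obtain ⟨Ω', _, _, _, _, _, hpΩ', hform⟩ := hlocal p hp
    exact hform.isPointTransformation.jacobian_ne_zero p hpΩ'
  intro D D' u v u' v' hD hD' hu hv hu' hv' hgraph himage
  have hm : ∀ z ∈ D, ∃ z' ∈ D', graphPoint u' v' z' = Φ (graphPoint u v z) := fun z hz =>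
    himage.subset ⟨z, hz, rfl⟩
  have hsolves : ∀ z ∈ D, SolvesAt u v z ↔ SolvesAt u' v' (proj (Φ (graphPoint u v z))) := by
    intro z hz
    obtain ⟨Ω', _, _, _, _, _, hpΩ', hform⟩ := hlocal _ (hgraph z hz)
    exact hform.solvesAt_iff (isOpen_graph_preimage hD hform.isOpen hu hv) hD' hu' hv'
      (fun z hz => hz.2) (fun z hz => hm z hz.1) z ⟨hz, hpΩ'⟩
  rw [solvesOn_iff hD hu, solvesOn_iff hD' hu']
  constructor
  · intro hs z' hz'
    obtain ⟨z, hz, hzz'⟩ := himage.superset ⟨z', hz', rfl⟩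
    have hproj : proj (Φ (graphPoint u v z)) = z' := congrArg proj hzz'
    exact hproj ▸ (hsolves z hz).1 (hs z hz)
  · intro hs z hz
    obtain ⟨z', hz', hzz'⟩ := hm z hz
    have hproj : z' = proj (Φ (graphPoint u v z)) := congrArg proj hzz'
    exact (hsolves z hz).2 (hproj ▸ hs z' hz')

theorem exists_local_inverse {E : Type*} [NormedAddCommGroup E] [NormedSpace ℝ E]
    [FiniteDimensional ℝ E] {D : Set E} {φ : E → E} {z₀ : E} (hD : IsOpen D)
    (hφ : ContDiffOn ℝ ∞ φ D) (hz₀ : z₀ ∈ D) (hinj : ∀ w, fderiv ℝ φ z₀ w = 0 → w = 0) :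
    ∃ D₁ ⊆ D, IsOpen D₁ ∧ z₀ ∈ D₁ ∧ IsOpen (φ '' D₁) ∧
      ∃ ψ : E → E, ContDiffOn ℝ ∞ ψ (φ '' D₁) ∧ ∀ z ∈ D₁, ψ (φ z) = z := by
  have := FiniteDimensional.complete ℝ E
  have hdet : IsOpen (D ∩ (fun z => (fderiv ℝ φ z).det) ⁻¹' {0}ᶜ) :=
    (ContinuousLinearMap.continuous_det.comp_continuousOn
      (hφ.continuousOn_fderiv_of_isOpen hD (by simp))).isOpen_inter_preimage hD
      isOpen_compl_singleton
  have hequiv : ∀ z ∈ D, (fderiv ℝ φ z).det ≠ 0 →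
      ∃ A : E ≃L[ℝ] E, HasFDerivAt φ (A : E →L[ℝ] E) z := fun z hz h0 =>
    ⟨ContinuousLinearMap.toContinuousLinearEquivOfDetNeZero _ h0, by
      rw [ContinuousLinearMap.coe_toContinuousLinearEquivOfDetNeZero]
      exact (differentiableAt_of_mem hD hz hφ).hasFDerivAt⟩
  have hdet₀ := det_ne_zero_of_injective hinj
  obtain ⟨A₀, hA₀⟩ := hequiv z₀ hz₀ hdet₀
  have hφz₀ := contDiffAt_of_mem hD hz₀ hφ
  set e := hφz₀.toOpenPartialHomeomorph φ hA₀ (by simp)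
  have hD₁ := e.open_source.inter hdet
  refine ⟨_, fun z hz => hz.2.1, hD₁,
    ⟨hφz₀.mem_toOpenPartialHomeomorph_source hA₀ (by simp), hz₀, hdet₀⟩,
    e.isOpen_image_of_subset_source hD₁ Set.inter_subset_left, e.symm, ?_,
    fun z hz => e.left_inv hz.1⟩
  rintro _ ⟨z, ⟨hze, hzD, hz0⟩, rfl⟩
  obtain ⟨A, hA⟩ := hequiv z hzD hz0
  have hinv : e.symm (φ z) = z := e.left_inv hze
  refine (e.contDiffAt_symm (e.map_source hze) (f₀' := A) ?_ ?_).contDiffWithinAt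
  · exact hinv.symm ▸ hA
  · exact hinv.symm ▸ contDiffAt_of_mem hD hzD hφ

/-- The direction of the `t`-axis in the total space. -/
abbrev Et : Total := (1, 0, 0, 0, 0)

/-- The direction of the `x`-axis in the total space. -/
abbrev Ex : Total := (0, 1, 0, 0, 0)

/-- The direction of the `y`-axis in the total space. -/
abbrev Ey : Total := (0, 0, 1, 0, 0)

/-- The direction of the `u`-axis. -/
abbrev Eu : Total := (0, 0, 0, 1, 0)

/-- The direction of the `v`-axis. -/
abbrev Ev : Total := (0, 0, 0, 0, 1)

section Components

variable (Φ : Total → Total)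

/-- The component `t̃` of a transformation. -/
def compT : Total → ℝ := fun q => tTotal (Φ q)

/-- The component `x̃` of a transformation. -/
def compX : Total → ℝ := fun q => xTotal (Φ q)

/-- The component `ỹ` of a transformation. -/
def compY : Total → ℝ := fun q => yTotal (Φ q)

/-- The component `ũ` of a transformation. -/
def compU : Total → ℝ := fun q => uTotal (Φ q)

/-- The component `ṽ` of a transformation. -/
def compV : Total → ℝ := fun q => vTotal (Φ q)

/-- The components `(t̃, x̃, ỹ)` of a transformation. -/
def baseComp : Total → Base := fun q => proj (Φ q)

/-- The function `ṽ - L(t̃, x̃, ỹ)`. If `L` is the differential of `ṽ` along the image of a graph,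
then its restriction to the graph has a critical point. -/
def defect (L : Base →L[ℝ] ℝ) : Total → ℝ := fun q => compV Φ q - L (baseComp Φ q)

end Components

theorem baseComp_eq (Φ : Total → Total) (p : Total) :
    baseComp Φ p = (compT Φ p, compX Φ p, compY Φ p) := rfl

section Smooth

variable {Ω : Set Total} {Φ : Total → Total}

@[fun_prop]
theorem contDiffOn_compT (h : ContDiffOn ℝ ∞ Φ Ω) : ContDiffOn ℝ ∞ (compT Φ) Ω :=
  tTotal.contDiff.comp_contDiffOn h

@[fun_prop]
theorem contDiffOn_compX (h : ContDiffOn ℝ ∞ Φ Ω) : ContDiffOn ℝ ∞ (compX Φ) Ω :=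
  xTotal.contDiff.comp_contDiffOn h

@[fun_prop]
theorem contDiffOn_compY (h : ContDiffOn ℝ ∞ Φ Ω) : ContDiffOn ℝ ∞ (compY Φ) Ω :=
  yTotal.contDiff.comp_contDiffOn h

@[fun_prop]
theorem contDiffOn_compV (h : ContDiffOn ℝ ∞ Φ Ω) : ContDiffOn ℝ ∞ (compV Φ) Ω :=
  vTotal.contDiff.comp_contDiffOn h

@[fun_prop]
theorem contDiffOn_baseComp (h : ContDiffOn ℝ ∞ Φ Ω) : ContDiffOn ℝ ∞ (baseComp Φ) Ω :=
  proj.contDiff.comp_contDiffOn h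

@[fun_prop]
theorem contDiffOn_defect (h : ContDiffOn ℝ ∞ Φ Ω) (L : Base →L[ℝ] ℝ) :
    ContDiffOn ℝ ∞ (defect Φ L) Ω :=
  (contDiffOn_compV h).sub (L.contDiff.comp_contDiffOn (contDiffOn_baseComp h))

theorem fderiv_baseComp_apply (hΩ : IsOpen Ω) {p : Total} (hp : p ∈ Ω) (h : ContDiffOn ℝ ∞ Φ Ω)
    (w : Total) : fderiv ℝ (baseComp Φ) p w =
      (pd w (compT Φ) p, pd w (compX Φ) p, pd w (compY Φ) p) := by
  have hT := (differentiableAt_of_mem hΩ hp (contDiffOn_compT h)).hasFDerivAt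
  have hX := (differentiableAt_of_mem hΩ hp (contDiffOn_compX h)).hasFDerivAt
  have hY := (differentiableAt_of_mem hΩ hp (contDiffOn_compY h)).hasFDerivAt
  rw [show baseComp Φ = fun q => (compT Φ q, compX Φ q, compY Φ q) from rfl,
    (hT.prodMk (hX.prodMk hY)).fderiv]
  rfl

theorem pd_defect (hΩ : IsOpen Ω) {p : Total} (hp : p ∈ Ω) (h : ContDiffOn ℝ ∞ Φ Ω)
    (L : Base →L[ℝ] ℝ) (w : Total) :
    pd w (defect Φ L) p = pd w (compV Φ) p - L (fderiv ℝ (baseComp Φ) p w) := by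
  have hb := contDiffOn_baseComp h
  have hL : ContDiffOn ℝ ∞ (fun q => L (baseComp Φ q)) Ω := L.contDiff.comp_contDiffOn hb
  unfold defect
  rw [pd_sub hΩ hp (contDiffOn_compV h) hL,
    pd_comp L.differentiableAt (differentiableAt_of_mem hΩ hp hb), pd_clm]

end Smooth

/-- The map `Φ` sends the graph over the open set `D` of the smooth pair `(u, v)`, which lies in
`Ω`, into the graph over the open set `D'` of the smooth pair `(u', v')`. -/
structure MapsGraph (Ω : Set Total) (Φ : Total → Total) (D : Set Base) (u v : Base → ℝ)
    (D' : Set Base) (u' v' : Base → ℝ) : Prop where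
  isOpen : IsOpen D
  smooth_u : ContDiffOn ℝ ∞ u D
  smooth_v : ContDiffOn ℝ ∞ v D
  mem : ∀ z ∈ D, graphPoint u v z ∈ Ω
  isOpen' : IsOpen D'
  smooth_u' : ContDiffOn ℝ ∞ u' D'
  smooth_v' : ContDiffOn ℝ ∞ v' D'
  baseComp_mem : ∀ z ∈ D, baseComp Φ (graphPoint u v z) ∈ D'
  apply_eq : ∀ z ∈ D, Φ (graphPoint u v z) = graphPoint u' v' (baseComp Φ (graphPoint u v z))

section MapsGraph

variable {Ω : Set Total} {Φ : Total → Total} {D D' : Set Base} {u v u' v' : Base → ℝ} {z₀ : Base}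

theorem MapsGraph.compU_eq (h : MapsGraph Ω Φ D u v D' u' v') :
    ∀ z ∈ D, compU Φ (graphPoint u v z) = u' (baseComp Φ (graphPoint u v z)) :=
  fun z hz => congrArg uTotal (h.apply_eq z hz)

theorem MapsGraph.compV_eq (h : MapsGraph Ω Φ D u v D' u' v') :
    ∀ z ∈ D, compV Φ (graphPoint u v z) = v' (baseComp Φ (graphPoint u v z)) :=
  fun z hz => congrArg vTotal (h.apply_eq z hz)

theorem IsPointSymmetry.exists_mapsGraph (hΦ : IsPointSymmetry Ω Φ) (hD : IsOpen D)
    (hu : ContDiffOn ℝ ∞ u D) (hv : ContDiffOn ℝ ∞ v D) (hs : ∀ z ∈ D, SolvesAt u v z)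
    (hz₀ : z₀ ∈ D) (hp : graphPoint u v z₀ ∈ Ω)
    (hinj : ∀ w, fderiv ℝ (fun z => baseComp Φ (graphPoint u v z)) z₀ w = 0 → w = 0) :
    ∃ D₁ D' u' v', z₀ ∈ D₁ ∧ D₁ ⊆ D ∧ MapsGraph Ω Φ D₁ u v D' u' v' ∧
      ∀ z ∈ D', SolvesAt u' v' z := by
  have hG : ContDiffOn ℝ ∞ (fun z => Φ (graphPoint u v z)) (D ∩ graphPoint u v ⁻¹' Ω) :=
    hΦ.smooth.comp ((contDiffOn_graphPoint hu hv).mono Set.inter_subset_left) fun z hz => hz.2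
  obtain ⟨D₁, hsub, hD₁, hz₁, hD', ψ, hψ, hψφ⟩ :=
    exists_local_inverse (isOpen_graph_preimage hD hΦ.isOpen hu hv)
      (proj.contDiff.comp_contDiffOn hG) ⟨hz₀, hp⟩ hinj
  have hD₁D : D₁ ⊆ D := fun z hz => (hsub hz).1
  have hD₁Ω : ∀ z ∈ D₁, graphPoint u v z ∈ Ω := fun z hz => (hsub hz).2
  have hGψ := hG.comp hψ (by
    rintro _ ⟨z, hz, rfl⟩
    exact (hψφ z hz).symm ▸ hsub hz)
  set u' : Base → ℝ := fun z' => compU Φ (graphPoint u v (ψ z'))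
  set v' : Base → ℝ := fun z' => compV Φ (graphPoint u v (ψ z'))
  have hu' : ContDiffOn ℝ ∞ u' _ := uTotal.contDiff.comp_contDiffOn hGψ
  have hv' : ContDiffOn ℝ ∞ v' _ := vTotal.contDiff.comp_contDiffOn hGψ
  have hgraph : ∀ z ∈ D₁, Φ (graphPoint u v z) =
      graphPoint u' v' (baseComp Φ (graphPoint u v z)) := fun z hz => by
    have hz' : ψ (baseComp Φ (graphPoint u v z)) = z := hψφ z hz
    have hu'z : u' (baseComp Φ (graphPoint u v z)) = compU Φ (graphPoint u v z) := by
      simp only [u', hz']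
    have hv'z : v' (baseComp Φ (graphPoint u v z)) = compV Φ (graphPoint u v z) := by
      simp only [v', hz']
    exact Prod.ext rfl (Prod.ext rfl (Prod.ext rfl (Prod.ext hu'z.symm hv'z.symm)))
  refine ⟨D₁, _, u', v', hz₁, hD₁D, ⟨hD₁, hu.mono hD₁D, hv.mono hD₁D, hD₁Ω, hD', hu', hv',
    fun z hz => ⟨z, hz, rfl⟩, hgraph⟩, ?_⟩
  refine (solvesOn_iff hD' hu').1 ((hΦ.solves_iff D₁ _ u v _ _ hD₁ hD' (hu.mono hD₁D)
    (hv.mono hD₁D) hu' hv' hD₁Ω ?_).1 ((solvesOn_iff hD₁ (hu.mono hD₁D)).2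
    fun z hz => hs z (hD₁D hz)))
  rw [Set.image_image]
  exact Set.image_congr hgraph

end MapsGraph

/-- The differential `w ↦ (w, α w, β w)` of the graph of a pair of functions with the differentials
`α` and `β`. -/
def graphLift (α β : Base →L[ℝ] ℝ) : Base →L[ℝ] Total :=
  tBase.prod (xBase.prod (yBase.prod (α.prod β)))

section GraphPoint

variable {D : Set Base} {u v : Base → ℝ} {z : Base}

theorem fderiv_graphPoint (hD : IsOpen D) (hz : z ∈ D) (hu : ContDiffOn ℝ ∞ u D)
    (hv : ContDiffOn ℝ ∞ v D) :
    fderiv ℝ (graphPoint u v) z = graphLift (fderiv ℝ u z) (fderiv ℝ v z) :=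
  (tBase.hasFDerivAt.prodMk (xBase.hasFDerivAt.prodMk (yBase.hasFDerivAt.prodMk
    ((differentiableAt_of_mem hD hz hu).hasFDerivAt.prodMk
      (differentiableAt_of_mem hD hz hv).hasFDerivAt)))).fderiv

theorem fderiv_fderiv_graphPoint (hD : IsOpen D) (hz : z ∈ D) (hu : ContDiffOn ℝ ∞ u D)
    (hv : ContDiffOn ℝ ∞ v D) (w : Base) :
    fderiv ℝ (fun z => fderiv ℝ (graphPoint u v) z w) z w =
      pd w (pd w u) z • Eu + pd w (pd w v) z • Ev := by
  have happly : (fun z => fderiv ℝ (graphPoint u v) z w) =ᶠ[nhds z]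
      fun z => (w.1, w.2.1, w.2.2, pd w u z, pd w v z) := by
    filter_upwards [hD.mem_nhds hz] with z hz
    rw [fderiv_graphPoint hD hz hu hv]
    rfl
  have hwu := (differentiableAt_of_mem hD hz (contDiffOn_pd hD w hu)).hasFDerivAt
  have hwv := (differentiableAt_of_mem hD hz (contDiffOn_pd hD w hv)).hasFDerivAt
  rw [happly.fderiv_eq, ((hasFDerivAt_const w.1 z).prodMk ((hasFDerivAt_const w.2.1 z).prodMk
    ((hasFDerivAt_const w.2.2 z).prodMk (hwu.prodMk hwv)))).fderiv]
  simp [pd]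

theorem pd_pd_comp_graphPoint {Ω : Set Total} {f : Total → ℝ} (hD : IsOpen D) (hΩ : IsOpen Ω)
    (hz : z ∈ D) (hu : ContDiffOn ℝ ∞ u D) (hv : ContDiffOn ℝ ∞ v D) (hf : ContDiffOn ℝ ∞ f Ω)
    (hm : ∀ z ∈ D, graphPoint u v z ∈ Ω) (w : Base) :
    pd w (pd w fun z => f (graphPoint u v z)) z =
      pd (graphLift (fderiv ℝ u z) (fderiv ℝ v z) w)
          (pd (graphLift (fderiv ℝ u z) (fderiv ℝ v z) w) f) (graphPoint u v z)
        + pd Eu f (graphPoint u v z) * pd w (pd w u) z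
        + pd Ev f (graphPoint u v z) * pd w (pd w v) z := by
  rw [pd_pd_comp hD hΩ hz (contDiffOn_graphPoint hu hv) hf hm, fderiv_graphPoint hD hz hu hv,
    fderiv_fderiv_graphPoint hD hz hu hv]
  simp only [map_add, map_smul, smul_eq_mul]
  simp only [pd]
  ring

end GraphPoint

/-- The first-order data at `p` of a transformation and of a graph through `p` whose components
have the differentials `α` and `β`: the graph is mapped locally onto a graph, `ξ` is mapped to
`∂/∂x̃`, and `L` is the differential of `ṽ` as a function on the image. -/
structure IsFrame (Φ : Total → Total) (p : Total) (α β : Base →L[ℝ] ℝ) (ξ : Base)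
    (L : Base →L[ℝ] ℝ) : Prop where
  inj : ∀ w, fderiv ℝ (baseComp Φ) p (graphLift α β w) = 0 → w = 0
  map_ξ : fderiv ℝ (baseComp Φ) p (graphLift α β ξ) = ex
  pd_defect : ∀ w, pd (graphLift α β w) (defect Φ L) p = 0

section Frame

variable {Ω : Set Total} {Φ : Total → Total} {p : Total}

theorem exists_isFrame (hΩ : IsOpen Ω) (hp : p ∈ Ω) (h : ContDiffOn ℝ ∞ Φ Ω)
    {α β : Base →L[ℝ] ℝ}
    (hinj : ∀ w, fderiv ℝ (baseComp Φ) p (graphLift α β w) = 0 → w = 0) :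
    ∃ ξ L, IsFrame Φ p α β ξ L := by
  set A : Base →L[ℝ] Base := (fderiv ℝ (baseComp Φ) p).comp (graphLift α β)
  let B := A.toContinuousLinearEquivOfDetNeZero (det_ne_zero_of_injective hinj)
  have hB : ∀ w, fderiv ℝ (baseComp Φ) p (graphLift α β w) = B w := fun w =>
    (ContinuousLinearMap.toContinuousLinearEquivOfDetNeZero_apply A _ w).symm
  refine ⟨B.symm ex, ((fderiv ℝ (compV Φ) p).comp (graphLift α β)).comp (B.symm : Base →L[ℝ] Base),
    hinj, by rw [hB, B.apply_symm_apply], fun w => ?_⟩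
  rw [BLP.pd_defect hΩ hp h, hB]
  simp [pd]

section Image

variable {D D' : Set Base} {u v u' v' : Base → ℝ} {z : Base} {ξ : Base} {L : Base →L[ℝ] ℝ}

theorem fderiv_baseComp_graphPoint (hD : IsOpen D) (hΩ : IsOpen Ω) (hz : z ∈ D)
    (hp : graphPoint u v z ∈ Ω) (hu : ContDiffOn ℝ ∞ u D) (hv : ContDiffOn ℝ ∞ v D)
    (h : ContDiffOn ℝ ∞ Φ Ω) (w : Base) :
    fderiv ℝ (fun z => baseComp Φ (graphPoint u v z)) z w =
      fderiv ℝ (baseComp Φ) (graphPoint u v z) (graphLift (fderiv ℝ u z) (fderiv ℝ v z) w) := by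
  rw [fderiv_fun_comp z (differentiableAt_of_mem hΩ hp (contDiffOn_baseComp h))
    (differentiableAt_of_mem hD hz (contDiffOn_graphPoint hu hv)), fderiv_graphPoint hD hz hu hv]
  rfl

theorem IsFrame.fderiv_image (hΩ : IsOpen Ω) (h : ContDiffOn ℝ ∞ Φ Ω)
    (hm : MapsGraph Ω Φ D u v D' u' v') (hz : z ∈ D)
    (hF : IsFrame Φ (graphPoint u v z) (fderiv ℝ u z) (fderiv ℝ v z) ξ L) :
    fderiv ℝ v' (baseComp Φ (graphPoint u v z)) = L := by
  have hD := hm.isOpen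
  have hsurj := LinearMap.injective_iff_surjective.1 ((injective_iff_map_eq_zero
    ((fderiv ℝ (baseComp Φ) (graphPoint u v z)).comp
      (graphLift (fderiv ℝ u z) (fderiv ℝ v z)) : Base →ₗ[ℝ] Base)).2 hF.inj)
  have hgraph := contDiffOn_graphPoint hm.smooth_u hm.smooth_v
  have hφ : ContDiffOn ℝ ∞ (fun z => baseComp Φ (graphPoint u v z)) D :=
    (contDiffOn_baseComp h).comp hgraph hm.mem
  refine ContinuousLinearMap.ext fun w' => ?_
  obtain ⟨w, rfl⟩ := hsurj w'
  have hw := hF.pd_defect w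
  rw [BLP.pd_defect hΩ (hm.mem z hz) h, sub_eq_zero] at hw
  have hchain := pd_congr hD w hm.compV_eq z hz
  rw [pd_comp (differentiableAt_of_mem hΩ (hm.mem z hz) (contDiffOn_compV h))
    (differentiableAt_of_mem hD hz hgraph), fderiv_graphPoint hD hz hm.smooth_u hm.smooth_v, hw,
    pd_comp (G := fun z => baseComp Φ (graphPoint u v z))
      (differentiableAt_of_mem hm.isOpen' (hm.baseComp_mem z hz) hm.smooth_v')
      (differentiableAt_of_mem hD hz hφ),
    fderiv_baseComp_graphPoint hD hΩ hz (hm.mem z hz) hm.smooth_u hm.smooth_v h] at hchain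
  exact hchain.symm

theorem IsFrame.pd_ex_pd_ex_image (hΩ : IsOpen Ω) (h : ContDiffOn ℝ ∞ Φ Ω)
    (hm : MapsGraph Ω Φ D u v D' u' v') (hz : z ∈ D)
    (hF : IsFrame Φ (graphPoint u v z) (fderiv ℝ u z) (fderiv ℝ v z) ξ L) :
    pd ex (pd ex v') (baseComp Φ (graphPoint u v z)) =
      pd (graphLift (fderiv ℝ u z) (fderiv ℝ v z) ξ)
          (pd (graphLift (fderiv ℝ u z) (fderiv ℝ v z) ξ) (defect Φ L)) (graphPoint u v z)
        + pd Eu (defect Φ L) (graphPoint u v z) * pd ξ (pd ξ u) z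
        + pd Ev (defect Φ L) (graphPoint u v z) * pd ξ (pd ξ v) z := by
  have hD := hm.isOpen
  have hD' := hm.isOpen'
  have hv' := hm.smooth_v'
  have hz' := hm.baseComp_mem z hz
  have hL : ContDiffOn ℝ ∞ (fun z => L z) D' := L.contDiff.contDiffOn
  have hφ : ContDiffOn ℝ ∞ (fun z => baseComp Φ (graphPoint u v z)) D :=
    (contDiffOn_baseComp h).comp (contDiffOn_graphPoint hm.smooth_u hm.smooth_v) hm.mem
  have hcritical : fderiv ℝ (fun z => v' z - L z) (baseComp Φ (graphPoint u v z)) = 0 := by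
    rw [fderiv_fun_sub (differentiableAt_of_mem hD' hz' hv') L.differentiableAt,
      hF.fderiv_image hΩ h hm hz, L.fderiv, sub_self]
  have hpd_sub : ∀ z ∈ D', pd ex (fun z => v' z - L z) z = pd ex v' z - L ex := fun z hz => by
    rw [pd_sub hD' hz hv' hL, pd_clm]
  have hdefect : ∀ z ∈ D, defect Φ L (graphPoint u v z) =
      (fun z => v' z - L z) (baseComp Φ (graphPoint u v z)) := fun z hz =>
    congrArg (· - L (baseComp Φ (graphPoint u v z))) (hm.compV_eq z hz)
  rw [← pd_pd_comp_graphPoint hD hΩ hz hm.smooth_u hm.smooth_v (contDiffOn_defect h L) hm.mem,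
    pd_congr hD ξ (pd_congr hD ξ hdefect) z hz,
    pd_pd_comp hD hD' hz hφ (hv'.sub hL) hm.baseComp_mem,
    fderiv_baseComp_graphPoint hD hΩ hz (hm.mem z hz) hm.smooth_u hm.smooth_v h, hF.map_ξ,
    hcritical, pd_congr hD' ex hpd_sub _ hz', pd_sub hD' hz' (contDiffOn_pd hD' ex hv')
      contDiffOn_const, pd_const]
  simp

theorem IsPointSymmetry.second_order_identity (hΦ : IsPointSymmetry Ω Φ) (hD : IsOpen D)
    (hu : ContDiffOn ℝ ∞ u D) (hv : ContDiffOn ℝ ∞ v D) (hs : ∀ z ∈ D, SolvesAt u v z)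
    (hz : z ∈ D) (hp : graphPoint u v z ∈ Ω)
    (hF : IsFrame Φ (graphPoint u v z) (fderiv ℝ u z) (fderiv ℝ v z) ξ L) :
    L et = pd (graphLift (fderiv ℝ u z) (fderiv ℝ v z) ξ)
          (pd (graphLift (fderiv ℝ u z) (fderiv ℝ v z) ξ) (defect Φ L)) (graphPoint u v z)
        + pd Eu (defect Φ L) (graphPoint u v z) * pd ξ (pd ξ u) z
        + pd Ev (defect Φ L) (graphPoint u v z) * pd ξ (pd ξ v) z
        + 2 * compU Φ (graphPoint u v z) * L ex := by
  have hinj : ∀ w, fderiv ℝ (fun z => baseComp Φ (graphPoint u v z)) z w = 0 → w = 0 :=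
    fun w hw => hF.inj w (by rwa [fderiv_baseComp_graphPoint hD hΦ.isOpen hz hp hu hv
      hΦ.smooth] at hw)
  obtain ⟨D₁, D', u', v', hz₁, -, hm, hs'⟩ := hΦ.exists_mapsGraph hD hu hv hs hz hp hinj
  have hL := hF.fderiv_image hΦ.isOpen hΦ.smooth hm hz₁
  have heq := (hs' _ (hm.baseComp_mem z hz₁)).2
  rw [hF.pd_ex_pd_ex_image hΦ.isOpen hΦ.smooth hm hz₁] at heq
  rwa [show pd et v' _ = L et from congrArg (· et) hL,
    show pd ex v' _ = L ex from congrArg (· ex) hL, ← hm.compU_eq z hz₁] at heq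

end Image

end Frame

section SecondOrder

variable {E : Type*} [NormedAddCommGroup E] [NormedSpace ℝ E] {D : Set E} {z : E}

theorem pd_pd_add_dir (hD : IsOpen D) (hz : z ∈ D) {f : E → ℝ} (hf : ContDiffOn ℝ ∞ f D)
    (w w' : E) : pd (w + w') (pd (w + w') f) z =
      pd w (pd w f) z + 2 * pd w (pd w' f) z + pd w' (pd w' f) z := by
  have hadd : ∀ z ∈ D, pd (w + w') f z = pd w f z + pd w' f z := fun z _ => pd_add_dir w w' f z
  rw [pd_congr hD _ hadd z hz, pd_add_dir, pd_add hD hz (contDiffOn_pd hD w hf)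
    (contDiffOn_pd hD w' hf), pd_add hD hz (contDiffOn_pd hD w hf) (contDiffOn_pd hD w' hf),
    pd_comm hD hz hf w' w]
  ring

theorem pd_pd_eq_polarization (hD : IsOpen D) (hz : z ∈ D) {f : E → ℝ} (hf : ContDiffOn ℝ ∞ f D)
    (w w' : E) : pd w (pd w' f) z =
      (pd (w + w') (pd (w + w') f) z - pd w (pd w f) z - pd w' (pd w' f) z) / 2 := by
  rw [pd_pd_add_dir hD hz hf]
  ring

end SecondOrder

theorem pd_ex_pd_ex_pd_ex_eq {D : Set Base} {u v : Base → ℝ} {z : Base} (hD : IsOpen D)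
    (hz : z ∈ D) (hu : ContDiffOn ℝ ∞ u D) (hv : ContDiffOn ℝ ∞ v D)
    (hs : ∀ z ∈ D, SolvesAt u v z) :
    pd ex (pd ex (pd ex v)) z =
      pd et (pd ex v) z - 2 * (pd ex u z * pd ex v z + u z * pd ex (pd ex v) z) := by
  have hsecond : ∀ z ∈ D, pd et v z = pd ex (pd ex v) z + 2 * u z * pd ex v z := fun z hz =>
    (hs z hz).2
  rw [pd_comm hD hz hv et ex, pd_congr hD ex hsecond z hz]
  simp (disch := fun_prop (disch := assumption)) only [pd_add hD hz, pd_mul hD hz, pd_const]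
  ring

theorem contDiff_deriv {h : ℝ → ℝ} (hh : ContDiff ℝ ∞ h) : ContDiff ℝ ∞ (deriv h) :=
  (contDiff_infty_iff_deriv.1 hh).2

/-- The smooth function `f` on `D` has at `z` the value `a` and the first two derivatives `b`, `c`
in the direction `w`. -/
structure HasJet {E : Type*} [NormedAddCommGroup E] [NormedSpace ℝ E] (D : Set E) (w z : E)
    (f : E → ℝ) (a b c : ℝ) : Prop where
  smooth : ContDiffOn ℝ ∞ f D
  val : f z = a
  fst : pd w f z = b
  snd : pd w (pd w f) z = c

namespace HasJet

variable {E : Type*} [NormedAddCommGroup E] [NormedSpace ℝ E] {D : Set E} {w z : E} {f g : E → ℝ}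
  {a b c a' b' c' : ℝ}

theorem add (hD : IsOpen D) (hz : z ∈ D) (hf : HasJet D w z f a b c)
    (hg : HasJet D w z g a' b' c') :
    HasJet D w z (fun z => f z + g z) (a + a') (b + b') (c + c') where
  smooth := hf.smooth.add hg.smooth
  val := by rw [hf.val, hg.val]
  fst := by rw [pd_add hD hz hf.smooth hg.smooth, hf.fst, hg.fst]
  snd := by
    rw [pd_congr hD w (fun z hz => pd_add hD hz hf.smooth hg.smooth) z hz,
      pd_add hD hz (contDiffOn_pd hD w hf.smooth) (contDiffOn_pd hD w hg.smooth), hf.snd, hg.snd]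

theorem mul (hD : IsOpen D) (hz : z ∈ D) (hf : HasJet D w z f a b c)
    (hg : HasJet D w z g a' b' c') : HasJet D w z (fun z => f z * g z)
      (a * a') (a * b' + a' * b) (a * c' + 2 * b * b' + a' * c) where
  smooth := hf.smooth.mul hg.smooth
  val := by rw [hf.val, hg.val]
  fst := by rw [pd_mul hD hz hf.smooth hg.smooth, hf.fst, hg.fst, hf.val, hg.val]
  snd := by
    have hfw := contDiffOn_pd hD w hf.smooth
    have hgw := contDiffOn_pd hD w hg.smooth
    rw [pd_congr hD w (fun z hz => pd_mul hD hz hf.smooth hg.smooth) z hz,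
      pd_add hD hz (hf.smooth.mul hgw) (hg.smooth.mul hfw), pd_mul hD hz hf.smooth hgw,
      pd_mul hD hz hg.smooth hfw, hf.snd, hg.snd, hf.fst, hg.fst, hf.val, hg.val]
    ring

theorem inv (hD : IsOpen D) (hz : z ∈ D) (hf : HasJet D w z f a b c) (h0 : ∀ z ∈ D, f z ≠ 0) :
    HasJet D w z (fun z => (f z)⁻¹) a⁻¹ (-b / a ^ 2) (2 * b ^ 2 / a ^ 3 - c / a ^ 2) where
  smooth := hf.smooth.inv h0
  val := by rw [hf.val]
  fst := by rw [pd_inv hD hz hf.smooth (h0 z hz), hf.fst, hf.val]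
  snd := by
    have hfw := contDiffOn_pd hD w hf.smooth
    have hinv : ContDiffOn ℝ ∞ (fun z => (f z)⁻¹) D := hf.smooth.inv h0
    have hpd : ∀ z ∈ D, pd w (fun z => (f z)⁻¹) z = -1 * (pd w f z * ((f z)⁻¹ * (f z)⁻¹)) :=
      fun z hz => by rw [pd_inv hD hz hf.smooth (h0 z hz)]; field_simp
    have ha : a ≠ 0 := hf.val ▸ h0 z hz
    rw [pd_congr hD w hpd z hz, pd_mul hD hz contDiffOn_const (hfw.mul (hinv.mul hinv)), pd_const,
      pd_mul hD hz hfw (hinv.mul hinv), pd_mul hD hz hinv hinv, pd_inv hD hz hf.smooth (h0 z hz),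
      hf.snd, hf.fst, hf.val]
    field_simp
    ring

theorem log (hD : IsOpen D) (hz : z ∈ D) (hf : HasJet D w z f a b c) (h0 : ∀ z ∈ D, f z ≠ 0) :
    HasJet D w z (fun z => Real.log (f z)) (Real.log a) (b / a) (c / a - (b / a) ^ 2) := by
  have hpd : ∀ z ∈ D, pd w (fun z => Real.log (f z)) z = pd w f z * (f z)⁻¹ := fun z hz => by
    rw [pd, ((differentiableAt_of_mem hD hz hf.smooth).hasFDerivAt.log (h0 z hz)).fderiv]
    simp [pd, mul_comm]
  have hinv : ContDiffOn ℝ ∞ (fun z => (f z)⁻¹) D := hf.smooth.inv h0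
  refine ⟨hf.smooth.log h0, by rw [hf.val], by rw [hpd z hz, hf.fst, hf.val, div_eq_mul_inv], ?_⟩
  rw [pd_congr hD w hpd z hz, pd_mul hD hz (contDiffOn_pd hD w hf.smooth) hinv,
    pd_inv hD hz hf.smooth (h0 z hz), hf.snd, hf.fst, hf.val]
  ring

theorem const (c : ℝ) : HasJet D w z (fun _ => c) c 0 0 where
  smooth := contDiffOn_const
  val := rfl
  fst := pd_const _ _ _
  snd := by rw [funext fun z => pd_const w c z, pd_const]

theorem comp_clm (L : E →L[ℝ] ℝ) {h : ℝ → ℝ} (hh : ContDiff ℝ ∞ h) :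
    HasJet D w z (fun z => h (L z)) (h (L z)) (L w * deriv h (L z))
      (L w * (L w * deriv (deriv h) (L z))) := by
  have hh' : ContDiff ℝ ∞ (deriv h) := contDiff_deriv hh
  have hh'L : ContDiffOn ℝ ∞ (fun z => deriv h (L z)) Set.univ := (hh'.comp L.contDiff).contDiffOn
  have hpd {g : ℝ → ℝ} (hg : ContDiff ℝ ∞ g) (z : E) :
      pd w (fun z => g (L z)) z = L w * deriv g (L z) :=
    pd_comp_clm isOpen_univ hg.contDiffOn L (Set.mem_univ _) w
  refine ⟨(hh.comp L.contDiff).contDiffOn, rfl, hpd hh z, ?_⟩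
  rw [funext (hpd hh), pd_mul isOpen_univ (Set.mem_univ z) contDiffOn_const hh'L,
    pd_const, hpd hh']
  ring

theorem congr {f' : E → ℝ} (hD : IsOpen D) (hz : z ∈ D) (hf : HasJet D w z f a b c)
    (h : ∀ z ∈ D, f' z = f z) : HasJet D w z f' a b c where
  smooth := hf.smooth.congr h
  val := by rw [h z hz, hf.val]
  fst := by rw [pd_congr hD w h z hz, hf.fst]
  snd := by rw [pd_congr hD w (pd_congr hD w h) z hz, hf.snd]

end HasJet

/-- The function `F = 1 + Q(y)(R₁(x) + R₂(t))` such that `u = (log F)_x + u₀`,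
`v = (log F)_y + V₀(y)` is a solution if `2 u₀ R₁' = R₂' - R₁''`. -/
noncomputable def tau (R₁ R₂ Q : ℝ → ℝ) : Base → ℝ :=
  fun z => 1 + Q (yBase z) * (R₁ (xBase z) + R₂ (tBase z))

/-- The solution `u₀(t, x)` of `2 u₀ R₁' = R₂' - R₁''`. -/
noncomputable def seed (R₁ R₂ : ℝ → ℝ) : Base → ℝ := fun z =>
  (deriv R₂ (tBase z) + -1 * deriv (deriv R₁) (xBase z)) * (2 * deriv R₁ (xBase z))⁻¹

/-- The set on which `log (tau R₁ R₂ Q)` and `seed R₁ R₂` are both free of junk values. -/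
def separableDomain (R₁ R₂ Q : ℝ → ℝ) : Set Base :=
  {z | 0 < tau R₁ R₂ Q z} ∩ {z | deriv R₁ (xBase z) ≠ 0}

section Separable

variable {R₁ R₂ Q V₀ : ℝ → ℝ} {D : Set Base} {z : Base}

theorem isOpen_separableDomain (hR₁ : ContDiff ℝ ∞ R₁) (hR₂ : ContDiff ℝ ∞ R₂)
    (hQ : ContDiff ℝ ∞ Q) : IsOpen (separableDomain R₁ R₂ Q) := by
  have hR₁' := (contDiff_deriv hR₁).continuous
  have hτ : Continuous (tau R₁ R₂ Q) :=
    continuous_const.add ((hQ.continuous.comp yBase.continuous).mul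
      ((hR₁.continuous.comp xBase.continuous).add (hR₂.continuous.comp tBase.continuous)))
  exact (isOpen_lt continuous_const hτ).inter
    (isOpen_ne_fun (hR₁'.comp xBase.continuous) continuous_const)

theorem hasJet_tau (hD : IsOpen D) (hz : z ∈ D) (hR₁ : ContDiff ℝ ∞ R₁) (hR₂ : ContDiff ℝ ∞ R₂)
    (hQ : ContDiff ℝ ∞ Q) (w : Base) : HasJet D w z (tau R₁ R₂ Q) (tau R₁ R₂ Q z)
      (Q (yBase z) * (xBase w * deriv R₁ (xBase z) + tBase w * deriv R₂ (tBase z))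
        + (R₁ (xBase z) + R₂ (tBase z)) * (yBase w * deriv Q (yBase z)))
      (Q (yBase z) * (xBase w ^ 2 * deriv (deriv R₁) (xBase z)
          + tBase w ^ 2 * deriv (deriv R₂) (tBase z))
        + 2 * (yBase w * deriv Q (yBase z))
          * (xBase w * deriv R₁ (xBase z) + tBase w * deriv R₂ (tBase z))
        + (R₁ (xBase z) + R₂ (tBase z)) * (yBase w ^ 2 * deriv (deriv Q) (yBase z))) := by
  unfold tau
  convert (HasJet.const 1).add hD hz ((HasJet.comp_clm yBase hQ).mul hD hz
    ((HasJet.comp_clm xBase hR₁).add hD hz (HasJet.comp_clm tBase hR₂))) using 1 <;> ring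

theorem hasJet_seed (hD : IsOpen D) (hz : z ∈ D) (hR₁ : ContDiff ℝ ∞ R₁) (hR₂ : ContDiff ℝ ∞ R₂)
    (h0 : ∀ z ∈ D, deriv R₁ (xBase z) ≠ 0) (w : Base) : HasJet D w z (seed R₁ R₂)
      ((deriv R₂ (tBase z) - deriv (deriv R₁) (xBase z)) / (2 * deriv R₁ (xBase z)))
      ((tBase w * deriv (deriv R₂) (tBase z) - xBase w * deriv (deriv (deriv R₁)) (xBase z))
          / (2 * deriv R₁ (xBase z))
        - (deriv R₂ (tBase z) - deriv (deriv R₁) (xBase z))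
          * (xBase w * deriv (deriv R₁) (xBase z)) / (2 * deriv R₁ (xBase z) ^ 2))
      ((tBase w ^ 2 * deriv (deriv (deriv R₂)) (tBase z)
          - xBase w ^ 2 * deriv (deriv (deriv (deriv R₁))) (xBase z)) / (2 * deriv R₁ (xBase z))
        - (tBase w * deriv (deriv R₂) (tBase z) - xBase w * deriv (deriv (deriv R₁)) (xBase z))
          * (xBase w * deriv (deriv R₁) (xBase z)) / deriv R₁ (xBase z) ^ 2
        + (deriv R₂ (tBase z) - deriv (deriv R₁) (xBase z))
          * (2 * (xBase w * deriv (deriv R₁) (xBase z)) ^ 2 / deriv R₁ (xBase z) ^ 3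
            - xBase w ^ 2 * deriv (deriv (deriv R₁)) (xBase z) / deriv R₁ (xBase z) ^ 2) / 2) := by
  have hR₁' := contDiff_deriv hR₁
  have hz0 := h0 z hz
  unfold seed
  convert ((HasJet.comp_clm tBase (contDiff_deriv hR₂)).add hD hz
    ((HasJet.const (-1)).mul hD hz (HasJet.comp_clm xBase (contDiff_deriv hR₁')))).mul hD hz
    (((HasJet.const 2).mul hD hz (HasJet.comp_clm xBase hR₁')).inv hD hz
      fun z hz => mul_ne_zero two_ne_zero (h0 z hz)) using 1 <;> field_simp <;> ring

section Solution

variable (hR₁ : ContDiff ℝ ∞ R₁) (hR₂ : ContDiff ℝ ∞ R₂) (hQ : ContDiff ℝ ∞ Q)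

include hR₁ hR₂ hQ

theorem contDiffOn_log_tau :
    ContDiffOn ℝ ∞ (fun z => Real.log (tau R₁ R₂ Q z)) (separableDomain R₁ R₂ Q) := fun z hz =>
  (hasJet_tau isOpen_univ (Set.mem_univ z) hR₁ hR₂ hQ 0).smooth.contDiffAt Filter.univ_mem
    |>.log (ne_of_gt hz.1) |>.contDiffWithinAt

theorem pd_log_tau (hz : z ∈ separableDomain R₁ R₂ Q) (w : Base) :
    pd w (fun z => Real.log (tau R₁ R₂ Q z)) z =
      (Q (yBase z) * (xBase w * deriv R₁ (xBase z) + tBase w * deriv R₂ (tBase z))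
        + (R₁ (xBase z) + R₂ (tBase z)) * (yBase w * deriv Q (yBase z))) / tau R₁ R₂ Q z :=
  have hD := isOpen_separableDomain hR₁ hR₂ hQ
  ((hasJet_tau hD hz hR₁ hR₂ hQ w).log hD hz fun _ hz => ne_of_gt hz.1).fst

theorem pd_et_log_tau (hz : z ∈ separableDomain R₁ R₂ Q) :
    pd et (fun z => Real.log (tau R₁ R₂ Q z)) z =
      pd ex (pd ex fun z => Real.log (tau R₁ R₂ Q z)) z
      + pd ex (fun z => Real.log (tau R₁ R₂ Q z)) z * pd ex (fun z => Real.log (tau R₁ R₂ Q z)) z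
      + 2 * (seed R₁ R₂ z * pd ex (fun z => Real.log (tau R₁ R₂ Q z)) z) := by
  have hD := isOpen_separableDomain hR₁ hR₂ hQ
  have hτ : tau R₁ R₂ Q z ≠ 0 := ne_of_gt hz.1
  have hR₁z : deriv R₁ z.2.1 ≠ 0 := hz.2
  rw [((hasJet_tau hD hz hR₁ hR₂ hQ ex).log hD hz fun _ hz => ne_of_gt hz.1).snd,
    pd_log_tau hR₁ hR₂ hQ hz, pd_log_tau hR₁ hR₂ hQ hz]
  simp [seed]
  field_simp
  ring

theorem solvesAt_separable (hV₀ : ContDiff ℝ ∞ V₀) :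
    ∀ z ∈ separableDomain R₁ R₂ Q, SolvesAt
      (fun z => pd ex (fun z => Real.log (tau R₁ R₂ Q z)) z + seed R₁ R₂ z)
      (fun z => pd ey (fun z => Real.log (tau R₁ R₂ Q z)) z + V₀ (yBase z)) z := by
  have hD := isOpen_separableDomain hR₁ hR₂ hQ
  have hV₀w (z w : Base) : pd w (fun z => V₀ (yBase z)) z = yBase w * deriv V₀ (yBase z) :=
    (HasJet.comp_clm (D := Set.univ) yBase hV₀).fst
  intro z hz
  exact solvesAt_of_potential hD (contDiffOn_log_tau hR₁ hR₂ hQ)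
    (hasJet_seed hD hz hR₁ hR₂ (fun _ hz => hz.2) 0).smooth
    (hV₀.comp yBase.contDiff).contDiffOn (fun z hz => pd_et_log_tau hR₁ hR₂ hQ hz)
    (fun z hz => by simp [(hasJet_seed hD hz hR₁ hR₂ (fun _ hz => hz.2) ey).fst])
    (fun z _ => (hV₀w z et).trans (by simp)) (fun z _ => (hV₀w z ex).trans (by simp)) z hz

variable (hz : z ∈ separableDomain R₁ R₂ Q) (hQz : Q (yBase z) = 0)
  (hRz : R₁ (xBase z) + R₂ (tBase z) = 0)

include hz hQz hRz

theorem hasJet_inv_tau (w : Base) : HasJet (separableDomain R₁ R₂ Q) w z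
    (fun z => (tau R₁ R₂ Q z)⁻¹) 1 0
    (-2 * (yBase w * deriv Q (yBase z))
      * (xBase w * deriv R₁ (xBase z) + tBase w * deriv R₂ (tBase z))) := by
  have hD := isOpen_separableDomain hR₁ hR₂ hQ
  have hτ : tau R₁ R₂ Q z = 1 := by rw [tau, hRz, mul_zero, add_zero]
  convert (hasJet_tau hD hz hR₁ hR₂ hQ w).inv hD hz (fun _ hz => ne_of_gt hz.1) using 1
  · rw [hτ, inv_one]
  · rw [hQz, hRz]; ring
  · rw [hτ, hQz, hRz]; ring

theorem hasJet_pd_ex_log_tau (w : Base) : HasJet (separableDomain R₁ R₂ Q) w z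
    (pd ex fun z => Real.log (tau R₁ R₂ Q z)) 0
    (yBase w * deriv Q (yBase z) * deriv R₁ (xBase z))
    (2 * (yBase w * deriv Q (yBase z)) * (xBase w * deriv (deriv R₁) (xBase z))
      + yBase w ^ 2 * deriv (deriv Q) (yBase z) * deriv R₁ (xBase z)) := by
  have hD := isOpen_separableDomain hR₁ hR₂ hQ
  convert ((((HasJet.comp_clm yBase hQ).mul hD hz (HasJet.comp_clm xBase (contDiff_deriv hR₁))).mul
    hD hz (hasJet_inv_tau hR₁ hR₂ hQ hz hQz hRz w)).congr (f' := pd ex _) hD hz fun z hz => ?_)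
    using 1
  · rw [hQz]; ring
  · rw [hQz]; ring
  · rw [hQz]; ring
  · rw [pd_log_tau hR₁ hR₂ hQ hz]
    simp [div_eq_mul_inv]

theorem hasJet_pd_ey_log_tau (w : Base) : HasJet (separableDomain R₁ R₂ Q) w z
    (pd ey fun z => Real.log (tau R₁ R₂ Q z)) 0
    (deriv Q (yBase z) * (xBase w * deriv R₁ (xBase z) + tBase w * deriv R₂ (tBase z)))
    (deriv Q (yBase z)
        * (xBase w ^ 2 * deriv (deriv R₁) (xBase z) + tBase w ^ 2 * deriv (deriv R₂) (tBase z))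
      + 2 * (yBase w * deriv (deriv Q) (yBase z))
        * (xBase w * deriv R₁ (xBase z) + tBase w * deriv R₂ (tBase z))) := by
  have hD := isOpen_separableDomain hR₁ hR₂ hQ
  convert ((((HasJet.comp_clm yBase (contDiff_deriv hQ)).mul hD hz
    ((HasJet.comp_clm xBase hR₁).add hD hz (HasJet.comp_clm tBase hR₂))).mul hD hz
    (hasJet_inv_tau hR₁ hR₂ hQ hz hQz hRz w)).congr (f' := pd ey _) hD hz fun z hz => ?_) using 1
  · rw [hRz]; ring
  · rw [hRz]; ring
  · rw [hRz]; ring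
  · rw [pd_log_tau hR₁ hR₂ hQ hz]
    simp [div_eq_mul_inv, mul_comm]

end Solution

theorem exists_separable_solution (hR₁ : ContDiff ℝ ∞ R₁) (hR₂ : ContDiff ℝ ∞ R₂)
    (hQ : ContDiff ℝ ∞ Q) (hV₀ : ContDiff ℝ ∞ V₀) {t₀ x₀ y₀ : ℝ} (hR₁x : deriv R₁ x₀ ≠ 0)
    (hR : R₁ x₀ + R₂ t₀ = 0) (hQy : Q y₀ = 0) :
    ∃ (D : Set Base) (u v : Base → ℝ), IsOpen D ∧ (t₀, x₀, y₀) ∈ D ∧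
      (∀ z ∈ D, SolvesAt u v z) ∧ ∀ w : Base,
      HasJet D w (t₀, x₀, y₀) u
        ((deriv R₂ t₀ - deriv (deriv R₁) x₀) / (2 * deriv R₁ x₀))
        (w.2.2 * deriv Q y₀ * deriv R₁ x₀
          + ((w.1 * deriv (deriv R₂) t₀ - w.2.1 * deriv (deriv (deriv R₁)) x₀) / (2 * deriv R₁ x₀)
            - (deriv R₂ t₀ - deriv (deriv R₁) x₀) * (w.2.1 * deriv (deriv R₁) x₀)
              / (2 * deriv R₁ x₀ ^ 2)))
        (2 * (w.2.2 * deriv Q y₀) * (w.2.1 * deriv (deriv R₁) x₀)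
            + w.2.2 ^ 2 * deriv (deriv Q) y₀ * deriv R₁ x₀
          + ((w.1 ^ 2 * deriv (deriv (deriv R₂)) t₀
              - w.2.1 ^ 2 * deriv (deriv (deriv (deriv R₁))) x₀) / (2 * deriv R₁ x₀)
            - (w.1 * deriv (deriv R₂) t₀ - w.2.1 * deriv (deriv (deriv R₁)) x₀)
              * (w.2.1 * deriv (deriv R₁) x₀) / deriv R₁ x₀ ^ 2
            + (deriv R₂ t₀ - deriv (deriv R₁) x₀)
              * (2 * (w.2.1 * deriv (deriv R₁) x₀) ^ 2 / deriv R₁ x₀ ^ 3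
                - w.2.1 ^ 2 * deriv (deriv (deriv R₁)) x₀ / deriv R₁ x₀ ^ 2) / 2)) ∧
      HasJet D w (t₀, x₀, y₀) v (V₀ y₀)
        (deriv Q y₀ * (w.2.1 * deriv R₁ x₀ + w.1 * deriv R₂ t₀) + w.2.2 * deriv V₀ y₀)
        (deriv Q y₀ * (w.2.1 ^ 2 * deriv (deriv R₁) x₀ + w.1 ^ 2 * deriv (deriv R₂) t₀)
            + 2 * (w.2.2 * deriv (deriv Q) y₀) * (w.2.1 * deriv R₁ x₀ + w.1 * deriv R₂ t₀)
          + w.2.2 * (w.2.2 * deriv (deriv V₀) y₀)) := by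
  have hD := isOpen_separableDomain hR₁ hR₂ hQ
  have hz : (t₀, x₀, y₀) ∈ separableDomain R₁ R₂ Q := ⟨by simp [tau, hQy], hR₁x⟩
  refine ⟨_, _, _, hD, hz, solvesAt_separable hR₁ hR₂ hQ hV₀, fun w => ⟨?_, ?_⟩⟩
  · have hju := (hasJet_pd_ex_log_tau hR₁ hR₂ hQ hz hQy hR w).add hD hz
      (hasJet_seed hD hz hR₁ hR₂ (fun _ hz => hz.2) w)
    rw [zero_add] at hju
    exact hju
  · have hjv := (hasJet_pd_ey_log_tau hR₁ hR₂ hQ hz hQy hR w).add hD hz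
      (HasJet.comp_clm yBase hV₀)
    rw [zero_add] at hjv
    exact hjv

end Separable

/-- The quartic polynomial with the coefficients `c₀, …, c₄` in powers of `x - x₀`. -/
def quartic (c₀ c₁ c₂ c₃ c₄ x₀ x : ℝ) : ℝ :=
  c₀ + c₁ * (x - x₀) + c₂ * (x - x₀) ^ 2 + c₃ * (x - x₀) ^ 3 + c₄ * (x - x₀) ^ 4

theorem contDiff_quartic (c₀ c₁ c₂ c₃ c₄ x₀ : ℝ) : ContDiff ℝ ∞ (quartic c₀ c₁ c₂ c₃ c₄ x₀) := by
  unfold quartic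
  fun_prop

theorem quartic_self (c₀ c₁ c₂ c₃ c₄ x₀ : ℝ) : quartic c₀ c₁ c₂ c₃ c₄ x₀ x₀ = c₀ := by
  simp [quartic]

theorem deriv_quartic (c₀ c₁ c₂ c₃ c₄ x₀ : ℝ) :
    deriv (quartic c₀ c₁ c₂ c₃ c₄ x₀) = quartic c₁ (2 * c₂) (3 * c₃) (4 * c₄) 0 x₀ := by
  funext x
  have hsub : HasDerivAt (fun x : ℝ => x - x₀) 1 x := (hasDerivAt_id x).sub_const x₀
  have hquartic : HasDerivAt (quartic c₀ c₁ c₂ c₃ c₄ x₀) _ x :=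
    ((((hsub.const_mul c₁).const_add c₀).add ((hsub.pow 2).const_mul c₂)).add
      ((hsub.pow 3).const_mul c₃)).add ((hsub.pow 4).const_mul c₄)
  rw [hquartic.deriv, quartic]
  simp
  ring

/-- The linear form `a dt + b dx + c dy`. -/
noncomputable def baseForm (a b c : ℝ) : Base →L[ℝ] ℝ := a • tBase + b • xBase + c • yBase

theorem fderiv_eq_baseForm {f : Base → ℝ} {z : Base} {a b c : ℝ}
    (h : ∀ w, pd w f z = w.1 * a + w.2.1 * b + w.2.2 * c) : fderiv ℝ f z = baseForm a b c :=
  ContinuousLinearMap.ext fun w => (h w).trans (by simp [baseForm]; ring)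

theorem exists_solution (p : Total) {ρ : ℝ} (hρ : ρ ≠ 0) (θ n ut ux : ℝ) :
    ∃ C : Base → ℝ, ∀ d k m l : ℝ, ∃ (D : Set Base) (u v : Base → ℝ),
      IsOpen D ∧ proj p ∈ D ∧ ContDiffOn ℝ ∞ u D ∧ ContDiffOn ℝ ∞ v D ∧
      (∀ z ∈ D, SolvesAt u v z) ∧ graphPoint u v (proj p) = p ∧
      fderiv ℝ u (proj p) = baseForm ut ux ρ ∧ fderiv ℝ v (proj p) = baseForm θ ρ n ∧
      (∀ w : Base, pd w (pd w u) (proj p) =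
        C w + d * w.1 ^ 2 + k * w.2.1 ^ 2 + m * w.2.2 ^ 2) ∧
      (∀ w : Base, pd w (pd w v) (proj p) =
        (θ - 2 * ρ * uTotal p) * w.2.1 ^ 2 + 2 * ρ * ut * w.1 ^ 2
          + 2 * m / ρ * w.2.2 * (ρ * w.2.1 + θ * w.1) + l * w.2.2 ^ 2) ∧
      pd ex (pd ex (pd ex v)) (proj p) = -2 * (ρ * ux + uTotal p * (θ - 2 * ρ * uTotal p)) := by
  obtain ⟨t₀, x₀, y₀, u₀, v₀⟩ := p
  have hproj : proj (t₀, x₀, y₀, u₀, v₀) = (t₀, x₀, y₀) := rfl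
  have huTotal : uTotal (t₀, x₀, y₀, u₀, v₀) = u₀ := rfl
  simp only [hproj, huTotal]
  refine ⟨fun w => -(w.1 * (2 * (ρ * ut)) + w.2.1 * (2 * (ρ * ux + u₀ * (θ - 2 * ρ * u₀))))
    * (w.2.1 * (θ - 2 * ρ * u₀)) / ρ ^ 2
    + 2 * ρ * u₀ * (2 * (w.2.1 * (θ - 2 * ρ * u₀)) ^ 2 / ρ ^ 3
      + w.2.1 ^ 2 * (2 * (ρ * ux + u₀ * (θ - 2 * ρ * u₀))) / ρ ^ 2) / 2
    + 2 * w.2.2 * (w.2.1 * (θ - 2 * ρ * u₀)), fun d k m l => ?_⟩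
  obtain ⟨D, u, v, hD, hz, hs, hj⟩ := exists_separable_solution
    (contDiff_quartic 0 ρ ((θ - 2 * ρ * u₀) / 2) (-(ρ * ux + u₀ * (θ - 2 * ρ * u₀)) / 3)
      (-(ρ * k) / 12) x₀)
    (contDiff_quartic 0 θ (ρ * ut) (ρ * d / 3) 0 t₀) (contDiff_quartic 0 1 (m / (2 * ρ)) 0 0 y₀)
    (contDiff_quartic v₀ n (l / 2) 0 0 y₀) (t₀ := t₀) (x₀ := x₀) (y₀ := y₀)
    (by rwa [deriv_quartic, quartic_self]) (by simp [quartic_self]) (quartic_self _ _ _ _ _ _)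
  simp only [deriv_quartic, quartic_self] at hj
  have hu := (hj 0).1.smooth
  have hv := (hj 0).2.smooth
  have huz : u (t₀, x₀, y₀) = u₀ := (hj 0).1.val.trans (by field_simp; ring)
  have hvz : v (t₀, x₀, y₀) = v₀ := (hj 0).2.val
  have hvx : pd ex v (t₀, x₀, y₀) = ρ := (hj ex).2.fst.trans (by simp)
  have hux : pd ex u (t₀, x₀, y₀) = ux := (hj ex).1.fst.trans (by simp; field_simp; ring)
  have hvxx : pd ex (pd ex v) (t₀, x₀, y₀) = θ - 2 * ρ * u₀ := (hj ex).2.snd.trans (by simp; ring)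
  refine ⟨D, u, v, hD, hz, hu, hv, hs, ?_, fderiv_eq_baseForm fun w => ?_,
    fderiv_eq_baseForm fun w => ?_, fun w => ?_, fun w => ?_, ?_⟩
  · rw [graphPoint, huz, hvz]
  · rw [(hj w).1.fst]; field_simp; ring
  · rw [(hj w).2.fst]; ring
  · rw [(hj w).1.snd]; field_simp; ring
  · rw [(hj w).2.snd]; simp; field_simp
  · have hvtx : pd et (pd ex v) (t₀, x₀, y₀) = 0 := by
      rw [pd_pd_eq_polarization hD hz hv, (hj _).2.snd, (hj _).2.snd, (hj _).2.snd]
      simp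
    rw [pd_ex_pd_ex_pd_ex_eq hD hz hu hv hs, hvtx, huz, hux, hvx, hvxx]
    ring

theorem eventually_sum_pow_smul_ne_zero {E : Type*} [AddCommGroup E] [Module ℝ E] {n : ℕ}
    {a : Fin n → E} (h : a ≠ 0) :
    ∀ᶠ s : ℝ in Filter.cofinite, ∑ i : Fin n, s ^ (i : ℕ) • a i ≠ 0 := by
  obtain ⟨i, hi⟩ := Function.ne_iff.1 h
  obtain ⟨f, hf⟩ := Module.Projective.exists_dual_ne_zero ℝ hi
  set P : Polynomial ℝ := ∑ i : Fin n, Polynomial.monomial i (f (a i)) with hP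
  have hcoeff : P.coeff i = f (a i) := by
    simp [hP, Polynomial.finsetSum_coeff, Polynomial.coeff_monomial, Fin.val_inj]
  have hP0 : P ≠ 0 := fun h0 => hf (by rw [← hcoeff, h0, Polynomial.coeff_zero])
  refine (Polynomial.finite_setOfPred_isRoot hP0).eventually_cofinite_notMem.mono
    fun s hs hs0 => hs ?_
  have heval := congrArg f hs0
  simpa [hP, Polynomial.IsRoot, Polynomial.eval_finsetSum, mul_comm] using heval

section LinearAlgebra

theorem exists_ne_baseForm {m : Total} {s : ℝ}
    (h : tTotal m = 0 → xTotal m = 0 → uTotal m ≠ s * yTotal m) :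
    ∃ ut ux, uTotal m ≠ baseForm ut ux s (proj m) := by
  by_contra! hcon
  have hform : ∀ ut ux, uTotal m = ut * tTotal m + ux * xTotal m + s * yTotal m := hcon
  exact h (by linarith [hform 0 0, hform 1 0]) (by linarith [hform 0 0, hform 0 1])
    (by linarith [hform 0 0])

theorem exists_eq_baseForm_imp {A : Total →L[ℝ] Base} {m : Total} {s : ℝ} {β : Base →L[ℝ] ℝ}
    (hA : A m = 0) (hβ : vTotal m = β (proj m)) (hs : A (0, 0, 1, s, β ey) ≠ 0) :
    ∃ ut ux, uTotal m = baseForm ut ux s (proj m) → m = 0 := by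
  by_contra! hcon
  obtain ⟨ut, ux, hne⟩ := exists_ne_baseForm (m := m) (s := s) fun ht hx hu => by
    have hproj : proj m = yTotal m • ey := Prod.ext (ht.trans (mul_zero _).symm)
      (Prod.ext (hx.trans (mul_zero _).symm) (mul_one _).symm)
    have hv : vTotal m = yTotal m * β ey := by
      rw [hβ, hproj, map_smul, smul_eq_mul]
    have hmy : m = yTotal m • ((0, 0, 1, s, β ey) : Total) :=
      Prod.ext (ht.trans (mul_zero _).symm) (Prod.ext (hx.trans (mul_zero _).symm)
        (Prod.ext (mul_one _).symm (Prod.ext (hu.trans (mul_comm _ _)) hv)))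
    rw [hmy, map_smul, smul_eq_zero] at hA
    exact (hcon 0 0).2 (by rw [hmy, hA.resolve_right hs, zero_smul])
  exact hne (hcon ut ux).1

variable (F : Total ≃L[ℝ] Total)

theorem eq_add_of_proj_apply_eq_zero {k : Total} (h : proj (F k) = 0) :
    k = uTotal (F k) • F.symm Eu + vTotal (F k) • F.symm Ev := by
  simp only [Prod.ext_iff] at h
  obtain ⟨ht, hx, hy⟩ := h
  apply F.injective
  rw [map_add, map_smul, map_smul, F.apply_symm_apply, F.apply_symm_apply]
  ext <;> simp_all

theorem proj_apply_Ey_Eu_Ev_ne_zero :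
    ¬(proj (F Ey) = 0 ∧ proj (F Eu) = 0 ∧ proj (F Ev) = 0) := by
  rintro ⟨hy, hu, hv⟩
  let G : ℝ × ℝ →ₗ[ℝ] Base := (LinearMap.toSpanSingleton ℝ Base (proj (F Et))).coprod
    (LinearMap.toSpanSingleton ℝ Base (proj (F Ex)))
  have hG : Function.Surjective G := fun b => by
    obtain ⟨k, hk⟩ := F.surjective (b.1, b.2.1, b.2.2, 0, 0)
    refine ⟨(tTotal k, xTotal k), ?_⟩
    have hsum : k = tTotal k • Et + xTotal k • Ex + yTotal k • Ey + uTotal k • Eu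
        + vTotal k • Ev := by ext <;> simp
    have hproj : proj (F k) = tTotal k • proj (F Et) + xTotal k • proj (F Ex) := by
      conv_lhs => rw [hsum]
      simp only [map_add, map_smul, hy, hu, hv, smul_zero, add_zero]
    exact hproj.symm.trans (by rw [hk]; rfl)
  simpa using LinearMap.finrank_le_finrank_of_surjective hG

theorem exists_transversal {s : ℝ} {β : Base →L[ℝ] ℝ}
    (hβ : vTotal (F.symm Eu) ≠ β (proj (F.symm Eu))) (hs : proj (F (0, 0, 1, s, β ey)) ≠ 0) :
    ∃ ut ux, ∀ z, proj (F (graphLift (baseForm ut ux s) β z)) = 0 → z = 0 := by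
  set b : Total →L[ℝ] ℝ := vTotal - β.comp proj
  have hbw : b (F.symm Eu) ≠ 0 := sub_ne_zero.2 hβ
  set m : Total := b (F.symm Eu) • F.symm Ev - b (F.symm Ev) • F.symm Eu with hm
  have hbm : b m = 0 := by simp [hm, mul_comm]
  have hFm : proj (F m) = 0 := by simp [hm]
  obtain ⟨ut, ux, h⟩ := exists_eq_baseForm_imp (A := proj.comp (F : Total →L[ℝ] Total)) hFm
    (sub_eq_zero.1 hbm) hs
  refine ⟨ut, ux, fun z hz => ?_⟩
  set k := graphLift (baseForm ut ux s) β z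
  have hspan := eq_add_of_proj_apply_eq_zero F hz
  generalize uTotal (F k) = g, vTotal (F k) = g' at hspan
  have hk : b (F.symm Eu) • k = g' • m := by
    have hbk : b k = 0 := sub_eq_zero.2 rfl
    rw [hspan, map_add, map_smul, map_smul, smul_eq_mul, smul_eq_mul] at hbk
    calc b (F.symm Eu) • k
        = (g * b (F.symm Eu) + g' * b (F.symm Ev)) • F.symm Eu + g' • m := by
          rw [hspan, hm]
          module
      _ = g' • m := by rw [hbk, zero_smul, zero_add]
  have hg' : g' • m = 0 := by
    rcases eq_or_ne g' 0 with rfl | hg'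
    · exact zero_smul _ _
    have huk : uTotal k - baseForm ut ux s (proj k) = 0 := sub_eq_zero.2 rfl
    have hum : g' * (uTotal m - baseForm ut ux s (proj m)) = 0 := by
      have hcongr := congrArg (uTotal - (baseForm ut ux s).comp proj) hk
      rw [map_smul, map_smul] at hcongr
      exact hcongr.symm.trans ((congrArg _ huk).trans (smul_zero _))
    rw [h (sub_eq_zero.1 ((mul_eq_zero.1 hum).resolve_left hg')), smul_zero]
  exact congrArg proj ((smul_eq_zero.1 (hk.trans hg')).resolve_left hbw)

end LinearAlgebra

section Frame

variable {Ω : Set Total} {Φ : Total → Total} {p : Total} {α β L : Base →L[ℝ] ℝ} {ξ : Base}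

theorem fderiv_baseComp (hΩ : IsOpen Ω) (hp : p ∈ Ω) (h : ContDiffOn ℝ ∞ Φ Ω) :
    fderiv ℝ (baseComp Φ) p = proj.comp (fderiv ℝ Φ p) :=
  (proj.hasFDerivAt.comp p (differentiableAt_of_mem hΩ hp h).hasFDerivAt).fderiv

theorem pd_compV (hΩ : IsOpen Ω) (hp : p ∈ Ω) (h : ContDiffOn ℝ ∞ Φ Ω) (w : Total) :
    pd w (compV Φ) p = vTotal (fderiv ℝ Φ p w) :=
  congrArg (· w) (vTotal.hasFDerivAt.comp p (differentiableAt_of_mem hΩ hp h).hasFDerivAt).fderiv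

theorem IsPointTransformation.exists_fderiv_eq (hΦ : IsPointTransformation Ω Φ) (hp : p ∈ Ω) :
    ∃ F : Total ≃L[ℝ] Total, fderiv ℝ (baseComp Φ) p = proj.comp (F : Total →L[ℝ] Total) ∧
      ∀ w, pd w (compV Φ) p = vTotal (F w) :=
  ⟨ContinuousLinearMap.toContinuousLinearEquivOfDetNeZero _ (hΦ.jacobian_ne_zero p hp), by
    rw [ContinuousLinearMap.coe_toContinuousLinearEquivOfDetNeZero,
      fderiv_baseComp hΦ.isOpen hp hΦ.smooth], pd_compV hΦ.isOpen hp hΦ.smooth⟩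

namespace IsFrame

theorem ne_zero (hF : IsFrame Φ p α β ξ L) : ξ ≠ 0 := by
  rintro rfl
  simpa [Prod.ext_iff] using hF.map_ξ

theorem pd_defect_eq (hF : IsFrame Φ p α β ξ L) (k : Total) :
    pd k (defect Φ L) p = pd Eu (defect Φ L) p * (uTotal k - α (proj k))
      + pd Ev (defect Φ L) p * (vTotal k - β (proj k)) := by
  have hk : k = graphLift α β (proj k) + (uTotal k - α (proj k)) • Eu
      + (vTotal k - β (proj k)) • Ev := by ext <;> simp [graphLift]
  conv_lhs => rw [hk]
  rw [pd_add_dir, pd_add_dir, pd_smul_dir, pd_smul_dir, hF.pd_defect, zero_add, mul_comm,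
    mul_comm (vTotal k - _)]

end IsFrame

-- The second derivatives of `u` can be prescribed freely along a solution, so the second order
-- identity leaves no room for a dependence of the defect on `u`.
theorem IsPointSymmetry.pd_Eu_defect_eq_zero_of_isFrame (hΦ : IsPointSymmetry Ω Φ) (hp : p ∈ Ω)
    {s θ n ut ux : ℝ} (hs : s ≠ 0)
    (hF : IsFrame Φ p (baseForm ut ux s) (baseForm θ s n) ξ L) : pd Eu (defect Φ L) p = 0 := by
  obtain ⟨C, hC⟩ := exists_solution p hs θ n ut ux
  set j := graphLift (baseForm ut ux s) (baseForm θ s n)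
  obtain ⟨c, b, hidentity⟩ : ∃ c b, ∀ d k m : ℝ,
      pd Eu (defect Φ L) p * (d * ξ.1 ^ 2 + k * ξ.2.1 ^ 2 + m * ξ.2.2 ^ 2)
        + m * b * ξ.2.2 * (s * ξ.2.1 + θ * ξ.1) = c := by
    refine ⟨L et - pd (j ξ) (pd (j ξ) (defect Φ L)) p - pd Eu (defect Φ L) p * C ξ
      - pd Ev (defect Φ L) p * ((θ - 2 * s * uTotal p) * ξ.2.1 ^ 2 + 2 * s * ut * ξ.1 ^ 2)
      - 2 * compU Φ p * L ex, pd Ev (defect Φ L) p * (2 / s), fun d k m => ?_⟩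
    obtain ⟨D, u, v, hD, hz, hu, hv, hsol, hgraph, hα, hβ, hu₂, hv₂, -⟩ := hC d k m 0
    have heq := hΦ.second_order_identity hD hu hv hsol hz (hgraph.symm ▸ hp)
      (by rw [hgraph, hα, hβ]; exact hF)
    rw [hgraph, hα, hβ, hu₂, hv₂] at heq
    linear_combination -heq
  by_contra hne
  have h0 : c = 0 := by simpa using (hidentity 0 0 0).symm
  have ht : ξ.1 = 0 := by simpa [hne, h0] using hidentity 1 0 0
  have hx : ξ.2.1 = 0 := by simpa [hne, h0] using hidentity 0 1 0
  have hy : ξ.2.2 = 0 := by simpa [hne, h0, ht, hx] using hidentity 0 0 1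
  exact hF.ne_zero (Prod.ext ht (Prod.ext hx hy))

/-- The linear form `s² dt + s dx + s³ dy`. A nonzero vector is annihilated by only finitely many
forms on this curve, which supplies the differentials in general position. -/
noncomputable abbrev momentForm (s : ℝ) : Base →L[ℝ] ℝ := baseForm (s ^ 2) s (s ^ 3)

theorem eventually_vTotal_ne_momentForm {k : Total}
    (h : ¬(tTotal k = 0 ∧ xTotal k = 0 ∧ yTotal k = 0 ∧ vTotal k = 0)) :
    ∀ᶠ s in Filter.cofinite, vTotal k ≠ momentForm s (proj k) := by
  have ha : ![vTotal k, -xTotal k, -tTotal k, -yTotal k] ≠ 0 := fun h0 => h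
    ⟨neg_eq_zero.1 (congrFun h0 2), neg_eq_zero.1 (congrFun h0 1), neg_eq_zero.1 (congrFun h0 3),
      congrFun h0 0⟩
  refine (eventually_sum_pow_smul_ne_zero ha).mono fun s hs hv => hs ?_
  simp [Fin.sum_univ_four, baseForm] at hv ⊢
  linarith

theorem eventually_proj_apply_ne_zero (F : Total ≃L[ℝ] Total) :
    ∀ᶠ s in Filter.cofinite, proj (F (0, 0, 1, s, momentForm s ey)) ≠ 0 := by
  have ha : ![proj (F Ey), proj (F Eu), 0, proj (F Ev)] ≠ 0 := fun h0 =>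
    proj_apply_Ey_Eu_Ev_ne_zero F ⟨congrFun h0 0, congrFun h0 1, congrFun h0 3⟩
  refine (eventually_sum_pow_smul_ne_zero ha).mono fun s hs h0 => hs ?_
  have hsum : ((0, 0, 1, s, momentForm s ey) : Total) = Ey + s • Eu + s ^ 3 • Ev := by
    ext <;> simp [baseForm]
  rw [hsum] at h0
  simp only [map_add, map_smul] at h0
  simpa [Fin.sum_univ_four] using h0

theorem IsPointSymmetry.fderiv_symm_Eu (hΦ : IsPointSymmetry Ω Φ) (hp : p ∈ Ω)
    {F : Total ≃L[ℝ] Total} (hF : fderiv ℝ (baseComp Φ) p = proj.comp (F : Total →L[ℝ] Total))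
    (hV : ∀ w, pd w (compV Φ) p = vTotal (F w)) :
    tTotal (F.symm Eu) = 0 ∧ xTotal (F.symm Eu) = 0 ∧ yTotal (F.symm Eu) = 0 ∧
      vTotal (F.symm Eu) = 0 := by
  by_contra hne
  obtain ⟨s, hs₀, hsv, hsF⟩ := ((Filter.eventually_cofinite_ne (0 : ℝ)).and
    ((eventually_vTotal_ne_momentForm hne).and (eventually_proj_apply_ne_zero F))).exists
  obtain ⟨ut, ux, hinj⟩ := exists_transversal F hsv hsF
  obtain ⟨ξ, L, hframe⟩ := exists_isFrame hΦ.isOpen hp hΦ.smooth (by rw [hF]; exact hinj)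
  have hu := hΦ.pd_Eu_defect_eq_zero_of_isFrame hp hs₀ hframe
  have hdefect : ∀ w, proj (F w) = 0 → vTotal (F w) =
      pd Ev (defect Φ L) p * (vTotal w - momentForm s (proj w)) := fun w hw => by
    have h := hframe.pd_defect_eq w
    rw [pd_defect hΦ.isOpen hp hΦ.smooth, hF, hV, hu, zero_mul, zero_add] at h
    rw [← h, show (proj.comp (F : Total →L[ℝ] Total)) w = 0 from hw, map_zero, sub_zero]
  have hv : pd Ev (defect Φ L) p = 0 := by
    have h := hdefect (F.symm Eu) (by simp)
    rw [F.apply_symm_apply] at h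
    exact (mul_eq_zero.1 h.symm).resolve_right (sub_ne_zero.2 hsv)
  have h := hdefect (F.symm Ev) (by simp)
  rw [hv, F.apply_symm_apply] at h
  simp at h

theorem IsPointSymmetry.fderiv_baseComp_Eu (hΦ : IsPointSymmetry Ω Φ) (hp : p ∈ Ω) :
    fderiv ℝ (baseComp Φ) p Eu = 0 ∧ pd Eu (compV Φ) p = 0 := by
  obtain ⟨F, hF, hV⟩ := hΦ.toIsPointTransformation.exists_fderiv_eq hp
  obtain ⟨ht, hx, hy, hv⟩ := hΦ.fderiv_symm_Eu hp hF hV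
  have hw : F.symm Eu = uTotal (F.symm Eu) • Eu := by ext <;> simp_all
  have hFw : Eu = uTotal (F.symm Eu) • F Eu := by rw [← map_smul, ← hw, F.apply_symm_apply]
  have hu : uTotal (F.symm Eu) ≠ 0 := fun h0 => by simp [h0] at hFw
  have hFu : F Eu = (uTotal (F.symm Eu))⁻¹ • Eu := by
    rw [eq_inv_smul_iff₀ hu, ← hFw]
  rw [hF, hV, ContinuousLinearMap.comp_apply]
  simp [hFu]

end Frame

section Frame

variable {Ω : Set Total} {Φ : Total → Total} {p : Total} {α β L : Base →L[ℝ] ℝ} {ξ : Base}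

theorem graphLift_eq_add (α β : Base →L[ℝ] ℝ) (w : Base) :
    graphLift α β w = graphLift 0 β w + α w • Eu := by
  ext <;> simp [graphLift]

theorem pd_pd_add_smul_Eu {f : Total → ℝ} (hΩ : IsOpen Ω) (hp : p ∈ Ω) (hf : ContDiffOn ℝ ∞ f Ω)
    (h : ∀ q ∈ Ω, pd Eu f q = 0) (k : Total) (r : ℝ) :
    pd (k + r • Eu) (pd (k + r • Eu) f) p = pd k (pd k f) p := by
  have hpd : ∀ q ∈ Ω, pd (k + r • Eu) f q = pd k f q := fun q hq => by
    rw [pd_add_dir, pd_smul_dir, h q hq, mul_zero, add_zero]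
  rw [pd_congr hΩ _ hpd p hp, pd_add_dir, pd_smul_dir, pd_pd_eq_zero hΩ hf h k p hp, mul_zero,
    add_zero]

theorem IsPointSymmetry.pd_Eu_defect_eq_zero (hΦ : IsPointSymmetry Ω Φ) (hp : p ∈ Ω)
    (L : Base →L[ℝ] ℝ) : pd Eu (defect Φ L) p = 0 := by
  obtain ⟨hbase, hV⟩ := hΦ.fderiv_baseComp_Eu hp
  rw [pd_defect hΦ.isOpen hp hΦ.smooth, hbase, hV, map_zero, sub_zero]

theorem IsPointSymmetry.isFrame_of_isFrame_zero (hΦ : IsPointSymmetry Ω Φ) (hp : p ∈ Ω)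
    (hF : IsFrame Φ p 0 β ξ L) (α : Base →L[ℝ] ℝ) : IsFrame Φ p α β ξ L := by
  have hbase : ∀ w, fderiv ℝ (baseComp Φ) p (graphLift α β w) =
      fderiv ℝ (baseComp Φ) p (graphLift 0 β w) := fun w => by
    rw [graphLift_eq_add, map_add, map_smul, (hΦ.fderiv_baseComp_Eu hp).1, smul_zero, add_zero]
  exact {
    inj := fun w hw => hF.inj w (hbase w ▸ hw)
    map_ξ := (hbase ξ).trans hF.map_ξ
    pd_defect := fun w => by
      rw [graphLift_eq_add, pd_add_dir, pd_smul_dir, hF.pd_defect, hΦ.pd_Eu_defect_eq_zero hp,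
        mul_zero, add_zero] }

theorem IsPointSymmetry.pd_Ev_defect_ne_zero (hΦ : IsPointSymmetry Ω Φ) (hp : p ∈ Ω)
    (hF : IsFrame Φ p α β ξ L) : pd Ev (defect Φ L) p ≠ 0 := by
  intro h0
  obtain ⟨F, hbase, hV⟩ := hΦ.toIsPointTransformation.exists_fderiv_eq hp
  have h := hF.pd_defect_eq (F.symm Ev)
  have hproj : (proj.comp (F : Total →L[ℝ] Total)) (F.symm Ev) = 0 := by simp
  rw [h0, hΦ.pd_Eu_defect_eq_zero hp, pd_defect hΦ.isOpen hp hΦ.smooth, hbase, hV, hproj,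
    map_zero] at h
  simp at h

theorem IsPointSymmetry.frame_identity (hΦ : IsPointSymmetry Ω Φ) (hp : p ∈ Ω) {ρ θ n : ℝ}
    (hρ : ρ ≠ 0) (hF : IsFrame Φ p 0 (baseForm θ ρ n) ξ L) :
    ξ.1 = 0 ∧ ξ.2.2 = 0 ∧
      L et = pd (graphLift 0 (baseForm θ ρ n) ξ) (pd (graphLift 0 (baseForm θ ρ n) ξ)
          (defect Φ L)) p
        + pd Ev (defect Φ L) p * ((θ - 2 * ρ * uTotal p) * ξ.2.1 ^ 2) + 2 * compU Φ p * L ex := by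
  have hidentity : ∀ ut l : ℝ, L et =
      pd (graphLift 0 (baseForm θ ρ n) ξ) (pd (graphLift 0 (baseForm θ ρ n) ξ) (defect Φ L)) p
        + pd Ev (defect Φ L) p * ((θ - 2 * ρ * uTotal p) * ξ.2.1 ^ 2 + 2 * ρ * ut * ξ.1 ^ 2
          + l * ξ.2.2 ^ 2) + 2 * compU Φ p * L ex := fun ut l => by
    obtain ⟨C, hC⟩ := exists_solution p hρ θ n ut 0
    obtain ⟨D, u, v, hD, hz, hu, hv, hs, hgraph, hα, hβ, -, hv₂, -⟩ := hC 0 0 0 l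
    have heq := hΦ.second_order_identity hD hu hv hs hz (hgraph.symm ▸ hp)
      (by rw [hgraph, hα, hβ]; exact hΦ.isFrame_of_isFrame_zero hp hF _)
    rw [hgraph, hα, hβ, hv₂, hΦ.pd_Eu_defect_eq_zero hp, graphLift_eq_add,
      pd_pd_add_smul_Eu hΦ.isOpen hp (contDiffOn_defect hΦ.smooth L)
        fun q hq => hΦ.pd_Eu_defect_eq_zero hq L] at heq
    linear_combination heq
  have hv := hΦ.pd_Ev_defect_ne_zero hp hF
  have ht : pd Ev (defect Φ L) p * (2 * ρ * ξ.1 ^ 2) = 0 := by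
    linear_combination hidentity 0 0 - hidentity 1 0
  have hy : pd Ev (defect Φ L) p * ξ.2.2 ^ 2 = 0 := by
    linear_combination hidentity 0 0 - hidentity 0 1
  exact ⟨by simpa [hv, hρ] using ht, by simpa [hv] using hy,
    by linear_combination hidentity 0 0⟩

end Frame

section ExEv

variable {Ω : Set Total} {Φ : Total → Total} {p : Total}

theorem IsPointSymmetry.exists_isFrame_momentForm (hΦ : IsPointSymmetry Ω Φ) (hp : p ∈ Ω) :
    ∀ᶠ s in Filter.cofinite, ∃ ξ L, IsFrame Φ p 0 (momentForm s) ξ L := by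
  obtain ⟨F, hF, hV⟩ := hΦ.toIsPointTransformation.exists_fderiv_eq hp
  obtain ⟨ht, hx, hy, hv⟩ := hΦ.fderiv_symm_Eu hp hF hV
  have hEv : ¬(tTotal (F.symm Ev) = 0 ∧ xTotal (F.symm Ev) = 0 ∧ yTotal (F.symm Ev) = 0 ∧
      vTotal (F.symm Ev) = 0) := by
    rintro ⟨ht', hx', hy', hv'⟩
    have hEu : F.symm Ev = uTotal (F.symm Ev) • Eu := by ext <;> simp_all
    have h := hV (F.symm Ev)
    rw [hEu, pd_smul_dir, (hΦ.fderiv_baseComp_Eu hp).2, ← hEu, F.apply_symm_apply] at h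
    simp at h
  filter_upwards [eventually_vTotal_ne_momentForm hEv] with s hs
  refine exists_isFrame hΦ.isOpen hp hΦ.smooth fun z hz => ?_
  rw [hF] at hz
  have hspan := eq_add_of_proj_apply_eq_zero F hz
  set k := graphLift 0 (momentForm s) z
  generalize uTotal (F k) = g, vTotal (F k) = g' at hspan
  have hg' : g' = 0 := by
    have hk : (vTotal - (momentForm s).comp proj) k = 0 := sub_eq_zero.2 rfl
    have hEu : (vTotal - (momentForm s).comp proj) (F.symm Eu) = 0 := by
      simp_all [baseForm]
    rw [hspan, map_add, map_smul, map_smul, hEu, smul_zero, zero_add] at hk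
    exact (smul_eq_zero.1 hk).resolve_right (sub_ne_zero.2 hs)
  rw [hg', zero_smul, add_zero] at hspan
  have hproj : proj (F.symm Eu) = 0 := Prod.ext ht (Prod.ext hx hy)
  exact (congrArg proj hspan).trans (by rw [map_smul, hproj, smul_zero])

theorem IsPointSymmetry.eventually_smul_add_eq_ex (hΦ : IsPointSymmetry Ω Φ) (hp : p ∈ Ω) :
    ∀ᶠ s : ℝ in Filter.cofinite, ∃ r : ℝ,
      r • (fderiv ℝ (baseComp Φ) p Ex + s • fderiv ℝ (baseComp Φ) p Ev) = ex := by
  filter_upwards [Filter.eventually_cofinite_ne (0 : ℝ), hΦ.exists_isFrame_momentForm hp]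
    with s hs ⟨ξ, L, hF⟩
  obtain ⟨ht, hy, -⟩ := hΦ.frame_identity hp hs hF
  have hlift : graphLift 0 (momentForm s) ξ = ξ.2.1 • (Ex + s • Ev) := by
    ext <;> simp [graphLift, baseForm, ht, hy, mul_comm]
  refine ⟨ξ.2.1, ?_⟩
  rw [← map_smul, ← map_add, ← map_smul, ← hlift, hF.map_ξ]

theorem IsPointSymmetry.fderiv_baseComp_Ex_Ev (hΦ : IsPointSymmetry Ω Φ) (hp : p ∈ Ω) :
    ∃ a b : ℝ, fderiv ℝ (baseComp Φ) p Ex = a • ex ∧ fderiv ℝ (baseComp Φ) p Ev = b • ex ∧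
      (a ≠ 0 ∨ b ≠ 0) := by
  have hex : (ex : Base) ≠ 0 := fun h => by simpa using congrArg xBase h
  have hline : ∀ᶠ s : ℝ in Filter.cofinite, ∃ c : ℝ, c ≠ 0 ∧
      fderiv ℝ (baseComp Φ) p Ex + s • fderiv ℝ (baseComp Φ) p Ev = c • ex :=
    (hΦ.eventually_smul_add_eq_ex hp).mono fun s ⟨r, hr⟩ => by
      have hr₀ : r ≠ 0 := fun h0 => hex (by rw [← hr, h0, zero_smul])
      exact ⟨r⁻¹, inv_ne_zero hr₀, (eq_inv_smul_iff₀ hr₀).2 hr⟩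
  obtain ⟨s, c, hc, hs⟩ := hline.exists
  obtain ⟨s', ⟨c', -, hs'⟩, hne⟩ := (hline.and (Filter.eventually_cofinite_ne s)).exists
  obtain ⟨b, hb⟩ : ∃ b : ℝ, fderiv ℝ (baseComp Φ) p Ev = b • ex := by
    refine ⟨(s' - s)⁻¹ * (c' - c), ?_⟩
    rw [mul_smul, eq_inv_smul_iff₀ (sub_ne_zero.2 hne), sub_smul, sub_smul, ← hs, ← hs',
      add_sub_add_left_eq_sub]
  have ha : fderiv ℝ (baseComp Φ) p Ex = (c - s * b) • ex := by
    rw [sub_smul, ← hs, hb, mul_smul, add_sub_cancel_right]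
  refine ⟨c - s * b, b, ha, hb, ?_⟩
  by_contra! h
  exact hc (by simpa [h.2] using h.1)

end ExEv

/-- The direction `∂/∂x + ρ ∂/∂v`. -/
abbrev dirXV (ρ : ℝ) : Total := (0, 1, 0, 0, ρ)

theorem dirXV_eq_add (ρ : ℝ) : dirXV ρ = Ex + ρ • Ev := by
  ext <;> simp

theorem graphLift_ex (θ ρ n : ℝ) : graphLift 0 (baseForm θ ρ n) ex = dirXV ρ := by
  ext <;> simp [graphLift, baseForm]

theorem graphLift_et (θ ρ n : ℝ) : graphLift 0 (baseForm θ ρ n) et = Et + θ • Ev := by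
  ext <;> simp [graphLift, baseForm]

theorem graphLift_ey (θ ρ n : ℝ) : graphLift 0 (baseForm θ ρ n) ey = Ey + n • Ev := by
  ext <;> simp [graphLift, baseForm]

theorem apply_eq_add (L : Base →L[ℝ] ℝ) (w : Base) :
    L w = w.1 * L et + w.2.1 * L ex + w.2.2 * L ey := by
  have hw : w = w.1 • et + w.2.1 • ex + w.2.2 • ey := by ext <;> simp
  conv_lhs => rw [hw]
  simp only [map_add, map_smul, smul_eq_mul]

theorem pd_pd_smul_dir {E : Type*} [NormedAddCommGroup E] [NormedSpace ℝ E] {D : Set E} {z : E}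
    {f : E → ℝ} (hD : IsOpen D) (hz : z ∈ D) (hf : ContDiffOn ℝ ∞ f D) (c : ℝ) (w : E) :
    pd (c • w) (pd (c • w) f) z = c ^ 2 * pd w (pd w f) z := by
  rw [pd_congr hD _ (fun z _ => pd_smul_dir c w f z) z hz, pd_smul_dir,
    pd_mul hD hz contDiffOn_const (contDiffOn_pd hD w hf), pd_const]
  ring

/-- The relations imposed on a linear form `L` when `Φ` maps the graph of a solution through `p`,
with `v_t = θ`, `v_x = ρ` and `v_y = n` there, to the graph of a solution with `dṽ = L`. -/
structure IsImageJet (Φ : Total → Total) (p : Total) (θ ρ n : ℝ) (L : Base →L[ℝ] ℝ) : Prop where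
  apply_ex : L ex * pd (dirXV ρ) (compX Φ) p = pd (dirXV ρ) (compV Φ) p
  pd_Ev_ne : pd Ev (compV Φ) p - L ex * pd Ev (compX Φ) p ≠ 0
  apply_Et : L (fderiv ℝ (baseComp Φ) p Et) =
    pd Et (compV Φ) p + θ * (pd Ev (compV Φ) p - L ex * pd Ev (compX Φ) p)
  apply_Ey : L (fderiv ℝ (baseComp Φ) p Ey) =
    pd Ey (compV Φ) p + n * (pd Ev (compV Φ) p - L ex * pd Ev (compX Φ) p)
  apply_et : L et * pd (dirXV ρ) (compX Φ) p ^ 2 =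
    pd (dirXV ρ) (pd (dirXV ρ) (compV Φ)) p - L ex * pd (dirXV ρ) (pd (dirXV ρ) (compX Φ)) p
      + (pd Ev (compV Φ) p - L ex * pd Ev (compX Φ) p) * (θ - 2 * ρ * uTotal p)
      + 2 * compU Φ p * L ex * pd (dirXV ρ) (compX Φ) p ^ 2

namespace IsPointSymmetry

variable {Ω : Set Total} {Φ : Total → Total} {p : Total} {ρ : ℝ}

theorem fderiv_baseComp_Ev (hΦ : IsPointSymmetry Ω Φ) (hp : p ∈ Ω) :
    fderiv ℝ (baseComp Φ) p Ev = pd Ev (compX Φ) p • ex := by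
  obtain ⟨-, b, -, hb, -⟩ := hΦ.fderiv_baseComp_Ex_Ev hp
  have h := fderiv_baseComp_apply hΦ.isOpen hp hΦ.smooth Ev
  rw [hb] at h
  have hX : b * 1 = pd Ev (compX Φ) p := congrArg xBase h
  rw [hb, ← hX, mul_one]

theorem fderiv_baseComp_Ex (hΦ : IsPointSymmetry Ω Φ) (hp : p ∈ Ω) :
    fderiv ℝ (baseComp Φ) p Ex = pd Ex (compX Φ) p • ex := by
  obtain ⟨a, -, ha, -⟩ := hΦ.fderiv_baseComp_Ex_Ev hp
  have h := fderiv_baseComp_apply hΦ.isOpen hp hΦ.smooth Ex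
  rw [ha] at h
  have hX : a * 1 = pd Ex (compX Φ) p := congrArg xBase h
  rw [ha, ← hX, mul_one]

theorem fderiv_baseComp_dirXV (hΦ : IsPointSymmetry Ω Φ) (hp : p ∈ Ω) (ρ : ℝ) :
    fderiv ℝ (baseComp Φ) p (dirXV ρ) = pd (dirXV ρ) (compX Φ) p • ex := by
  rw [dirXV_eq_add, map_add, map_smul, hΦ.fderiv_baseComp_Ex hp, hΦ.fderiv_baseComp_Ev hp,
    pd_add_dir, pd_smul_dir, add_smul, mul_smul]

theorem surjective_fderiv_baseComp_graphLift (hΦ : IsPointSymmetry Ω Φ) (hp : p ∈ Ω)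
    (hℓ : pd (dirXV ρ) (compX Φ) p ≠ 0) (θ n : ℝ) :
    Function.Surjective ((fderiv ℝ (baseComp Φ) p).comp (graphLift 0 (baseForm θ ρ n))) := by
  intro b
  obtain ⟨F, hF, -⟩ := hΦ.toIsPointTransformation.exists_fderiv_eq hp
  obtain ⟨k, hk⟩ := F.surjective (b.1, b.2.1, b.2.2, 0, 0)
  have hkb : fderiv ℝ (baseComp Φ) p k = b := by rw [hF]; exact congrArg proj hk
  set r := vTotal k - baseForm θ ρ n (proj k)
  have hsplit : k = graphLift 0 (baseForm θ ρ n) (proj k) + uTotal k • Eu + r • Ev := by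
    ext <;> simp [graphLift, r]
  refine ⟨proj k + (r * pd Ev (compX Φ) p / pd (dirXV ρ) (compX Φ) p) • ex, ?_⟩
  rw [hsplit, map_add, map_add, map_smul, map_smul, (hΦ.fderiv_baseComp_Eu hp).1,
    hΦ.fderiv_baseComp_Ev hp, smul_zero, add_zero] at hkb
  rw [← hkb, ContinuousLinearMap.comp_apply, map_add, map_smul, graphLift_ex, map_add, map_smul,
    hΦ.fderiv_baseComp_dirXV hp, smul_smul, smul_smul, div_mul_cancel₀ _ hℓ]

theorem pd_pd_dirXV_defect (hΦ : IsPointSymmetry Ω Φ) (hp : p ∈ Ω) (L : Base →L[ℝ] ℝ) :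
    pd (dirXV ρ) (pd (dirXV ρ) (defect Φ L)) p =
      pd (dirXV ρ) (pd (dirXV ρ) (compV Φ)) p
        - L ex * pd (dirXV ρ) (pd (dirXV ρ) (compX Φ)) p := by
  have hΩ := hΦ.isOpen
  have hsmooth := hΦ.smooth
  have hpd : ∀ q ∈ Ω, pd (dirXV ρ) (defect Φ L) q =
      pd (dirXV ρ) (compV Φ) q - L ex * pd (dirXV ρ) (compX Φ) q := fun q hq => by
    rw [pd_defect hΩ hq hsmooth, hΦ.fderiv_baseComp_dirXV hq, map_smul, smul_eq_mul, mul_comm]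
  rw [pd_congr hΩ _ hpd p hp]
  simp (disch := fun_prop (disch := assumption)) only [pd_sub hΩ hp, pd_mul hΩ hp, pd_const]
  ring

theorem exists_isImageJet (hΦ : IsPointSymmetry Ω Φ) (hp : p ∈ Ω) (hρ : ρ ≠ 0)
    (hℓ : pd (dirXV ρ) (compX Φ) p ≠ 0) (θ n : ℝ) : ∃ L, IsImageJet Φ p θ ρ n L := by
  have hΩ := hΦ.isOpen
  have hsmooth := hΦ.smooth
  have hinj := (injective_iff_map_eq_zero _).1
    (LinearMap.injective_iff_surjective.2 (hΦ.surjective_fderiv_baseComp_graphLift hp hℓ θ n))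
  obtain ⟨ξ, L, hF⟩ := exists_isFrame hΩ hp hsmooth hinj
  obtain ⟨-, -, hsecond⟩ := hΦ.frame_identity hp hρ hF
  have hξ : ξ = (pd (dirXV ρ) (compX Φ) p)⁻¹ • ex := by
    refine sub_eq_zero.1 (hF.inj _ ?_)
    rw [map_sub, map_sub, hF.map_ξ, map_smul, graphLift_ex, map_smul,
      hΦ.fderiv_baseComp_dirXV hp, inv_smul_smul₀ hℓ, sub_self]
  have hEv : pd Ev (defect Φ L) p = pd Ev (compV Φ) p - L ex * pd Ev (compX Φ) p := by
    rw [pd_defect hΩ hp hsmooth, hΦ.fderiv_baseComp_Ev hp, map_smul, smul_eq_mul, mul_comm]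
  have ht := hF.pd_defect et
  have hx := hF.pd_defect ex
  have hy := hF.pd_defect ey
  rw [graphLift_et, pd_add_dir, pd_smul_dir, hEv, pd_defect hΩ hp hsmooth] at ht
  rw [graphLift_ex, pd_defect hΩ hp hsmooth, hΦ.fderiv_baseComp_dirXV hp, map_smul,
    smul_eq_mul] at hx
  rw [graphLift_ey, pd_add_dir, pd_smul_dir, hEv, pd_defect hΩ hp hsmooth] at hy
  refine ⟨L, by linear_combination -hx, hEv ▸ hΦ.pd_Ev_defect_ne_zero hp hF,
    by linear_combination -ht, by linear_combination -hy, ?_⟩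
  rw [hξ, map_smul, graphLift_ex, pd_pd_smul_dir hΩ hp (contDiffOn_defect hsmooth L),
    hΦ.pd_pd_dirXV_defect hp, hEv] at hsecond
  simp only [Prod.smul_snd, Prod.smul_fst, smul_eq_mul, mul_one] at hsecond
  rw [hsecond]
  field_simp

theorem eventually_pd_dirXV_compX_ne_zero (hΦ : IsPointSymmetry Ω Φ) (hp : p ∈ Ω) :
    ∀ᶠ ρ : ℝ in Filter.cofinite, pd (dirXV ρ) (compX Φ) p ≠ 0 := by
  obtain ⟨a, b, ha, hb, hab⟩ := hΦ.fderiv_baseComp_Ex_Ev hp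
  have hne : ![fderiv ℝ (baseComp Φ) p Ex, fderiv ℝ (baseComp Φ) p Ev] ≠ 0 := fun h => by
    have ha0 : a = 0 := by simpa [ha] using congrArg xBase (congrFun h 0)
    have hb0 : b = 0 := by simpa [hb] using congrArg xBase (congrFun h 1)
    exact hab.elim (· ha0) (· hb0)
  refine (eventually_sum_pow_smul_ne_zero hne).mono fun ρ hρ h0 => hρ ?_
  have hdir := hΦ.fderiv_baseComp_dirXV hp ρ
  rw [h0, zero_smul, dirXV_eq_add, map_add, map_smul] at hdir
  simpa [Fin.sum_univ_two] using hdir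

theorem pd_Et_compY_and_sq (hΦ : IsPointSymmetry Ω Φ) (hp : p ∈ Ω) (hρ : ρ ≠ 0)
    (hℓ : pd (dirXV ρ) (compX Φ) p ≠ 0) :
    pd Et (compY Φ) p = 0 ∧ pd Ey (compY Φ) p ≠ 0 ∧
      pd (dirXV ρ) (compX Φ) p ^ 2 = pd Et (compT Φ) p := by
  obtain ⟨L, hL⟩ := hΦ.exists_isImageJet hp hρ hℓ 0 0
  obtain ⟨Lt, hLt⟩ := hΦ.exists_isImageJet hp hρ hℓ 1 0
  obtain ⟨Ly, hLy⟩ := hΦ.exists_isImageJet hp hρ hℓ 0 1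
  have htx : Lt ex = L ex := mul_right_cancel₀ hℓ (hLt.apply_ex.trans hL.apply_ex.symm)
  have hyx : Ly ex = L ex := mul_right_cancel₀ hℓ (hLy.apply_ex.trans hL.apply_ex.symm)
  obtain ⟨-, hv, hEt, hEy, het⟩ := hL
  obtain ⟨-, -, hEt₁, -, het₁⟩ := hLt
  obtain ⟨-, -, hEt₂, hEy₂, het₂⟩ := hLy
  rw [fderiv_baseComp_apply hΦ.isOpen hp hΦ.smooth, apply_eq_add] at hEt hEy hEt₁ hEt₂ hEy₂
  rw [htx] at hEt₁ het₁
  rw [hyx] at hEt₂ hEy₂ het₂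
  set δ := pd Ev (compV Φ) p - L ex * pd Ev (compX Φ) p
  set ℓ := pd (dirXV ρ) (compX Φ) p
  have hyt : Ly et = L et := mul_right_cancel₀ (pow_ne_zero 2 hℓ) (het₂.trans het.symm)
  have hYy : pd Ey (compY Φ) p * (Ly ey - L ey) = δ := by
    rw [hyt] at hEy₂
    linear_combination hEy₂ - hEy
  have hYt : pd Et (compY Φ) p * (Ly ey - L ey) = 0 := by
    rw [hyt] at hEt₂
    linear_combination hEt₂ - hEt
  have hYt₀ : pd Et (compY Φ) p = 0 :=
    (mul_eq_zero.1 hYt).resolve_right (right_ne_zero_of_mul (hYy.symm ▸ hv))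
  refine ⟨hYt₀, left_ne_zero_of_mul (hYy.symm ▸ hv), mul_left_cancel₀ hv ?_⟩
  rw [hYt₀] at hEt hEt₁
  linear_combination ℓ ^ 2 * (hEt - hEt₁) + pd Et (compT Φ) p * (het₁ - het)

theorem pd_Et_compY_eq_zero (hΦ : IsPointSymmetry Ω Φ) (hp : p ∈ Ω) : pd Et (compY Φ) p = 0 := by
  obtain ⟨ρ, hρ, hℓ⟩ := ((Filter.eventually_cofinite_ne (0 : ℝ)).and
    (hΦ.eventually_pd_dirXV_compX_ne_zero hp)).exists
  exact (hΦ.pd_Et_compY_and_sq hp hρ hℓ).1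

theorem pd_Ey_compY_ne_zero (hΦ : IsPointSymmetry Ω Φ) (hp : p ∈ Ω) : pd Ey (compY Φ) p ≠ 0 := by
  obtain ⟨ρ, hρ, hℓ⟩ := ((Filter.eventually_cofinite_ne (0 : ℝ)).and
    (hΦ.eventually_pd_dirXV_compX_ne_zero hp)).exists
  exact (hΦ.pd_Et_compY_and_sq hp hρ hℓ).2.1

-- The square of `X_x + ρ X_v` does not depend on `ρ`.
theorem pd_Ev_compX_eq_zero_and_sq (hΦ : IsPointSymmetry Ω Φ) (hp : p ∈ Ω) :
    pd Ev (compX Φ) p = 0 ∧ pd Ex (compX Φ) p ^ 2 = pd Et (compT Φ) p := by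
  have hcoeff : ![pd Ex (compX Φ) p ^ 2 - pd Et (compT Φ) p,
      2 * pd Ex (compX Φ) p * pd Ev (compX Φ) p, pd Ev (compX Φ) p ^ 2] = 0 := by
    by_contra hne
    obtain ⟨ρ, hρ, hℓ, hsum⟩ := ((Filter.eventually_cofinite_ne (0 : ℝ)).and
      ((hΦ.eventually_pd_dirXV_compX_ne_zero hp).and
        (eventually_sum_pow_smul_ne_zero hne))).exists
    have hsq := (hΦ.pd_Et_compY_and_sq hp hρ hℓ).2.2
    rw [dirXV_eq_add, pd_add_dir, pd_smul_dir] at hsq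
    apply hsum
    simp only [Fin.sum_univ_three, smul_eq_mul, Matrix.cons_val, Fin.val_zero, Fin.val_one,
      Fin.val_two]
    linear_combination hsq
  exact ⟨pow_eq_zero_iff two_ne_zero |>.1 (congrFun hcoeff 2), sub_eq_zero.1 (congrFun hcoeff 0)⟩

theorem pd_Ev_compX_eq_zero (hΦ : IsPointSymmetry Ω Φ) (hp : p ∈ Ω) : pd Ev (compX Φ) p = 0 :=
  (hΦ.pd_Ev_compX_eq_zero_and_sq hp).1

theorem pd_Ex_compX_sq (hΦ : IsPointSymmetry Ω Φ) (hp : p ∈ Ω) :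
    pd Ex (compX Φ) p ^ 2 = pd Et (compT Φ) p :=
  (hΦ.pd_Ev_compX_eq_zero_and_sq hp).2

theorem pd_dirXV_compX (hΦ : IsPointSymmetry Ω Φ) (hp : p ∈ Ω) (ρ : ℝ) :
    pd (dirXV ρ) (compX Φ) p = pd Ex (compX Φ) p := by
  rw [dirXV_eq_add, pd_add_dir, pd_smul_dir, hΦ.pd_Ev_compX_eq_zero hp, mul_zero, add_zero]

theorem pd_Ex_compX_ne_zero (hΦ : IsPointSymmetry Ω Φ) (hp : p ∈ Ω) : pd Ex (compX Φ) p ≠ 0 := by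
  obtain ⟨ρ, hρ⟩ := (hΦ.eventually_pd_dirXV_compX_ne_zero hp).exists
  rwa [hΦ.pd_dirXV_compX hp] at hρ

theorem pd_compT_eq_zero (hΦ : IsPointSymmetry Ω Φ) (hp : p ∈ Ω) :
    pd Ex (compT Φ) p = 0 ∧ pd Eu (compT Φ) p = 0 ∧ pd Ev (compT Φ) p = 0 := by
  have h := fderiv_baseComp_apply hΦ.isOpen hp hΦ.smooth
  have hx := (h Ex).symm.trans (hΦ.fderiv_baseComp_Ex hp)
  have hu := (h Eu).symm.trans (hΦ.fderiv_baseComp_Eu hp).1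
  have hv := (h Ev).symm.trans (hΦ.fderiv_baseComp_Ev hp)
  exact ⟨by simpa using congrArg tBase hx, congrArg tBase hu, by simpa using congrArg tBase hv⟩

theorem pd_compY_eq_zero (hΦ : IsPointSymmetry Ω Φ) (hp : p ∈ Ω) :
    pd Ex (compY Φ) p = 0 ∧ pd Eu (compY Φ) p = 0 ∧ pd Ev (compY Φ) p = 0 := by
  have h := fderiv_baseComp_apply hΦ.isOpen hp hΦ.smooth
  have hx := (h Ex).symm.trans (hΦ.fderiv_baseComp_Ex hp)
  have hu := (h Eu).symm.trans (hΦ.fderiv_baseComp_Eu hp).1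
  have hv := (h Ev).symm.trans (hΦ.fderiv_baseComp_Ev hp)
  exact ⟨by simpa using congrArg yBase hx, congrArg yBase hu, by simpa using congrArg yBase hv⟩

theorem pd_Eu_compX_eq_zero (hΦ : IsPointSymmetry Ω Φ) (hp : p ∈ Ω) : pd Eu (compX Φ) p = 0 :=
  congrArg xBase ((fderiv_baseComp_apply hΦ.isOpen hp hΦ.smooth Eu).symm.trans
    (hΦ.fderiv_baseComp_Eu hp).1)

theorem pd_Ex_pd_Ex_compX_eq_zero (hΦ : IsPointSymmetry Ω Φ) (hp : p ∈ Ω) :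
    pd Ex (pd Ex (compX Φ)) p = 0 := by
  have hΩ := hΦ.isOpen
  have hsmooth := hΦ.smooth
  have hsq : ∀ q ∈ Ω, pd Ex (compX Φ) q * pd Ex (compX Φ) q = pd Et (compT Φ) q := fun q hq =>
    (sq _).symm.trans (hΦ.pd_Ex_compX_sq hq)
  have h := pd_congr hΩ Ex hsq p hp
  rw [pd_pd_eq_zero hΩ (contDiffOn_compT hsmooth) (fun q hq => (hΦ.pd_compT_eq_zero hq).1) Et p hp]
    at h
  simp (disch := fun_prop (disch := assumption)) only [pd_mul hΩ hp] at h
  exact mul_left_cancel₀ (hΦ.pd_Ex_compX_ne_zero hp) (by linear_combination h / 2)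

end IsPointSymmetry

section CentralDirections

variable {Ω : Set Total} {Φ : Total → Total} {p : Total} {ρ : ℝ}

theorem pd_pd_dirXV (hΩ : IsOpen Ω) (hp : p ∈ Ω) {f : Total → ℝ} (hf : ContDiffOn ℝ ∞ f Ω) :
    pd (dirXV ρ) (pd (dirXV ρ) f) p =
      pd Ex (pd Ex f) p + 2 * ρ * pd Ex (pd Ev f) p + ρ ^ 2 * pd Ev (pd Ev f) p := by
  rw [dirXV_eq_add, pd_pd_add_dir hΩ hp hf, pd_pd_smul_dir hΩ hp hf,
    pd_congr hΩ Ex (fun z _ => pd_smul_dir ρ Ev f z) p hp,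
    pd_mul hΩ hp contDiffOn_const (contDiffOn_pd hΩ Ev hf), pd_const]
  ring

/-- The expression of `u` through `ũ` and the derivatives of `x̃`, which equals `u` for a point
symmetry. -/
noncomputable def uPullback (Φ : Total → Total) (p : Total) : ℝ :=
  pd Ex (compX Φ) p * compU Φ p + pd Et (compX Φ) p / (2 * pd Ex (compX Φ) p)

namespace IsPointSymmetry

theorem pd_Ev_compV_ne_zero (hΦ : IsPointSymmetry Ω Φ) (hp : p ∈ Ω) : pd Ev (compV Φ) p ≠ 0 := by
  obtain ⟨L, hL⟩ := hΦ.exists_isImageJet (ρ := 1) hp one_ne_zero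
    (by rw [hΦ.pd_dirXV_compX hp]; exact hΦ.pd_Ex_compX_ne_zero hp) 0 0
  simpa [hΦ.pd_Ev_compX_eq_zero hp] using hL.pd_Ev_ne

theorem pd_pd_dirXV_compX (hΦ : IsPointSymmetry Ω Φ) (hp : p ∈ Ω) :
    pd (dirXV ρ) (pd (dirXV ρ) (compX Φ)) p = 0 := by
  rw [pd_congr hΦ.isOpen _ (fun q hq => hΦ.pd_dirXV_compX hq ρ) p hp, dirXV_eq_add, pd_add_dir,
    pd_smul_dir, hΦ.pd_Ex_pd_Ex_compX_eq_zero hp,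
    pd_pd_eq_zero hΦ.isOpen (contDiffOn_compX hΦ.smooth)
      (fun q hq => hΦ.pd_Ev_compX_eq_zero hq) Ex p hp, mul_zero, add_zero]

theorem pd_Et_compV_eq_polynomial (hΦ : IsPointSymmetry Ω Φ) (hp : p ∈ Ω) (hρ : ρ ≠ 0) :
    pd Et (compV Φ) p =
      pd Ex (pd Ex (compV Φ)) p + 2 * uPullback Φ p * pd Ex (compV Φ) p
        + ρ * (2 * (pd Ex (pd Ev (compV Φ)) p + (uPullback Φ p - uTotal p) * pd Ev (compV Φ) p))
        + ρ ^ 2 * pd Ev (pd Ev (compV Φ)) p := by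
  have hXx := hΦ.pd_Ex_compX_ne_zero hp
  obtain ⟨L, hL⟩ := hΦ.exists_isImageJet hp hρ (by rwa [hΦ.pd_dirXV_compX hp]) 0 0
  obtain ⟨hx, -, hEt, -, het⟩ := hL
  rw [hΦ.pd_dirXV_compX hp, dirXV_eq_add, pd_add_dir, pd_smul_dir] at hx
  rw [fderiv_baseComp_apply hΦ.isOpen hp hΦ.smooth, apply_eq_add, hΦ.pd_Et_compY_eq_zero hp,
    ← hΦ.pd_Ex_compX_sq hp] at hEt
  rw [hΦ.pd_dirXV_compX hp, hΦ.pd_pd_dirXV_compX hp, hΦ.pd_Ev_compX_eq_zero hp,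
    pd_pd_dirXV hΦ.isOpen hp (contDiffOn_compV hΦ.smooth)] at het
  have hu : 2 * uPullback Φ p * pd Ex (compX Φ) p =
      2 * pd Ex (compX Φ) p ^ 2 * compU Φ p + pd Et (compX Φ) p := by
    rw [uPullback]
    field_simp
  linear_combination -hEt + het + 2 * uPullback Φ p * hx - L ex * hu

theorem compV_coefficients (hΦ : IsPointSymmetry Ω Φ) (hp : p ∈ Ω) :
    pd Et (compV Φ) p = pd Ex (pd Ex (compV Φ)) p + 2 * uPullback Φ p * pd Ex (compV Φ) p ∧
      pd Ex (pd Ev (compV Φ)) p = (uTotal p - uPullback Φ p) * pd Ev (compV Φ) p ∧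
      pd Ev (pd Ev (compV Φ)) p = 0 := by
  have hcoeff : ![pd Ex (pd Ex (compV Φ)) p + 2 * uPullback Φ p * pd Ex (compV Φ) p
        - pd Et (compV Φ) p,
      2 * (pd Ex (pd Ev (compV Φ)) p + (uPullback Φ p - uTotal p) * pd Ev (compV Φ) p),
      pd Ev (pd Ev (compV Φ)) p] = 0 := by
    by_contra hne
    obtain ⟨ρ, hρ, hsum⟩ := ((Filter.eventually_cofinite_ne (0 : ℝ)).and
      (eventually_sum_pow_smul_ne_zero hne)).exists
    apply hsum
    simp only [Fin.sum_univ_three, smul_eq_mul, Matrix.cons_val, Fin.val_zero, Fin.val_one,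
      Fin.val_two]
    linear_combination -hΦ.pd_Et_compV_eq_polynomial hp hρ
  have h₀ := congrFun hcoeff 0
  have h₁ := congrFun hcoeff 1
  simp only [Matrix.cons_val, Pi.zero_apply] at h₀ h₁
  exact ⟨by linear_combination -h₀, by linear_combination h₁ / 2, congrFun hcoeff 2⟩

-- Eliminating `ũ` from the coefficients expresses `u` times `V_v V_x` through functions that do
-- not depend on `u`.
theorem pd_Ex_compV_eq_zero (hΦ : IsPointSymmetry Ω Φ) : ∀ p ∈ Ω, pd Ex (compV Φ) p = 0 := by
  intro p hp
  have hΩ := hΦ.isOpen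
  have hsmooth := hΦ.smooth
  have heq : ∀ q ∈ Ω, 2 * uTotal q * (pd Ev (compV Φ) q * pd Ex (compV Φ) q) =
      pd Et (compV Φ) q * pd Ev (compV Φ) q + 2 * (pd Ex (pd Ev (compV Φ)) q * pd Ex (compV Φ) q)
        - pd Ex (pd Ex (compV Φ)) q * pd Ev (compV Φ) q := fun q hq => by
    obtain ⟨h₀, h₁, -⟩ := hΦ.compV_coefficients hq
    linear_combination -pd Ev (compV Φ) q * h₀ - 2 * pd Ex (compV Φ) q * h₁
  have hu : ∀ q ∈ Ω, pd Eu (compV Φ) q = 0 := fun q hq => (hΦ.fderiv_baseComp_Eu hq).2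
  have hV := contDiffOn_compV hsmooth
  have hux := pd_pd_eq_zero hΩ hV hu Ex
  have huv := pd_pd_eq_zero hΩ hV hu Ev
  have h := pd_congr hΩ Eu heq p hp
  simp (disch := fun_prop (disch := assumption)) only [pd_add hΩ hp, pd_sub hΩ hp, pd_mul hΩ hp,
    pd_const, pd_clm, hux p hp, huv p hp, pd_pd_eq_zero hΩ hV hu Et p hp,
    pd_pd_eq_zero hΩ (contDiffOn_pd hΩ Ex hV) hux Ex p hp,
    pd_pd_eq_zero hΩ (contDiffOn_pd hΩ Ev hV) huv Ex p hp] at h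
  have hprod : pd Ev (compV Φ) p * pd Ex (compV Φ) p = 0 := by
    have hone : uTotal Eu = 1 := rfl
    rw [hone] at h
    linear_combination h / 2
  exact (mul_eq_zero.1 hprod).resolve_left (hΦ.pd_Ev_compV_ne_zero hp)

theorem pd_Et_compV_eq_zero (hΦ : IsPointSymmetry Ω Φ) (hp : p ∈ Ω) : pd Et (compV Φ) p = 0 := by
  rw [(hΦ.compV_coefficients hp).1, pd_eq_zero_of_const hΦ.isOpen Ex hΦ.pd_Ex_compV_eq_zero p hp,
    hΦ.pd_Ex_compV_eq_zero p hp, mul_zero, add_zero]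

theorem uPullback_eq (hΦ : IsPointSymmetry Ω Φ) (hp : p ∈ Ω) : uPullback Φ p = uTotal p := by
  have h := (hΦ.compV_coefficients hp).2.1
  rw [pd_pd_eq_zero hΦ.isOpen (contDiffOn_compV hΦ.smooth) hΦ.pd_Ex_compV_eq_zero Ev p hp] at h
  exact (sub_eq_zero.1 ((mul_eq_zero.1 h.symm).resolve_right (hΦ.pd_Ev_compV_ne_zero hp))).symm

end IsPointSymmetry

end CentralDirections

theorem pd_eq_sum (w : Total) (f : Total → ℝ) (p : Total) :
    pd w f p = tTotal w * pd Et f p + xTotal w * pd Ex f p + yTotal w * pd Ey f p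
      + uTotal w * pd Eu f p + vTotal w * pd Ev f p := by
  have hw : w = tTotal w • Et + xTotal w • Ex + yTotal w • Ey + uTotal w • Eu + vTotal w • Ev := by
    ext <;> simp
  conv_lhs => rw [hw]
  simp only [pd_add_dir, pd_smul_dir]

/-- A smooth function of `(t, x, y, u, v)` that locally depends on `(t, x, y)` only. The derivatives
of its restriction to a graph do not involve the derivatives of `u` and `v`. -/
structure IsBasic (Ω : Set Total) (f : Total → ℝ) : Prop where
  smooth : ContDiffOn ℝ ∞ f Ω
  pd_Eu : ∀ p ∈ Ω, pd Eu f p = 0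
  pd_Ev : ∀ p ∈ Ω, pd Ev f p = 0

namespace IsBasic

variable {Ω : Set Total} {f g : Total → ℝ}

theorem const (c : ℝ) : IsBasic Ω fun _ => c :=
  ⟨contDiffOn_const, fun p _ => pd_const Eu c p, fun p _ => pd_const Ev c p⟩

theorem pd (hf : IsBasic Ω f) (hΩ : IsOpen Ω) (w : Total) : IsBasic Ω (pd w f) :=
  ⟨contDiffOn_pd hΩ w hf.smooth, pd_pd_eq_zero hΩ hf.smooth hf.pd_Eu w,
    pd_pd_eq_zero hΩ hf.smooth hf.pd_Ev w⟩

theorem add (hf : IsBasic Ω f) (hg : IsBasic Ω g) (hΩ : IsOpen Ω) :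
    IsBasic Ω fun p => f p + g p where
  smooth := hf.smooth.add hg.smooth
  pd_Eu p hp := by
    rw [pd_add hΩ hp hf.smooth hg.smooth, hf.pd_Eu p hp, hg.pd_Eu p hp, add_zero]
  pd_Ev p hp := by
    rw [pd_add hΩ hp hf.smooth hg.smooth, hf.pd_Ev p hp, hg.pd_Ev p hp, add_zero]

theorem sub (hf : IsBasic Ω f) (hg : IsBasic Ω g) (hΩ : IsOpen Ω) :
    IsBasic Ω fun p => f p - g p where
  smooth := hf.smooth.sub hg.smooth
  pd_Eu p hp := by
    rw [pd_sub hΩ hp hf.smooth hg.smooth, hf.pd_Eu p hp, hg.pd_Eu p hp, sub_zero]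
  pd_Ev p hp := by
    rw [pd_sub hΩ hp hf.smooth hg.smooth, hf.pd_Ev p hp, hg.pd_Ev p hp, sub_zero]

theorem mul (hf : IsBasic Ω f) (hg : IsBasic Ω g) (hΩ : IsOpen Ω) :
    IsBasic Ω fun p => f p * g p where
  smooth := hf.smooth.mul hg.smooth
  pd_Eu p hp := by
    rw [pd_mul hΩ hp hf.smooth hg.smooth, hf.pd_Eu p hp, hg.pd_Eu p hp, mul_zero, mul_zero,
      add_zero]
  pd_Ev p hp := by
    rw [pd_mul hΩ hp hf.smooth hg.smooth, hf.pd_Ev p hp, hg.pd_Ev p hp, mul_zero, mul_zero,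
      add_zero]

theorem pow (hf : IsBasic Ω f) (hΩ : IsOpen Ω) (n : ℕ) : IsBasic Ω fun p => f p ^ n := by
  induction n with
  | zero => simpa only [pow_zero] using const 1
  | succ n ih => simpa only [pow_succ] using ih.mul hf hΩ

theorem inv (hf : IsBasic Ω f) (hΩ : IsOpen Ω) (h0 : ∀ p ∈ Ω, f p ≠ 0) :
    IsBasic Ω fun p => (f p)⁻¹ where
  smooth := hf.smooth.inv h0
  pd_Eu p hp := by rw [pd_inv hΩ hp hf.smooth (h0 p hp), hf.pd_Eu p hp, neg_zero, zero_div]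
  pd_Ev p hp := by rw [pd_inv hΩ hp hf.smooth (h0 p hp), hf.pd_Ev p hp, neg_zero, zero_div]

section Graph

variable {D : Set Base} {u v : Base → ℝ} {z : Base}

theorem contDiffOn_graph (hf : IsBasic Ω f) (hu : ContDiffOn ℝ ∞ u D) (hv : ContDiffOn ℝ ∞ v D)
    (hm : ∀ z ∈ D, graphPoint u v z ∈ Ω) : ContDiffOn ℝ ∞ (fun z => f (graphPoint u v z)) D :=
  hf.smooth.comp (contDiffOn_graphPoint hu hv) hm

theorem pd_graph (hf : IsBasic Ω f) (hΩ : IsOpen Ω) (hD : IsOpen D) (hu : ContDiffOn ℝ ∞ u D)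
    (hv : ContDiffOn ℝ ∞ v D) (hz : z ∈ D) (hp : graphPoint u v z ∈ Ω) (w : Base) :
    BLP.pd w (fun z => f (graphPoint u v z)) z =
      BLP.pd (graphLift 0 0 w) f (graphPoint u v z) := by
  rw [pd_comp (differentiableAt_of_mem hΩ hp hf.smooth)
    (differentiableAt_of_mem hD hz (contDiffOn_graphPoint hu hv)), fderiv_graphPoint hD hz hu hv,
    pd_eq_sum, pd_eq_sum (graphLift 0 0 w), hf.pd_Eu _ hp, hf.pd_Ev _ hp]
  simp [graphLift]

end Graph

end IsBasic

theorem graphLift_zero_et : graphLift 0 0 et = Et := by ext <;> simp [graphLift]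

theorem graphLift_zero_ex : graphLift 0 0 ex = Ex := by ext <;> simp [graphLift]

theorem graphLift_zero_ey : graphLift 0 0 ey = Ey := by ext <;> simp [graphLift]

/-- The function on the total space whose restriction to a graph is `burgers q`, where `q` is the
restriction of the basic function `f`. -/
noncomputable def burgersTotal (f : Total → ℝ) : Total → ℝ := fun p =>
  pd Et f p - 2 * (f p * pd Ex f p) + pd Ex (pd Ex f) p

section BurgersTotal

variable {Ω : Set Total} {f : Total → ℝ} {D : Set Base} {u v : Base → ℝ}

theorem isBasic_burgersTotal (hf : IsBasic Ω f) (hΩ : IsOpen Ω) : IsBasic Ω (burgersTotal f) :=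
  ((hf.pd hΩ Et).sub ((IsBasic.const 2).mul (hf.mul (hf.pd hΩ Ex) hΩ) hΩ) hΩ).add
    ((hf.pd hΩ Ex).pd hΩ Ex) hΩ

theorem burgers_graph (hf : IsBasic Ω f) (hΩ : IsOpen Ω) (hD : IsOpen D)
    (hu : ContDiffOn ℝ ∞ u D) (hv : ContDiffOn ℝ ∞ v D) (hm : ∀ z ∈ D, graphPoint u v z ∈ Ω) :
    ∀ z ∈ D, burgers (fun z => f (graphPoint u v z)) z = burgersTotal f (graphPoint u v z) := by
  have hx : ∀ z ∈ D, pd ex (fun z => f (graphPoint u v z)) z = pd Ex f (graphPoint u v z) :=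
    fun z hz => by rw [hf.pd_graph hΩ hD hu hv hz (hm z hz), graphLift_zero_ex]
  intro z hz
  simp only [burgers, burgersTotal]
  rw [pd_congr hD ex hx z hz, hx z hz, hf.pd_graph hΩ hD hu hv hz (hm z hz),
    (hf.pd hΩ Ex).pd_graph hΩ hD hu hv hz (hm z hz), graphLift_zero_ex, graphLift_zero_et]

end BurgersTotal

/-- The term `q` of the base change `u ↦ σ u + q` that a point symmetry induces on graphs. -/
noncomputable def uShift (Φ : Total → Total) (p : Total) : ℝ :=
  pd Et (compX Φ) p * (2 * pd Ex (compX Φ) p)⁻¹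

/-- The term `b` in the expression `v = ṽ / ṽ_v + b`. -/
noncomputable def vShift (Φ : Total → Total) (p : Total) : ℝ :=
  vTotal p - (pd Ev (compV Φ) p)⁻¹ * compV Φ p

namespace IsPointSymmetry

variable {Ω : Set Total} {Φ : Total → Total} (hΦ : IsPointSymmetry Ω Φ)

include hΦ

theorem isBasic_compT : IsBasic Ω (compT Φ) :=
  ⟨contDiffOn_compT hΦ.smooth, fun _ hp => (hΦ.pd_compT_eq_zero hp).2.1,
    fun _ hp => (hΦ.pd_compT_eq_zero hp).2.2⟩

theorem isBasic_compX : IsBasic Ω (compX Φ) :=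
  ⟨contDiffOn_compX hΦ.smooth, fun _ hp => hΦ.pd_Eu_compX_eq_zero hp,
    fun _ hp => hΦ.pd_Ev_compX_eq_zero hp⟩

theorem isBasic_compY : IsBasic Ω (compY Φ) :=
  ⟨contDiffOn_compY hΦ.smooth, fun _ hp => (hΦ.pd_compY_eq_zero hp).2.1,
    fun _ hp => (hΦ.pd_compY_eq_zero hp).2.2⟩

theorem isBasic_uShift : IsBasic Ω (uShift Φ) := by
  have hΩ := hΦ.isOpen
  have hX := hΦ.isBasic_compX
  exact (hX.pd hΩ Et).mul (((IsBasic.const 2).mul (hX.pd hΩ Ex) hΩ).inv hΩ fun p hp =>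
    mul_ne_zero two_ne_zero (hΦ.pd_Ex_compX_ne_zero hp)) hΩ

theorem pd_Eu_compV_eq_zero : ∀ p ∈ Ω, pd Eu (compV Φ) p = 0 :=
  fun _ hp => (hΦ.fderiv_baseComp_Eu hp).2

theorem isBasic_inv_pd_Ev_compV : IsBasic Ω fun p => (pd Ev (compV Φ) p)⁻¹ := by
  have hV := contDiffOn_compV hΦ.smooth
  have hVv : IsBasic Ω (pd Ev (compV Φ)) := ⟨contDiffOn_pd hΦ.isOpen Ev hV,
    pd_pd_eq_zero hΦ.isOpen hV hΦ.pd_Eu_compV_eq_zero Ev,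
    fun p hp => (hΦ.compV_coefficients hp).2.2⟩
  exact hVv.inv hΦ.isOpen fun p hp => hΦ.pd_Ev_compV_ne_zero hp

theorem pd_inv_pd_Ev_compV_eq_zero {w : Total} (hw : ∀ p ∈ Ω, pd w (compV Φ) p = 0) {p : Total}
    (hp : p ∈ Ω) : pd w (fun p => (pd Ev (compV Φ) p)⁻¹) p = 0 := by
  have hV := contDiffOn_compV hΦ.smooth
  rw [pd_inv hΦ.isOpen hp (contDiffOn_pd hΦ.isOpen Ev hV) (hΦ.pd_Ev_compV_ne_zero hp),
    pd_pd_eq_zero hΦ.isOpen hV hw Ev p hp, neg_zero, zero_div]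

theorem pd_vShift {p : Total} (hp : p ∈ Ω) (w : Total) :
    pd w (vShift Φ) p = vTotal w - ((pd Ev (compV Φ) p)⁻¹ * pd w (compV Φ) p
      + compV Φ p * pd w (fun p => (pd Ev (compV Φ) p)⁻¹) p) := by
  have hV := contDiffOn_compV hΦ.smooth
  have ha := hΦ.isBasic_inv_pd_Ev_compV.smooth
  unfold vShift
  rw [pd_sub hΦ.isOpen hp vTotal.contDiff.contDiffOn (ha.mul hV), pd_clm,
    pd_mul hΦ.isOpen hp ha hV]

theorem pd_vShift_eq_vTotal {w : Total} (hw : ∀ p ∈ Ω, pd w (compV Φ) p = 0) {p : Total}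
    (hp : p ∈ Ω) : pd w (vShift Φ) p = vTotal w := by
  rw [hΦ.pd_vShift hp, hw p hp, hΦ.pd_inv_pd_Ev_compV_eq_zero hw hp]
  simp

theorem isBasic_vShift : IsBasic Ω (vShift Φ) where
  smooth := vTotal.contDiff.contDiffOn.sub
    (hΦ.isBasic_inv_pd_Ev_compV.smooth.mul (contDiffOn_compV hΦ.smooth))
  pd_Eu _ hp := hΦ.pd_vShift_eq_vTotal hΦ.pd_Eu_compV_eq_zero hp
  pd_Ev p hp := by
    rw [hΦ.pd_vShift hp, inv_mul_cancel₀ (hΦ.pd_Ev_compV_ne_zero hp),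
      hΦ.isBasic_inv_pd_Ev_compV.pd_Ev p hp]
    simp

section Graph

variable {D : Set Base} {u v : Base → ℝ} {z₀ : Base}

theorem isBaseChange (hD : IsOpen D) (hu : ContDiffOn ℝ ∞ u D) (hv : ContDiffOn ℝ ∞ v D)
    (hm : ∀ z ∈ D, graphPoint u v z ∈ Ω) :
    IsBaseChange D (fun z => compT Φ (graphPoint u v z)) (fun z => compX Φ (graphPoint u v z))
      (fun z => compY Φ (graphPoint u v z)) (fun z => pd Ex (compX Φ) (graphPoint u v z))
      (fun z => uShift Φ (graphPoint u v z)) := by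
  have hΩ := hΦ.isOpen
  have hT := hΦ.isBasic_compT
  have hX := hΦ.isBasic_compX
  have hY := hΦ.isBasic_compY
  exact
    { isOpen := hD
      smooth_τ := hT.contDiffOn_graph hu hv hm
      smooth_χ := hX.contDiffOn_graph hu hv hm
      smooth_ψ := hY.contDiffOn_graph hu hv hm
      smooth_σ := (hX.pd hΩ Ex).contDiffOn_graph hu hv hm
      smooth_q := hΦ.isBasic_uShift.contDiffOn_graph hu hv hm
      σ_ne_zero := fun z hz => hΦ.pd_Ex_compX_ne_zero (hm z hz)
      pd_ex_τ := fun z hz => by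
        rw [hT.pd_graph hΩ hD hu hv hz (hm z hz), graphLift_zero_ex,
          (hΦ.pd_compT_eq_zero (hm z hz)).1]
      pd_ex_ψ := fun z hz => by
        rw [hY.pd_graph hΩ hD hu hv hz (hm z hz), graphLift_zero_ex,
          (hΦ.pd_compY_eq_zero (hm z hz)).1]
      pd_et_ψ := fun z hz => by
        rw [hY.pd_graph hΩ hD hu hv hz (hm z hz), graphLift_zero_et,
          hΦ.pd_Et_compY_eq_zero (hm z hz)]
      pd_ex_χ := fun z hz => by
        rw [hX.pd_graph hΩ hD hu hv hz (hm z hz), graphLift_zero_ex]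
      pd_ex_σ := fun z hz => by
        rw [(hX.pd hΩ Ex).pd_graph hΩ hD hu hv hz (hm z hz), graphLift_zero_ex,
          hΦ.pd_Ex_pd_Ex_compX_eq_zero (hm z hz)]
      pd_et_τ := fun z hz => by
        rw [hT.pd_graph hΩ hD hu hv hz (hm z hz), graphLift_zero_et,
          hΦ.pd_Ex_compX_sq (hm z hz)]
      pd_et_χ := fun z hz => by
        have hXx := hΦ.pd_Ex_compX_ne_zero (hm z hz)
        rw [hX.pd_graph hΩ hD hu hv hz (hm z hz), graphLift_zero_et, uShift]
        field_simp }

theorem injective_fderiv_baseComp_graphPoint (hD : IsOpen D) (hu : ContDiffOn ℝ ∞ u D)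
    (hv : ContDiffOn ℝ ∞ v D) (hz₀ : z₀ ∈ D) (hp : graphPoint u v z₀ ∈ Ω) (w : Base)
    (hw : fderiv ℝ (fun z => baseComp Φ (graphPoint u v z)) z₀ w = 0) : w = 0 := by
  obtain ⟨hTx, hTu, hTv⟩ := hΦ.pd_compT_eq_zero hp
  obtain ⟨hYx, hYu, hYv⟩ := hΦ.pd_compY_eq_zero hp
  have hXx := hΦ.pd_Ex_compX_ne_zero hp
  rw [fderiv_baseComp_graphPoint hD hΦ.isOpen hz₀ hp hu hv hΦ.smooth,
    fderiv_baseComp_apply hΦ.isOpen hp hΦ.smooth, pd_eq_sum, pd_eq_sum _ (compX Φ),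
    pd_eq_sum _ (compY Φ), hTx, hTu, hTv, hYx, hYu, hYv, hΦ.pd_Et_compY_eq_zero hp,
    hΦ.pd_Eu_compX_eq_zero hp, hΦ.pd_Ev_compX_eq_zero hp, ← hΦ.pd_Ex_compX_sq hp] at hw
  obtain ⟨t, x, y⟩ := w
  have hy : y = 0 := by simpa [graphLift, hΦ.pd_Ey_compY_ne_zero hp] using congrArg yBase hw
  have ht : t = 0 := by simpa [graphLift, hXx, hy] using congrArg tBase hw
  have hx : x = 0 := by simpa [graphLift, hXx, hy, ht] using congrArg xBase hw
  rw [hy, ht, hx, Prod.mk_zero_zero, Prod.mk_zero_zero]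

theorem exists_solution_image (hD : IsOpen D) (hu : ContDiffOn ℝ ∞ u D)
    (hv : ContDiffOn ℝ ∞ v D) (hs : ∀ z ∈ D, SolvesAt u v z) (hz₀ : z₀ ∈ D)
    (hp : graphPoint u v z₀ ∈ Ω) :
    ∃ D₁ D' u' v', z₀ ∈ D₁ ∧ D₁ ⊆ D ∧ MapsGraph Ω Φ D₁ u v D' u' v' ∧
      ∀ z ∈ D', SolvesAt u' v' z :=
  hΦ.exists_mapsGraph hD hu hv hs hz₀ hp
    (hΦ.injective_fderiv_baseComp_graphPoint hD hu hv hz₀ hp)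

end Graph

end IsPointSymmetry

namespace MapsGraph

variable {Ω : Set Total} {Φ : Total → Total} {D D' : Set Base} {u v u' v' : Base → ℝ}

theorem u_eq (h : MapsGraph Ω Φ D u v D' u' v') (hΦ : IsPointSymmetry Ω Φ) :
    ∀ z ∈ D, u z = pd Ex (compX Φ) (graphPoint u v z) * u' (baseComp Φ (graphPoint u v z))
      + uShift Φ (graphPoint u v z) := fun z hz => by
  rw [← h.compU_eq z hz, uShift, ← div_eq_mul_inv]
  exact (hΦ.uPullback_eq (h.mem z hz)).symm

theorem v_eq (h : MapsGraph Ω Φ D u v D' u' v') :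
    ∀ z ∈ D, v z = (pd Ev (compV Φ) (graphPoint u v z))⁻¹ * v' (baseComp Φ (graphPoint u v z))
      + vShift Φ (graphPoint u v z) := fun z hz => by
  rw [← h.compV_eq z hz, vShift, add_sub_cancel]
  rfl

theorem isBaseChange (h : MapsGraph Ω Φ D u v D' u' v') (hΦ : IsPointSymmetry Ω Φ) :
    IsBaseChange D (fun z => compT Φ (graphPoint u v z)) (fun z => compX Φ (graphPoint u v z))
      (fun z => compY Φ (graphPoint u v z)) (fun z => pd Ex (compX Φ) (graphPoint u v z))
      (fun z => uShift Φ (graphPoint u v z)) :=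
  hΦ.isBaseChange h.isOpen h.smooth_u h.smooth_v h.mem

theorem pd_ex_pd_ex_pd_ex_v (h : MapsGraph Ω Φ D u v D' u' v') (hΦ : IsPointSymmetry Ω Φ) :
    ∀ z ∈ D, pd ex (pd ex (pd ex v)) z = (pd Ev (compV Φ) (graphPoint u v z))⁻¹
      * pd Ex (compX Φ) (graphPoint u v z) ^ 3
      * pd ex (pd ex (pd ex v')) (baseComp Φ (graphPoint u v z)) := by
  have ha := hΦ.isBasic_inv_pd_Ev_compV
  have hb := hΦ.isBasic_vShift
  have hax : ∀ z ∈ D, pd ex (fun z => (pd Ev (compV Φ) (graphPoint u v z))⁻¹) z = 0 :=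
    fun z hz => by
      rw [ha.pd_graph hΦ.isOpen h.isOpen h.smooth_u h.smooth_v hz (h.mem z hz), graphLift_zero_ex,
        hΦ.pd_inv_pd_Ev_compV_eq_zero hΦ.pd_Ex_compV_eq_zero (h.mem z hz)]
  have hbx : ∀ z ∈ D, pd ex (fun z => vShift Φ (graphPoint u v z)) z = 0 := fun z hz => by
    rw [hb.pd_graph hΦ.isOpen h.isOpen h.smooth_u h.smooth_v hz (h.mem z hz), graphLift_zero_ex,
      hΦ.pd_vShift_eq_vTotal hΦ.pd_Ex_compV_eq_zero (h.mem z hz)]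
    rfl
  intro z hz
  rw [((h.isBaseChange hΦ).pd_ex_affine h.isOpen' h.baseComp_mem h.smooth_v'
    (ha.contDiffOn_graph h.smooth_u h.smooth_v h.mem) hax
    (hb.contDiffOn_graph h.smooth_u h.smooth_v h.mem) hbx h.v_eq).2.2 z hz]
  simp only [← baseComp_eq]
  ring

theorem burgers_eq (h : MapsGraph Ω Φ D u v D' u' v') (hΦ : IsPointSymmetry Ω Φ) :
    ∀ z ∈ D, burgers u z = pd Ex (compX Φ) (graphPoint u v z) ^ 3
      * burgers u' (baseComp Φ (graphPoint u v z)) + burgersTotal (uShift Φ) (graphPoint u v z) :=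
  fun z hz => by
    rw [(h.isBaseChange hΦ).burgers_eq h.isOpen' h.baseComp_mem h.smooth_u' (h.u_eq hΦ) z hz,
      burgers_graph hΦ.isBasic_uShift hΦ.isOpen h.isOpen h.smooth_u h.smooth_v h.mem z hz,
      ← baseComp_eq]
    ring

theorem pd_burgers_eq (h : MapsGraph Ω Φ D u v D' u' v') (hΦ : IsPointSymmetry Ω Φ) {z : Base}
    (hz : z ∈ D) (w : Base) :
    pd w (burgers u) z =
      pd (graphLift 0 0 w) (fun q => pd Ex (compX Φ) q ^ 3) (graphPoint u v z)
          * burgers u' (baseComp Φ (graphPoint u v z))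
        + pd Ex (compX Φ) (graphPoint u v z) ^ 3
          * (pd (graphLift 0 0 w) (compT Φ) (graphPoint u v z)
              * pd et (burgers u') (baseComp Φ (graphPoint u v z))
            + pd (graphLift 0 0 w) (compX Φ) (graphPoint u v z)
              * pd ex (burgers u') (baseComp Φ (graphPoint u v z))
            + pd (graphLift 0 0 w) (compY Φ) (graphPoint u v z)
              * pd ey (burgers u') (baseComp Φ (graphPoint u v z)))
        + pd (graphLift 0 0 w) (burgersTotal (uShift Φ)) (graphPoint u v z) := by
  have hΩ := hΦ.isOpen
  have hD := h.isOpen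
  have hp := h.mem z hz
  have hchange := h.isBaseChange hΦ
  have hs := (hΦ.isBasic_compX.pd hΩ Ex).pow hΩ 3
  have hBq := isBasic_burgersTotal hΦ.isBasic_uShift hΩ
  have hBu' := contDiffOn_burgers h.isOpen' h.smooth_u'
  have hs_graph := hs.contDiffOn_graph h.smooth_u h.smooth_v h.mem
  have hBu'_graph := hchange.contDiffOn_comp h.baseComp_mem hBu'
  rw [pd_congr hD w (h.burgers_eq hΦ) z hz]
  simp only [baseComp_eq]
  rw [pd_add hD hz (hs_graph.mul hBu'_graph) (hBq.contDiffOn_graph h.smooth_u h.smooth_v h.mem),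
    pd_mul hD hz hs_graph hBu'_graph,
    pd_comp_base hD h.isOpen' hz hchange.smooth_τ hchange.smooth_χ hchange.smooth_ψ hBu'
      h.baseComp_mem,
    hs.pd_graph hΩ hD h.smooth_u h.smooth_v hz hp, hBq.pd_graph hΩ hD h.smooth_u h.smooth_v hz hp,
    hΦ.isBasic_compT.pd_graph hΩ hD h.smooth_u h.smooth_v hz hp,
    hΦ.isBasic_compX.pd_graph hΩ hD h.smooth_u h.smooth_v hz hp,
    hΦ.isBasic_compY.pd_graph hΩ hD h.smooth_u h.smooth_v hz hp]
  ring

end MapsGraph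

theorem exists_burgers_jet (p : Total) (bt bx : ℝ) :
    ∃ u : Base → ℝ, ContDiff ℝ ∞ u ∧ u (proj p) = uTotal p ∧ (∀ z, pd ey u z = 0) ∧
      burgers u (proj p) = 0 ∧ pd et (burgers u) (proj p) = bt ∧
      pd ex (burgers u) (proj p) = bx := by
  set δt : Base → ℝ := fun z => tBase z - tTotal p with hδt
  set δx : Base → ℝ := fun z => xBase z - xTotal p with hδx
  have hδt_smooth : ContDiffOn ℝ ∞ δt Set.univ := (tBase.contDiff.sub contDiff_const).contDiffOn
  have hδx_smooth : ContDiffOn ℝ ∞ δx Set.univ := (xBase.contDiff.sub contDiff_const).contDiffOn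
  have hpδt : ∀ w z, pd w δt z = tBase w := fun w z => by
    rw [hδt, pd_sub isOpen_univ (Set.mem_univ z) tBase.contDiff.contDiffOn contDiffOn_const,
      pd_clm, pd_const, sub_zero]
  have hpδx : ∀ w z, pd w δx z = xBase w := fun w z => by
    rw [hδx, pd_sub isOpen_univ (Set.mem_univ z) xBase.contDiff.contDiffOn contDiffOn_const,
      pd_clm, pd_const, sub_zero]
  set u : Base → ℝ := fun z => uTotal p + bt / 2 * (δt z * δt z) + bx / 6 * (δx z * δx z * δx z)
  have hu : ContDiffOn ℝ ∞ u Set.univ := by fun_prop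
  have hut : ∀ w z, pd w u z = bt * tBase w * δt z + bx / 2 * xBase w * (δx z * δx z) :=
    fun w z => by
      simp (disch := fun_prop) only [u, pd_add isOpen_univ (Set.mem_univ z),
        pd_mul isOpen_univ (Set.mem_univ z), pd_const, hpδt, hpδx]
      ring
  have hburgers : burgers u = fun z =>
      bt * δt z - u z * (bx * (δx z * δx z)) + bx * δx z := by
    ext z
    have hx : ∀ z ∈ Set.univ, pd ex u z = bx / 2 * (δx z * δx z) := fun z _ => by
      rw [hut]; simp
    rw [burgers, pd_congr isOpen_univ ex hx z (Set.mem_univ z), hut, hut]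
    simp (disch := fun_prop) only [pd_mul isOpen_univ (Set.mem_univ z), pd_const, hpδx]
    simp
    ring
  refine ⟨u, contDiffOn_univ.1 hu, by simp [u, δt, δx], fun z => by rw [hut]; simp,
    by simp [hburgers, δt, δx], ?_, ?_⟩ <;>
  · rw [hburgers]
    simp (disch := fun_prop) only [pd_add isOpen_univ (Set.mem_univ (proj p)),
      pd_sub isOpen_univ (Set.mem_univ (proj p)),
      pd_mul isOpen_univ (Set.mem_univ (proj p)), pd_const, hpδt, hpδx]
    simp [δt, δx]

theorem pd_fun_const (w : Base) (c : ℝ) : pd w (fun _ => c) = fun _ => 0 :=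
  funext fun z => pd_const w c z

theorem solvesAt_const {D : Set Base} {u : Base → ℝ} (hD : IsOpen D) (hu : ContDiffOn ℝ ∞ u D)
    (huy : ∀ z ∈ D, pd ey u z = 0) (c : ℝ) : ∀ z ∈ D, SolvesAt u (fun _ => c) z := by
  intro z hz
  simp [SolvesAt, pd_fun_const, pd_ey_burgers_eq_zero hD hu huy z hz]

namespace IsPointSymmetry

variable {Ω : Set Total} {Φ : Total → Total} {p : Total}

theorem exists_image_burgers_jet (hΦ : IsPointSymmetry Ω Φ) (hp : p ∈ Ω) {u : Base → ℝ}
    (hu : ContDiff ℝ ∞ u) (hup : u (proj p) = uTotal p) (huy : ∀ z, pd ey u z = 0) :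
    ∃ b bt bx : ℝ,
      burgers u (proj p) = pd Ex (compX Φ) p ^ 3 * b + burgersTotal (uShift Φ) p ∧
      ∀ w, pd w (burgers u) (proj p) =
        pd (graphLift 0 0 w) (fun q => pd Ex (compX Φ) q ^ 3) p * b
          + pd Ex (compX Φ) p ^ 3 * (pd (graphLift 0 0 w) (compT Φ) p * bt
            + pd (graphLift 0 0 w) (compX Φ) p * bx)
          + pd (graphLift 0 0 w) (burgersTotal (uShift Φ)) p := by
  have hgraph : graphPoint u (fun _ => vTotal p) (proj p) = p :=
    Prod.ext rfl (Prod.ext rfl (Prod.ext rfl (Prod.ext hup rfl)))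
  obtain ⟨D₁, D', u', v', hz₁, -, hm, hs'⟩ := hΦ.exists_solution_image isOpen_univ hu.contDiffOn
    contDiffOn_const (solvesAt_const isOpen_univ hu.contDiffOn (fun z _ => huy z) (vTotal p))
    (Set.mem_univ (proj p)) (hgraph ▸ hp)
  have hp' := hm.baseComp_mem _ hz₁
  have hvxxx := hm.pd_ex_pd_ex_pd_ex_v hΦ _ hz₁
  have hB := hm.burgers_eq hΦ _ hz₁
  have hBw := hm.pd_burgers_eq hΦ hz₁
  rw [hgraph] at hp' hvxxx hB
  simp only [hgraph] at hBw
  have hv'xxx : pd ex (pd ex (pd ex v')) (baseComp Φ p) = 0 := by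
    simpa [pd_fun_const, hΦ.pd_Ev_compV_ne_zero hp, hΦ.pd_Ex_compX_ne_zero hp] using hvxxx
  have hB'y : pd ey (burgers u') (baseComp Φ p) = 0 := by rw [(hs' _ hp').1, hv'xxx, mul_zero]
  exact ⟨_, _, _, hB, fun w => by rw [hBw w, hB'y, mul_zero, add_zero]⟩

theorem exists_image_prescribed_burgers_jet (hΦ : IsPointSymmetry Ω Φ) (hp : p ∈ Ω) (Bt Bx : ℝ) :
    ∃ b bt bx : ℝ,
      0 = pd Ex (compX Φ) p ^ 3 * b + burgersTotal (uShift Φ) p ∧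
      Bt = pd Et (fun q => pd Ex (compX Φ) q ^ 3) p * b
        + pd Ex (compX Φ) p ^ 3 * (pd Et (compT Φ) p * bt + pd Et (compX Φ) p * bx)
        + pd Et (burgersTotal (uShift Φ)) p ∧
      Bx = pd Ex (fun q => pd Ex (compX Φ) q ^ 3) p * b
        + pd Ex (compX Φ) p ^ 3 * (pd Ex (compT Φ) p * bt + pd Ex (compX Φ) p * bx)
        + pd Ex (burgersTotal (uShift Φ)) p ∧
      0 = pd Ey (fun q => pd Ex (compX Φ) q ^ 3) p * b
        + pd Ex (compX Φ) p ^ 3 * (pd Ey (compT Φ) p * bt + pd Ey (compX Φ) p * bx)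
        + pd Ey (burgersTotal (uShift Φ)) p := by
  obtain ⟨u, hu, hup, huy, hB, hBt, hBx⟩ := exists_burgers_jet p Bt Bx
  have hBy : pd ey (burgers u) (proj p) = 0 :=
    pd_ey_burgers_eq_zero isOpen_univ hu.contDiffOn (fun z _ => huy z) _ (Set.mem_univ _)
  obtain ⟨b, bt, bx, hb, hbw⟩ := hΦ.exists_image_burgers_jet hp hu hup huy
  refine ⟨b, bt, bx, hB ▸ hb, ?_, ?_, ?_⟩
  · rw [← hBt, hbw et, graphLift_zero_et]
  · rw [← hBx, hbw ex, graphLift_zero_ex]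
  · rw [← hBy, hbw ey, graphLift_zero_ey]

-- The `t`- and `x`-derivatives of `burgers u` can be prescribed while its `y`-derivative vanishes
-- on both sides, so `ỹ` is not mixed with `t̃` and `x̃`.
theorem pd_Ey_compT_compX_eq_zero (hΦ : IsPointSymmetry Ω Φ) (hp : p ∈ Ω) :
    pd Ey (compT Φ) p = 0 ∧ pd Ey (compX Φ) p = 0 := by
  have hjet := hΦ.exists_image_prescribed_burgers_jet hp
  have hs := hΦ.pd_Ex_compX_ne_zero hp
  have hTx := (hΦ.pd_compT_eq_zero hp).1
  obtain ⟨b₀, bt₀, bx₀, hB₀, hBt₀, hBx₀, hBy₀⟩ := hjet 0 0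
  obtain ⟨b₁, bt₁, bx₁, hB₁, hBt₁, hBx₁, hBy₁⟩ := hjet 1 0
  obtain ⟨b₂, bt₂, bx₂, hB₂, -, hBx₂, hBy₂⟩ := hjet 0 1
  obtain rfl : b₁ = b₀ := mul_left_cancel₀ (pow_ne_zero 3 hs) (by linear_combination hB₀ - hB₁)
  obtain rfl : b₂ = b₁ := mul_left_cancel₀ (pow_ne_zero 3 hs) (by linear_combination hB₁ - hB₂)
  rw [hTx] at hBx₀ hBx₁ hBx₂
  obtain rfl : bx₁ = bx₀ := mul_left_cancel₀ (pow_ne_zero 4 hs)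
    (by linear_combination hBx₀ - hBx₁)
  have hT : pd Ey (compT Φ) p = 0 := by
    linear_combination
      pd Ey (compT Φ) p * (hBt₁ - hBt₀) - pd Et (compT Φ) p * (hBy₁ - hBy₀)
  rw [hT] at hBy₀ hBy₂
  exact ⟨hT, by
    linear_combination
      pd Ey (compX Φ) p * (hBx₂ - hBx₀) - pd Ex (compX Φ) p * (hBy₂ - hBy₀)⟩

end IsPointSymmetry

theorem MapsGraph.pd_ey_burgers_eq {Ω : Set Total} {Φ : Total → Total} {D D' : Set Base}
    {u v u' v' : Base → ℝ} (h : MapsGraph Ω Φ D u v D' u' v') (hΦ : IsPointSymmetry Ω Φ) :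
    ∀ z ∈ D, pd ey (burgers u) z =
      pd Ex (compX Φ) (graphPoint u v z) ^ 3 * pd Ey (compY Φ) (graphPoint u v z)
        * pd ey (burgers u') (baseComp Φ (graphPoint u v z)) := by
  have hgraph : ∀ {f : Total → ℝ}, IsBasic Ω f → ∀ z ∈ D,
      pd ey (fun z => f (graphPoint u v z)) z = pd Ey f (graphPoint u v z) := fun hf z hz => by
    rw [hf.pd_graph hΦ.isOpen h.isOpen h.smooth_u h.smooth_v hz (h.mem z hz), graphLift_zero_ey]
  intro z hz
  rw [(h.isBaseChange hΦ).pd_ey_burgers_eq h.isOpen' h.baseComp_mem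
    (fun z hz => (hgraph hΦ.isBasic_compT z hz).trans
      (hΦ.pd_Ey_compT_compX_eq_zero (h.mem z hz)).1)
    (fun z hz => (hgraph hΦ.isBasic_compX z hz).trans
      (hΦ.pd_Ey_compT_compX_eq_zero (h.mem z hz)).2) h.smooth_u' (h.u_eq hΦ) z hz,
    hgraph hΦ.isBasic_compY z hz, ← baseComp_eq]

-- The first equation of the system compares the scalings of `v_xxx` and of the `y`-derivative of
-- `burgers u`, on a solution with `v_xxx ≠ 0`.
theorem IsPointSymmetry.pd_Ev_compV_mul_pd_Ey_compY_eq_one {Ω : Set Total}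
    {Φ : Total → Total} {p : Total} (hΦ : IsPointSymmetry Ω Φ) (hp : p ∈ Ω) :
    pd Ev (compV Φ) p * pd Ey (compY Φ) p = 1 := by
  obtain ⟨_, hsol⟩ := exists_solution p one_ne_zero (2 * uTotal p) 0 0 1
  obtain ⟨D, u, v, hD, hz₀, hu, hv, hs, hgraph, -, -, -, -, hvxxx⟩ := hsol 0 0 0 0
  obtain ⟨D₁, D', u', v', hz₁, -, hm, hs'⟩ :=
    hΦ.exists_solution_image hD hu hv hs hz₀ (hgraph.symm ▸ hp)
  have hp' := hm.baseComp_mem _ hz₁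
  have hscale_v := hm.pd_ex_pd_ex_pd_ex_v hΦ _ hz₁
  have hscale_B := hm.pd_ey_burgers_eq hΦ _ hz₁
  rw [hgraph] at hp' hscale_v hscale_B
  rw [(hs _ hz₀).1, (hs' _ hp').1] at hscale_B
  rw [hvxxx] at hscale_v hscale_B
  have hVv := hΦ.pd_Ev_compV_ne_zero hp
  field_simp at hscale_v
  linear_combination (1 / 4) * hscale_B - pd Ey (compY Φ) p / 2 * hscale_v

section Factor

variable {E : Type*} [NormedAddCommGroup E] [NormedSpace ℝ E] {Ω : Set E} {f : E → ℝ}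

theorem eq_of_pd_eq_zero (hΩ : IsOpen Ω) (hc : Convex ℝ Ω) (hf : ContDiffOn ℝ ∞ f Ω) {p q : E}
    (hp : p ∈ Ω) (hq : q ∈ Ω) (h : ∀ z ∈ Ω, pd (q - p) f z = 0) : f q = f p := by
  obtain ⟨z, hz, heq⟩ := domain_mvt
    (fun z hz => (differentiableAt_of_mem hΩ hz hf).hasFDerivAt.hasFDerivWithinAt) hc hp hq
  exact sub_eq_zero.1 (heq.trans (h z (hc.segment_subset hp hq hz)))

theorem contDiffOn_of_comp_clm (hΩ : IsOpen Ω) (hf : ContDiffOn ℝ ∞ f Ω) {L : E →L[ℝ] ℝ} {e : E}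
    (he : L e = 1) {g : ℝ → ℝ} (hg : ∀ q ∈ Ω, g (L q) = f q) : ContDiffOn ℝ ∞ g (L '' Ω) := by
  rintro _ ⟨q, hq, rfl⟩
  set γ : ℝ → E := fun s => q + (s - L q) • e with hγ
  have hγ_smooth : ContDiff ℝ ∞ γ := by fun_prop
  have hγq : γ (L q) = q := by simp [hγ]
  have hLγ : ∀ s, L (γ s) = s := fun s => by simp [hγ, he]
  have hγΩ : ∀ᶠ s in nhds (L q), γ s ∈ Ω :=
    hγ_smooth.continuous.continuousAt.eventually_mem (hγq.symm ▸ hΩ.mem_nhds hq)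
  have hfγ : ContDiffAt ℝ ∞ (fun s => f (γ s)) (L q) :=
    ContDiffAt.comp (L q) (hγq.symm ▸ contDiffAt_of_mem hΩ hq hf) hγ_smooth.contDiffAt
  refine (hfγ.congr_of_eventuallyEq ?_).contDiffWithinAt
  filter_upwards [hγΩ] with s hs
  rw [← hg _ hs, hLγ]

theorem exists_eq_comp_clm (hΩ : IsOpen Ω) (hc : Convex ℝ Ω) (hf : ContDiffOn ℝ ∞ f Ω)
    {L : E →L[ℝ] ℝ} {e : E} (he : L e = 1) (h : ∀ w, L w = 0 → ∀ q ∈ Ω, pd w f q = 0) :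
    ∃ g : ℝ → ℝ, ContDiffOn ℝ ∞ g (L '' Ω) ∧ ∀ q ∈ Ω, g (L q) = f q := by
  have hg : ∀ q ∈ Ω, f (Function.invFunOn L Ω (L q)) = f q := fun q hq =>
    have hq' : L q ∈ L '' Ω := Set.mem_image_of_mem L hq
    eq_of_pd_eq_zero hΩ hc hf hq (Function.invFunOn_mem hq') fun z hz =>
      h _ (by rw [map_sub, Function.invFunOn_eq hq', sub_self]) z hz
  exact ⟨_, contDiffOn_of_comp_clm (g := fun s => f (Function.invFunOn L Ω s)) hΩ hf he hg, hg⟩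

theorem deriv_of_comp_clm (hΩ : IsOpen Ω) {L : E →L[ℝ] ℝ} (hL : IsOpen (L '' Ω)) {e : E}
    (he : L e = 1) {g : ℝ → ℝ} (hg : ContDiffOn ℝ ∞ g (L '' Ω)) (h : ∀ q ∈ Ω, g (L q) = f q) :
    ∀ q ∈ Ω, deriv g (L q) = pd e f q := fun q hq => by
  rw [← pd_congr hΩ e h q hq, pd_comp_clm hL hg L (Set.mem_image_of_mem L hq) e, he, one_mul]

end Factor

namespace IsBasic

variable {Ω : Set Total} {f : Total → ℝ}

theorem exists_eq_comp_tTotal (hf : IsBasic Ω f) (hΩ : IsOpen Ω) (hc : Convex ℝ Ω)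
    (hx : ∀ p ∈ Ω, BLP.pd Ex f p = 0) (hy : ∀ p ∈ Ω, BLP.pd Ey f p = 0) :
    ∃ g : ℝ → ℝ, ContDiffOn ℝ ∞ g (tTotal '' Ω) ∧ (∀ p ∈ Ω, g (tTotal p) = f p) ∧
      ∀ p ∈ Ω, deriv g (tTotal p) = BLP.pd Et f p := by
  have he : tTotal Et = 1 := rfl
  obtain ⟨g, hg, hgf⟩ := exists_eq_comp_clm hΩ hc hf.smooth he fun w hw p hp => by
    rw [pd_eq_sum, hw, hx p hp, hy p hp, hf.pd_Eu p hp, hf.pd_Ev p hp]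
    ring
  exact ⟨g, hg, hgf, deriv_of_comp_clm hΩ (isOpen_image_tTotal hΩ) he hg hgf⟩

theorem exists_eq_comp_yTotal (hf : IsBasic Ω f) (hΩ : IsOpen Ω) (hc : Convex ℝ Ω)
    (ht : ∀ p ∈ Ω, BLP.pd Et f p = 0) (hx : ∀ p ∈ Ω, BLP.pd Ex f p = 0) :
    ∃ g : ℝ → ℝ, ContDiffOn ℝ ∞ g (yTotal '' Ω) ∧ (∀ p ∈ Ω, g (yTotal p) = f p) ∧
      ∀ p ∈ Ω, deriv g (yTotal p) = BLP.pd Ey f p := by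
  have he : yTotal Ey = 1 := rfl
  obtain ⟨g, hg, hgf⟩ := exists_eq_comp_clm hΩ hc hf.smooth he fun w hw p hp => by
    rw [pd_eq_sum, hw, ht p hp, hx p hp, hf.pd_Eu p hp, hf.pd_Ev p hp]
    ring
  exact ⟨g, hg, hgf, deriv_of_comp_clm hΩ (isOpen_image_yTotal hΩ) he hg hgf⟩

end IsBasic

theorem isBasic_xTotal (Ω : Set Total) : IsBasic Ω xTotal :=
  ⟨xTotal.contDiff.contDiffOn, fun p _ => pd_clm xTotal Eu p, fun p _ => pd_clm xTotal Ev p⟩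

namespace IsPointSymmetry

variable {Ω : Set Total} {Φ : Total → Total}

theorem exists_compX_eq (hΦ : IsPointSymmetry Ω Φ) (hc : Convex ℝ Ω) :
    ∃ S X₀ : ℝ → ℝ, ContDiffOn ℝ ∞ S (tTotal '' Ω) ∧ ContDiffOn ℝ ∞ X₀ (tTotal '' Ω) ∧
      (∀ p ∈ Ω, pd Ex (compX Φ) p = S (tTotal p)) ∧
      (∀ p ∈ Ω, compX Φ p = S (tTotal p) * xTotal p + X₀ (tTotal p)) ∧
      ∀ p ∈ Ω, pd Et (compX Φ) p = deriv S (tTotal p) * xTotal p + deriv X₀ (tTotal p) := by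
  have hΩ := hΦ.isOpen
  have hX := hΦ.isBasic_compX
  have hXx := hX.pd hΩ Ex
  have hXxx := fun p (hp : p ∈ Ω) => hΦ.pd_Ex_pd_Ex_compX_eq_zero hp
  have hXy := fun p (hp : p ∈ Ω) => (hΦ.pd_Ey_compT_compX_eq_zero hp).2
  have hXxy := pd_pd_eq_zero hΩ hX.smooth hXy Ex
  have hx := isBasic_xTotal Ω
  have hpd_rest : ∀ (w : Total) (p : Total), p ∈ Ω →
      pd w (fun p => compX Φ p - pd Ex (compX Φ) p * xTotal p) p = pd w (compX Φ) p
        - (pd Ex (compX Φ) p * xTotal w + xTotal p * pd w (pd Ex (compX Φ)) p) :=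
    fun w p hp => by
      rw [pd_sub hΩ hp hX.smooth (hXx.smooth.mul hx.smooth), pd_mul hΩ hp hXx.smooth hx.smooth,
        pd_clm]
  obtain ⟨S, hS, hSX, hS'⟩ := hXx.exists_eq_comp_tTotal hΩ hc hXxx hXxy
  obtain ⟨X₀, hX₀, hX₀X, hX₀'⟩ := (hX.sub (hXx.mul hx hΩ) hΩ).exists_eq_comp_tTotal hΩ hc
    (fun p hp => by rw [hpd_rest Ex p hp, hXxx p hp]; simp)
    (fun p hp => by rw [hpd_rest Ey p hp, hXy p hp, hXxy p hp]; simp)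
  refine ⟨S, X₀, hS, hX₀, fun p hp => (hSX p hp).symm, fun p hp => ?_, fun p hp => ?_⟩
  · rw [hSX p hp, hX₀X p hp]
    ring
  · rw [hS' p hp, hX₀' p hp, hpd_rest Et p hp]
    simp
    ring

theorem exists_hasFormWith (hΦ : IsPointSymmetry Ω Φ) (hc : Convex ℝ Ω) :
    ∃ T S X₀ Y V₀, HasFormWith Ω Φ T S X₀ Y V₀ := by
  have hΩ := hΦ.isOpen
  obtain ⟨T, hT, hTΦ, hT'⟩ := hΦ.isBasic_compT.exists_eq_comp_tTotal hΩ hc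
    (fun p hp => (hΦ.pd_compT_eq_zero hp).1) fun p hp => (hΦ.pd_Ey_compT_compX_eq_zero hp).1
  obtain ⟨S, X₀, hS, hX₀, hSX, hXΦ, hXt⟩ := hΦ.exists_compX_eq hc
  obtain ⟨Y, hY, hYΦ, hY'⟩ := hΦ.isBasic_compY.exists_eq_comp_yTotal hΩ hc
    (fun p hp => hΦ.pd_Et_compY_eq_zero hp) fun p hp => (hΦ.pd_compY_eq_zero hp).1
  obtain ⟨b, hb, hbΦ, -⟩ := hΦ.isBasic_vShift.exists_eq_comp_yTotal hΩ hc
    (fun p hp => hΦ.pd_vShift_eq_vTotal (fun q hq => hΦ.pd_Et_compV_eq_zero hq) hp)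
    fun p hp => hΦ.pd_vShift_eq_vTotal hΦ.pd_Ex_compV_eq_zero hp
  have hS0 : ∀ p ∈ Ω, S (tTotal p) ≠ 0 := fun p hp => hSX p hp ▸ hΦ.pd_Ex_compX_ne_zero hp
  have hY0 : ∀ p ∈ Ω, deriv Y (yTotal p) ≠ 0 := fun p hp =>
    (hY' p hp).symm ▸ hΦ.pd_Ey_compY_ne_zero hp
  have hYsmooth := hY.deriv_of_isOpen (m := ∞) (isOpen_image_yTotal hΩ) (by simp)
  refine ⟨T, S, X₀, Y, fun y => -b y / deriv Y y, hΩ, hT, hS, hX₀, hY,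
    hb.neg.div hYsmooth (Set.forall_mem_image.2 hY0), Set.forall_mem_image.2 fun p hp => ?_,
    Set.forall_mem_image.2 hS0, Set.forall_mem_image.2 hY0, fun p hp => ?_⟩
  · rw [hT' p hp, ← hΦ.pd_Ex_compX_sq hp, hSX p hp]
  have hSp := hS0 p hp
  have hYp := hY0 p hp
  have hU : uTotal p = S (tTotal p) * compU Φ p
      + (deriv S (tTotal p) * xTotal p + deriv X₀ (tTotal p)) / (2 * S (tTotal p)) := by
    rw [← hΦ.uPullback_eq hp, uPullback, hSX p hp, hXt p hp]
  have hV : vTotal p - b (yTotal p) = deriv Y (yTotal p) * compV Φ p := by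
    have hVv := eq_inv_of_mul_eq_one_right (hΦ.pd_Ev_compV_mul_pd_Ey_compY_eq_one hp)
    rw [hbΦ p hp, vShift, sub_sub_cancel, hY' p hp, hVv]
  refine Prod.ext (hTΦ p hp).symm (Prod.ext (hXΦ p hp) (Prod.ext (hYΦ p hp).symm
    (Prod.ext (?_ : compU Φ p = _) (?_ : compV Φ p = _))))
  · rw [hU]
    field_simp
    ring
  · rw [← add_div, ← sub_eq_add_neg, hV, mul_div_cancel_left₀ _ hYp]

theorem mono (hΦ : IsPointSymmetry Ω Φ) {Ω' : Set Total} (hΩ' : IsOpen Ω') (h : Ω' ⊆ Ω) :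
    IsPointSymmetry Ω' Φ where
  isOpen := hΩ'
  smooth := hΦ.smooth.mono h
  jacobian_ne_zero p hp := hΦ.jacobian_ne_zero p (h hp)
  solves_iff D D' u v u' v' hD hD' hu hv hu' hv' hg :=
    hΦ.solves_iff D D' u v u' v' hD hD' hu hv hu' hv' fun z hz => h (hg z hz)

theorem hasForm (hΦ : IsPointSymmetry Ω Φ) (hc : Convex ℝ Ω) : HasForm Ω Φ := by
  obtain ⟨_, _, _, _, _, h⟩ := hΦ.exists_hasFormWith hc
  exact h.hasForm hc.isPreconnected

end IsPointSymmetry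

end BLP

/-- The complete point-symmetry pseudogroup of the Boiti–Leon–Pempinelli system consists exactly of
the transformations of the stated form: on an arbitrary open set this holds near every point, and
on a convex open set the form is global. -/
theorem theorem1 (Ω : Set BLP.Total) (hΩ : IsOpen Ω) (Φ : BLP.Total → BLP.Total) :
    (BLP.IsPointSymmetry Ω Φ ↔
      ∀ p ∈ Ω, ∃ Ω' : Set BLP.Total, IsOpen Ω' ∧ p ∈ Ω' ∧ Ω' ⊆ Ω ∧ BLP.HasForm Ω' Φ) ∧
    (Convex ℝ Ω → (BLP.IsPointSymmetry Ω Φ ↔ BLP.HasForm Ω Φ)) := by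
  refine ⟨⟨fun hΦ p hp => ?_, BLP.isPointSymmetry_of_locally_hasForm hΩ⟩, fun hc =>
    ⟨fun hΦ => hΦ.hasForm hc, fun h => BLP.isPointSymmetry_of_locally_hasForm hΩ fun p hp =>
      ⟨Ω, hΩ, hp, subset_rfl, h⟩⟩⟩
  obtain ⟨r, hr, hball⟩ := Metric.isOpen_iff.1 hΩ p hp
  exact ⟨Metric.ball p r, Metric.isOpen_ball, Metric.mem_ball_self hr, hball,
    (hΦ.mono Metric.isOpen_ball hball).hasForm (convex_ball p r)⟩
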